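/- A graph property $\Pi$ is an isomorphism-closed collection of finite graphs. It is characterized by $c_\Pi$ adjacencies if for every $H\in\Pi$ and every $v\in V(H)$ there is a set $D\subseteq V(H)\setminus\{v\}$ with $|D|\le c_\Pi$ such that every graph obtained from $H$ by adding or removing edges between $v$ and vertices of $V(H)\setminus D$ is also in $\Pi$. A graph $H\in\Pi$ is vertex-minimal with respect to $\Pi$ if no proper induced subgraph of $H$ is in $\Pi$. An instance of $\Pi$-free Deletion [VC] is a graph $G$ on $n$ vertices, a vertex cover $X$ of $G$ with $|X|=K$, and an integer $0\le\ell\le n$; the question is whether there is a set $S\subseteq V(G)$ with $|S|\le\ell$ such that no induced subgraph of $G-S$ is isomorphic to a graph in $\Pi$. Suppose that every graph in $\Pi$ is connected and contains at least one edge, that $\Pi$ is characterized by $c_\Pi$ adjacencies, and that the algorithm is given explicitly (by adjacency matrices) the list $\Pi'$ of the $q\ge 1$ graphs, up to isomorphism, that have at most $(c_\Pi+1)K$ vertices and are vertex-minimal with respect to $\Pi$. Then the following hold; in each part one algorithm works for all $\Pi$, $c_\Pi$ and all instances, and the constants hidden in the $O$-notation are absolute. 1. On a word RAM with words of logarithmic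 length (that is, for some absolute constant $d$, for every word length $w$ with $2^w\ge N^d$, where $N$ is the number of memory cells of the input), with $G$ given by its adjacency matrix, $\Pi$-free Deletion [VC] can be solved in time $$O\bigl(q\cdot 2^K\cdot((c_\Pi+1)K)^K\cdot K!\cdot K\cdot((c_\Pi+1)K)!\cdot((c_\Pi+1)K)^2\cdot n\bigr),$$ and the same algorithm runs in time $$O\bigl(q\cdot 2^K\cdot c_\Pi^K\cdot K^{K+3}\cdot K!\cdot(c_\Pi K)!\cdot n\bigr).$$ 2. In the adjacency list (AL) streaming model, where in every pass the vertices come in some order and all edges incident to a vertex are presented consecutively when it comes, and where $n$, $K$, $\ell$, $q$, $X$ and $\Pi'$ are initially stored in the memory (and count towards the space), $\Pi$-free Deletion [VC] can be solved with $$O\bigl(q\cdot 2^K\cdot c_\Pi^K\cdot K^{K+2}\cdot K!\cdot(c_\Pi K)!\bigr)$$ passes and $\tilde O\bigl(q\cdot(c_\Pi K)^2\bigr)$ bits of space, where $\tilde O$ hides factors polylogarithmic in $n$. -/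

import Mathlib

namespace PiDel

/-! ### Graph properties and the deletion problem -/

/-- A finite graph, presented on the vertex set `Fin m`. -/
structure FinGraph where
  m : ℕ
  graph : SimpleGraph (Fin m)

/-- A graph property: an isomorphism-closed (possibly infinite) collection of finite graphs. -/
structure GraphProperty where
  holds : ∀ {m : ℕ}, SimpleGraph (Fin m) → Prop
  iso_closed : ∀ {m k : ℕ} (H : SimpleGraph (Fin m)) (H' : SimpleGraph (Fin k)),
    Nonempty (H ≃g H') → holds H → holds H'

/-- Membership in the property for a graph on an arbitrary vertex type. -/
def GraphProperty.Has (P : GraphProperty) {V : Type} (G : SimpleGraph V) : Prop :=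
  ∃ (m : ℕ) (H : SimpleGraph (Fin m)), P.holds H ∧ Nonempty (H ≃g G)

/-- `G` is `P`-free: no graph of `P` is isomorphic to an induced subgraph of `G`. -/
def GraphProperty.Free (P : GraphProperty) {V : Type} (G : SimpleGraph V) : Prop :=
  ∀ (m : ℕ) (H : SimpleGraph (Fin m)), P.holds H → ¬ H.IsIndContained G

/-- `P` is characterized by `c` adjacencies: for every `H` in `P` and every vertex `v` of `H` there
is a set `D` of at most `c` vertices other than `v` such that every graph obtained from `H` by
adding or removing edges between `v` and vertices outside `D` is also in `P`. -/
def GraphProperty.CharacterizedBy (P : GraphProperty) (c : ℕ) : Prop :=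
  ∀ (m : ℕ) (H : SimpleGraph (Fin m)), P.holds H → ∀ v : Fin m,
    ∃ D : Finset (Fin m), v ∉ D ∧ D.card ≤ c ∧
      ∀ H' : SimpleGraph (Fin m),
        (∀ x y, x ≠ v → y ≠ v → (H'.Adj x y ↔ H.Adj x y)) →
        (∀ u ∈ D, H'.Adj v u ↔ H.Adj v u) →
        P.holds H'

/-- `H` is vertex-minimal with respect to `P`: it is in `P`, and no proper induced subgraph is. -/
def GraphProperty.VertexMinimal (P : GraphProperty) (H : FinGraph) : Prop :=
  P.holds H.graph ∧
    ∀ S : Set (Fin H.m), S ≠ Set.univ → ¬ P.Has (H.graph.induce S)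

/-- `F` is an explicit list, up to isomorphism, of the graphs on at most `p` vertices that are
vertex-minimal with respect to `P`. -/
def GraphProperty.ListsMinimal (P : GraphProperty) (p : ℕ) (F : List FinGraph) : Prop :=
  (∀ H ∈ F, P.VertexMinimal H ∧ H.m ≤ p) ∧
  (∀ H : FinGraph, P.VertexMinimal H → H.m ≤ p → ∃ H' ∈ F, Nonempty (H.graph ≃g H'.graph))

/-- An instance: a graph on `n` vertices, a vertex cover `X` of it, and a budget `ℓ ≤ n`. -/
structure Inst where
  n : ℕ
  G : SimpleGraph (Fin n)
  X : Finset (Fin n)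
  cover : G.IsVertexCover (X : Set (Fin n))
  ℓ : ℕ
  budget_le : ℓ ≤ n

/-- The parameter: the size of the given vertex cover. -/
def Inst.K (I : Inst) : ℕ := I.X.card

/-- The question: can one delete at most `ℓ` vertices so that the rest is `P`-free? -/
def Inst.IsYes (I : Inst) (P : GraphProperty) : Prop :=
  ∃ S : Finset (Fin I.n), S.card ≤ I.ℓ ∧ P.Free (I.G.induce {v | v ∉ S})

/-! ### The machine: while programs over a random access memory, with a read-only stream -/

/-- Primitive operations (`lt` and `eq` give `0` or `1`; `sub` is truncated). -/
inductive Op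
  | add | sub | mul | div | mod | lt | eq

def Op.eval : Op → ℕ → ℕ → ℕ
  | .add, x, y => x + y
  | .sub, x, y => x - y
  | .mul, x, y => x * y
  | .div, x, y => x / y
  | .mod, x, y => x % y
  | .lt, x, y => if x < y then 1 else 0
  | .eq, x, y => if x = y then 1 else 0

/-- Programs. Registers have fixed numbers; memory is addressed through registers. -/
inductive Prog
  /-- `reg r := k` -/
  | const (r k : ℕ)
  /-- `reg r := reg a ∘ reg b` -/
  | op (o : Op) (r a b : ℕ)
  /-- `reg r := mem (reg a)` -/
  | load (r a : ℕ)
  /-- `mem (reg a) := reg r` -/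
  | store (a r : ℕ)
  | seq (p q : Prog)
  /-- branch on `reg r ≠ 0` -/
  | ite (r : ℕ) (p q : Prog)
  /-- repeat while `reg r ≠ 0` -/
  | loop (r : ℕ) (p : Prog)
  /-- read the next stream item `(a, b)`: `reg e := 1`, `reg u := a`, `reg v := b`; at the end of
  the pass only `reg e := 0` -/
  | next (e u v : ℕ)
  /-- start a new pass over the stream -/
  | rewind

/-- A machine state. `rest` is the unread part of the stream in the current pass; `time` and
`passes` are counters that programs cannot read. -/
structure State where
  reg : ℕ → ℕ
  mem : ℕ → ℕ
  rest : List (ℕ × ℕ)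
  time : ℕ
  passes : ℕ

/-- The initial state: the input in the memory cells `0, 1, 2, …`, everything else zero, and no
pass begun. -/
def State.start (input : List ℕ) : State where
  reg := fun _ => 0
  mem := fun a => input.getD a 0
  rest := []
  time := 0
  passes := 0

def State.tick (s : State) : State := { s with time := s.time + 1 }

def State.setReg (s : State) (r x : ℕ) : State := { s with reg := Function.update s.reg r x }

def State.setMem (s : State) (a x : ℕ) : State := { s with mem := Function.update s.mem a x }

/-- The number of bits that each register and each memory cell can hold
(a cell with `0` bits can hold only the value `0`). -/
structure Layout where
  reg : ℕ → ℕ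
  mem : ℕ → ℕ

/-- The word RAM with word length `w`: all registers and the `2 ^ w` memory cells hold one word. -/
def Layout.word (w : ℕ) : Layout where
  reg := fun _ => w
  mem := fun a => if a < 2 ^ w then w else 0

/-- The layout provides at most `M` bits in total: all storage lies in the first `R` registers and
the first `B` memory cells, and each of these counts for at least one bit. -/
def Layout.BitsAtMost (L : Layout) (M : ℕ) : Prop :=
  ∃ R B : ℕ, (∀ r, R ≤ r → L.reg r = 0) ∧ (∀ a, B ≤ a → L.mem a = 0) ∧
    (∑ r ∈ Finset.range R, max 1 (L.reg r)) + (∑ a ∈ Finset.range B, max 1 (L.mem a)) ≤ M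

/-- The memory contents `input` can be held by the layout. -/
def Layout.Holds (L : Layout) (input : List ℕ) : Prop :=
  ∀ a, input.getD a 0 < 2 ^ L.mem a

/-- `Exec L σ p s s'`: the program `p`, run from `s` with storage `L` on the stream `σ`, halts in
`s'`. Each primitive instruction and each test takes one time step. A value that does not fit in
its destination makes the program get stuck, so that it has no halting run. -/
inductive Exec (L : Layout) (σ : List (ℕ × ℕ)) : Prog → State → State → Prop
  | const {s : State} {r k : ℕ} (h : k < 2 ^ L.reg r) :
      Exec L σ (.const r k) s (s.tick.setReg r k)
  | op {s : State} {o : Op} {r a b : ℕ} (h : o.eval (s.reg a) (s.reg b) < 2 ^ L.reg r) :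
      Exec L σ (.op o r a b) s (s.tick.setReg r (o.eval (s.reg a) (s.reg b)))
  | load {s : State} {r a : ℕ} (h : s.mem (s.reg a) < 2 ^ L.reg r) :
      Exec L σ (.load r a) s (s.tick.setReg r (s.mem (s.reg a)))
  | store {s : State} {a r : ℕ} (h : s.reg r < 2 ^ L.mem (s.reg a)) :
      Exec L σ (.store a r) s (s.tick.setMem (s.reg a) (s.reg r))
  | seq {p q : Prog} {s s' s'' : State} (hp : Exec L σ p s s') (hq : Exec L σ q s' s'') :
      Exec L σ (.seq p q) s s''
  | ite_true {p q : Prog} {s s' : State} {r : ℕ} (h : s.reg r ≠ 0)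
      (hp : Exec L σ p s.tick s') : Exec L σ (.ite r p q) s s'
  | ite_false {p q : Prog} {s s' : State} {r : ℕ} (h : s.reg r = 0)
      (hq : Exec L σ q s.tick s') : Exec L σ (.ite r p q) s s'
  | loop_true {p : Prog} {s s' s'' : State} {r : ℕ} (h : s.reg r ≠ 0)
      (hp : Exec L σ p s.tick s') (hl : Exec L σ (.loop r p) s' s'') :
      Exec L σ (.loop r p) s s''
  | loop_false {p : Prog} {s : State} {r : ℕ} (h : s.reg r = 0) :
      Exec L σ (.loop r p) s s.tick
  | next_item {s : State} {e u v a b : ℕ} {l : List (ℕ × ℕ)} (hs : s.rest = (a, b) :: l)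
      (he : 1 < 2 ^ L.reg e) (hu : a < 2 ^ L.reg u) (hv : b < 2 ^ L.reg v) :
      Exec L σ (.next e u v) s
        { ((s.tick.setReg e 1).setReg u a).setReg v b with rest := l }
  | next_end {s : State} {e u v : ℕ} (hs : s.rest = []) :
      Exec L σ (.next e u v) s (s.tick.setReg e 0)
  | rewind {s : State} :
      Exec L σ .rewind s { s.tick with rest := σ, passes := s.passes + 1 }

/-! ### Inputs -/

open Classical in
/-- The adjacency matrix of a graph on `Fin m`, row by row, as `m * m` zeros and ones. -/
noncomputable def matrixCells {m : ℕ} (G : SimpleGraph (Fin m)) : List ℕ :=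
  (List.finRange m).flatMap fun i => (List.finRange m).map fun j => if G.Adj i j then 1 else 0

/-- The explicit description of a list of graphs: each graph by its number of vertices and its
adjacency matrix. -/
noncomputable def familyCells (F : List FinGraph) : List ℕ :=
  F.flatMap fun H => H.m :: matrixCells H.graph

/-- The numbers `n`, `K`, `ℓ`, `q` and the vertices of the vertex cover. -/
def Inst.headCells (I : Inst) (q : ℕ) : List ℕ :=
  [I.n, I.K, I.ℓ, q] ++ (I.X.sort (· ≤ ·)).map Fin.val

/-- Input of the random access algorithm: parameters, vertex cover, adjacency matrix of the graph,
and the explicit family `F`. -/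
noncomputable def Inst.ramInput (I : Inst) (F : List FinGraph) : List ℕ :=
  I.headCells F.length ++ matrixCells I.G ++ familyCells F

/-- Initial memory of the streaming algorithm: as above, but without the graph, which is available
only through the stream. -/
noncomputable def Inst.streamInput (I : Inst) (F : List FinGraph) : List ℕ :=
  I.headCells F.length ++ familyCells F

/-- `σ` is an adjacency list (AL) stream of `G`: the vertices come in some order, and for each
vertex `v` all pairs `(v, u)` with `u` a neighbour of `v` come consecutively, in some order. -/
def IsALStream {n : ℕ} (G : SimpleGraph (Fin n)) (σ : List (ℕ × ℕ)) : Prop :=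
  ∃ (order : List (Fin n)) (nbrs : Fin n → List (Fin n)),
    order.Nodup ∧ (∀ v, v ∈ order) ∧
    (∀ v, (nbrs v).Nodup ∧ ∀ u, u ∈ nbrs v ↔ G.Adj v u) ∧
    σ = order.flatMap fun v => (nbrs v).map fun u => (v.val, u.val)

end PiDel

namespace PiDel

/-! ### Expressions and their compilation -/

/-! Only the listed graphs matter. Let a graph of Π have a vertex cover Y. Delete, at one vertex y
of Y after the other, all edges leaving a set of at most c vertices; the graph stays in Π, so it is
still connected with an edge, and every vertex outside Y is one of at most c remaining neighbours of
some y. This gives at most (c+1)|Y| vertices (`GraphProperty.CharacterizedBy.card_le_of_cover`). The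
part of an induced copy lying in X covers the copy, so a smallest copy from Π is on the list
(`Inst.free_iff`). If ℓ ≥ K, deleting X settles the matter.

To find an induced copy of a listed H avoiding S, guess for each cover vertex which vertex of H it
represents, if any, and choose the images of the vertices of H greedily. Vertices outside X are
independent, so such a vertex matters only through its neighbours among the used cover vertices; two
legal images of the same vertex can be exchanged in any embedding, and greedy choice loses nothing
(`Tst.Legal.complete`, with converse `Tst.Legal.sound`). One image is found by one scan of the
edges, since legality can be read off a weighted count of edges into the cover
(`Tst.scans_of_blocks`). Isolated vertices of G never show up in the stream, but are never needed,
because graphs of Π have no isolated vertices.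

Every solution meets every copy found, so one branches on the vertices of the copy, to depth ℓ < K
(`Prob.Legal.exists_wins`). The branches are enumerated as ℓ-digit numbers in a base B larger than
all listed graphs, and the guesses as K-digit numbers. With B ≤ 3cK the number of scans is at most
q(3cK)^(2K+3), which `exists_search_bound` compares with the claimed product.

The programs are verified with a total-correctness triple `Tri` that tracks values, their fitting
into storage, and cost at once. Cost is α·time + β·passes, so one correctness proof (`branch_tri`,
`main_exec`) yields the time bound with weights (1, 0) and the pass bound with (0, 1); only the code
that delivers the items of a scan differs (`ram_drive`, `stream_drive`). -/

/-- Expressions over numbered variables and the memory. -/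
inductive E
  | c (k : ℕ)
  | v (r : ℕ)
  | op (o : Op) (a b : E)
  | ld (a : E)

/-- The state seen by a program written with expressions: variables, memory, unread stream, and a
bound on the cost so far. -/
@[ext] structure US where
  v : ℕ → ℕ
  m : ℕ → ℕ
  rest : List (ℕ × ℕ)
  c : ℕ

def US.set (u : US) (r x : ℕ) : US := { u with v := Function.update u.v r x }

def US.tick (u : US) (k : ℕ) : US := { u with c := u.c + k }

def US.store (u : US) (a x : ℕ) : US := { u with m := Function.update u.m a x }

@[simp] theorem US.set_v (u : US) (r x y : ℕ) :
    (u.set r x).v y = if y = r then x else u.v y := by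
  simp [US.set, Function.update_apply]

@[simp] theorem US.set_m (u : US) (r x : ℕ) : (u.set r x).m = u.m := rfl
@[simp] theorem US.set_rest (u : US) (r x : ℕ) : (u.set r x).rest = u.rest := rfl
@[simp] theorem US.set_c (u : US) (r x : ℕ) : (u.set r x).c = u.c := rfl
@[simp] theorem US.tick_v (u : US) (k : ℕ) : (u.tick k).v = u.v := rfl
@[simp] theorem US.tick_m (u : US) (k : ℕ) : (u.tick k).m = u.m := rfl
@[simp] theorem US.tick_rest (u : US) (k : ℕ) : (u.tick k).rest = u.rest := rfl
@[simp] theorem US.tick_c (u : US) (k : ℕ) : (u.tick k).c = u.c + k := rfl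
@[simp] theorem US.store_v (u : US) (a x : ℕ) : (u.store a x).v = u.v := rfl
@[simp] theorem US.store_m (u : US) (a x y : ℕ) :
    (u.store a x).m y = if y = a then x else u.m y := by
  simp [US.store, Function.update_apply]
@[simp] theorem US.store_rest (u : US) (a x : ℕ) : (u.store a x).rest = u.rest := rfl
@[simp] theorem US.store_c (u : US) (a x : ℕ) : (u.store a x).c = u.c := rfl

namespace E

def eval (u : US) : E → ℕ
  | .c k => k
  | .v r => u.v r
  | .op o a b => o.eval (a.eval u) (b.eval u)
  | .ld a => u.m (a.eval u)

/-- If all variables and memory cells are at most `V`, the value is at most `V ^ deg`. -/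
def deg : E → ℕ
  | .c _ => 1
  | .v _ => 1
  | .op .add a b => max a.deg b.deg + 1
  | .op .sub a _ => a.deg
  | .op .mul a b => a.deg + b.deg
  | .op .div a _ => a.deg
  | .op .mod a _ => a.deg
  | .op .lt _ _ => 1
  | .op .eq _ _ => 1
  | .ld _ => 1

/-- A left operand waits in its register while the right one is evaluated one register higher; this
counts how far evaluation climbs. -/
def depth : E → ℕ
  | .c _ => 0
  | .v _ => 0
  | .op _ a b => max a.depth (b.depth + 1)
  | .ld a => a.depth

/-- The number of primitive instructions in the compiled code. -/
def size : E → ℕ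
  | .c _ => 1
  | .v _ => 2
  | .op _ a b => a.size + b.size + 1
  | .ld a => a.size + 1

/-- Constants up to 16 are below the assumed lower bound on `V`, and degree at most 12 at every
operator keeps all intermediate values within `V ^ 12`, which every register can hold. -/
def wf : E → Bool
  | .c k => decide (k ≤ 16)
  | .v r => decide (r < 32)
  | .op o a b => a.wf && b.wf && decide ((E.op o a b).deg ≤ 12)
  | .ld a => a.wf

/-- The depth bound keeps evaluation from register 32 or 33 below register 63; the size bound lets a
flat charge of 100 steps per expression pay for a simple statement. -/
def ok (e : E) : Bool := e.wf && decide (e.depth < 30) && decide (e.size ≤ 90)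

/-- Code that puts the value of the expression into register `t`, using registers from `t` on. -/
def code : E → ℕ → Prog
  | .c k, t => .const t k
  | .v r, t => .seq (.const t 0) (.op .add t t r)
  | .op o a b, t => .seq (a.code t) (.seq (b.code (t + 1)) (.op o t t (t + 1)))
  | .ld a, t => .seq (a.code t) (.load t t)

end E

/-! ### Configurations and the triple -/

/-- What is fixed during a run: the layout, the stream, the cost weights of time steps and passes,
bounds on the values of variables and of work cells, the work area, the input, and the values of
the constant variables from `p` on. -/
structure Cfg where
  L : Layout
  σ : List (ℕ × ℕ)
  α : ℕ
  β : ℕ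
  V : ℕ
  Vm : ℕ
  W0 : ℕ
  ws : ℕ
  inp : ℕ → ℕ
  p : ℕ
  g : ℕ → ℕ
  hV : 16 ≤ V
  hreg : ∀ r < 64, V ^ 12 < 2 ^ L.reg r
  hinp : ∀ a < W0, inp a ≤ V
  hVm : Vm ≤ V
  hmem : ∀ a, W0 ≤ a → a < W0 + ws → Vm < 2 ^ L.mem a
  hp : p ≤ 32

/-- The cost of a simple statement. -/
def Cfg.κ (C : Cfg) : ℕ := 100 * C.α

/-- Work cells have their own bound `Vm`, usually far below `V`, because the streaming algorithm
pays for the bits of each of them. `glob` makes the variables from `p` on available as known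
constants everywhere. -/
structure Bd (C : Cfg) (u : US) : Prop where
  var : ∀ r < 32, u.v r ≤ C.V
  glob : ∀ r, C.p ≤ r → r < 32 → u.v r = C.g r
  inp : ∀ a < C.W0, u.m a = C.inp a
  work : ∀ a, C.W0 ≤ a → u.m a ≤ C.Vm

theorem Bd.mem {C : Cfg} {u : US} (h : Bd C u) (a : ℕ) : u.m a ≤ C.V := by
  by_cases ha : a < C.W0
  · rw [h.inp a ha]; exact C.hinp a ha
  · exact (h.work a (not_lt.1 ha)).trans C.hVm

/-- Only registers below 32 are compared, which leaves the others as scratch space; the cost is an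
inequality, so statements may be overcharged. -/
structure Rep (C : Cfg) (s : State) (u : US) : Prop where
  var : ∀ r < 32, s.reg r = u.v r
  mem : s.mem = u.m
  rest : s.rest = u.rest
  cost : C.α * s.time + C.β * s.passes ≤ u.c

/-- Total correctness: from `u` the program halts in a state satisfying `Q`. -/
def Tri (C : Cfg) (p : Prog) (u : US) (Q : US → Prop) : Prop :=
  Bd C u → ∀ s, Rep C s u → ∃ s' u', Exec C.L C.σ p s s' ∧ Rep C s' u' ∧ Bd C u' ∧ Q u'

theorem E.eval_le {C : Cfg} {u : US} (hb : Bd C u) (e : E) (h : e.wf = true) :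
    e.eval u ≤ C.V ^ e.deg ∧ 1 ≤ e.deg := by
  have hV := C.hV
  induction e with
  | c k => simp [E.wf] at h; simp [E.eval, E.deg]; omega
  | v r => simp [E.wf] at h; simp [E.eval, E.deg]; exact hb.var r h
  | ld a => simp [E.eval, E.deg]; exact hb.mem _
  | op o a b iha ihb =>
    simp [E.wf] at h
    obtain ⟨ha, ha1⟩ := iha h.1.1
    obtain ⟨hb', hb1⟩ := ihb h.1.2
    cases o
    · refine ⟨?_, by simp [E.deg]⟩
      have h1 : C.V ^ a.deg ≤ C.V ^ max a.deg b.deg := Nat.pow_le_pow_right (by omega) (le_max_left _ _)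
      have h2 : C.V ^ b.deg ≤ C.V ^ max a.deg b.deg := Nat.pow_le_pow_right (by omega) (le_max_right _ _)
      simp only [E.eval, E.deg, Op.eval, pow_succ]
      nlinarith
    · refine ⟨?_, by simpa [E.deg]⟩
      simp only [E.eval, E.deg, Op.eval]; omega
    · refine ⟨?_, by simp [E.deg]; omega⟩
      simp only [E.eval, E.deg, Op.eval, pow_add]
      exact Nat.mul_le_mul ha hb'
    · refine ⟨?_, by simpa [E.deg]⟩
      simp only [E.eval, E.deg, Op.eval]; exact (Nat.div_le_self _ _).trans ha
    · refine ⟨?_, by simpa [E.deg]⟩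
      simp only [E.eval, E.deg, Op.eval]; exact (Nat.mod_le _ _).trans ha
    · simp only [E.eval, E.deg, Op.eval]; split <;> simp; omega
    · simp only [E.eval, E.deg, Op.eval]; split <;> simp; omega

theorem E.deg_le {e : E} (h : e.wf = true) : e.deg ≤ 12 := by
  cases e with
  | c k => simp [E.deg]
  | v r => simp [E.deg]
  | ld a => simp [E.deg]
  | op o a b => simp [E.wf] at h; exact h.2

theorem E.eval_lt {C : Cfg} {u : US} (hb : Bd C u) (e : E) (h : e.wf = true) {r : ℕ} (hr : r < 64) :
    e.eval u < 2 ^ C.L.reg r :=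
  calc e.eval u ≤ C.V ^ e.deg := (e.eval_le hb h).1
    _ ≤ C.V ^ 12 := Nat.pow_le_pow_right (by have := C.hV; omega) (E.deg_le h)
    _ < _ := C.hreg r hr

/-- Preservation of all registers below `t` is what protects the left operand of an operation while
the right one is computed. -/
theorem E.code_exec {C : Cfg} {u : US} (hb : Bd C u) (e : E) (h : e.wf = true) :
    ∀ (t : ℕ) (s : State), 32 ≤ t → t + e.depth < 63 → (∀ r < 32, s.reg r = u.v r) → s.mem = u.m →
      ∃ s', Exec C.L C.σ (e.code t) s s' ∧ s'.reg t = e.eval u ∧ (∀ r < t, s'.reg r = s.reg r) ∧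
        s'.mem = s.mem ∧ s'.rest = s.rest ∧ s'.passes = s.passes ∧ s'.time = s.time + e.size := by
  have hV := C.hV
  induction e with
  | c k =>
    intro t s ht hd hv hm
    refine ⟨_, .const ?_, ?_⟩
    · simp [E.depth] at hd; exact E.eval_lt (u := u) hb (.c k) h (by omega)
    · refine ⟨by simp [State.setReg, E.eval], ?_, rfl, rfl, rfl, rfl⟩
      intro r hr
      simp [State.setReg, State.tick, Function.update_apply]; omega
  | v r =>
    intro t s ht hd hv hm
    simp [E.depth] at hd
    have hr : r < 32 := by simpa [E.wf] using h
    refine ⟨_, .seq (.const ?_) (.op ?_), ?_⟩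
    · exact Nat.two_pow_pos _
    · have := E.eval_lt (u := u) hb (.v r) h (r := t) (by omega)
      have h3 : r ≠ t := by omega
      simpa [State.setReg, State.tick, Op.eval, E.eval, Function.update_apply, h3, hv r hr] using this
    · have h3 : r ≠ t := by omega
      refine ⟨by simp [State.setReg, State.tick, Op.eval, E.eval, Function.update_apply, h3, hv r hr],
        ?_, rfl, rfl, rfl, rfl⟩
      intro r' hr'
      have : r' ≠ t := by omega
      simp [State.setReg, State.tick, Function.update_apply, this]
  | ld a iha =>
    intro t s ht hd hv hm
    obtain ⟨s1, he, h1, h2, h3, h4, h5, h6⟩ := iha h t s ht hd hv hm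
    simp [E.depth] at hd
    refine ⟨_, .seq he (.load ?_), ?_⟩
    · rw [h1, h3, hm]; exact E.eval_lt (u := u) hb (.ld a) h (by omega)
    · refine ⟨by simp [State.setReg, State.tick, h1, h3, hm, E.eval], ?_, h3, h4, h5, ?_⟩
      · intro r hr
        have : r ≠ t := by omega
        simp [State.setReg, State.tick, Function.update_apply, this, h2 r hr]
      · simp [State.setReg, State.tick, h6, E.size]; omega
  | op o a b iha ihb =>
    intro t s ht hd hv hm
    have h' := h
    simp [E.wf] at h
    simp [E.depth] at hd
    obtain ⟨s1, he, h1, h2, h3, h4, h5, h6⟩ := iha h.1.1 t s ht (by omega) hv hm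
    obtain ⟨s2, ge, g1, g2, g3, g4, g5, g6⟩ := ihb h.1.2 (t + 1) s1 (by omega) (by omega)
      (fun r hr => by rw [h2 r (by omega), hv r hr]) (by rw [h3, hm])
    refine ⟨_, .seq he (.seq ge (.op ?_)), ?_⟩
    · rw [g1, g2 t (by omega), h1]
      exact E.eval_lt (u := u) hb (.op o a b) h' (by omega)
    · refine ⟨by simp [State.setReg, State.tick, g1, g2 t (by omega), h1, E.eval], ?_, ?_, ?_, ?_, ?_⟩
      · intro r hr
        have : r ≠ t := by omega
        simp [State.setReg, State.tick, Function.update_apply, this, h2 r hr, g2 r (by omega)]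
      · simp [State.setReg, State.tick, g3, h3]
      · simp [State.setReg, State.tick, g4, h4]
      · simp [State.setReg, State.tick, g5, h5]
      · simp [State.setReg, State.tick, g6, h6, E.size]; omega

/-! ### Statements -/

def skip : Prog := .const 32 0

/-- The machine has no move instruction, so the result is added to a zero. -/
def assign (x : ℕ) (e : E) : Prog := .seq (e.code 33) (.seq (.const 32 0) (.op .add x 32 33))

def store (a e : E) : Prog := .seq (a.code 32) (.seq (e.code 33) (.store 32 33))

def ifE (e : E) (p q : Prog) : Prog := .seq (e.code 32) (.ite 32 p q)

/-- The loop tests a register that the body may overwrite, so the condition is evaluated anew after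
each round. -/
def whileE (e : E) (p : Prog) : Prog := .seq (e.code 32) (.loop 32 (.seq p (e.code 32)))

def seqs : List Prog → Prog
  | [] => skip
  | p :: ps => .seq p (seqs ps)

variable {C : Cfg} {u : US} {Q : US → Prop}

theorem Tri.mono {p : Prog} {Q' : US → Prop} (h : Tri C p u Q') (hq : ∀ u', Bd C u' → Q' u' → Q u') :
    Tri C p u Q := by
  intro hb s hs
  obtain ⟨s', u', h1, h2, h3, h4⟩ := h hb s hs
  exact ⟨s', u', h1, h2, h3, hq u' h3 h4⟩

theorem Tri.bd {p : Prog} (h : Bd C u → Tri C p u Q) : Tri C p u Q := fun hb => h hb hb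

theorem Tri.seq {p q : Prog} (h : Tri C p u (fun u' => Tri C q u' Q)) : Tri C (.seq p q) u Q := by
  intro hb s hs
  obtain ⟨s', u', h1, h2, h3, h4⟩ := h hb s hs
  obtain ⟨s'', u'', g1, g2, g3, g4⟩ := h4 h3 s' h2
  exact ⟨s'', u'', .seq h1 g1, g2, g3, g4⟩

theorem Tri.cons {p : Prog} {ps : List Prog} (h : Tri C p u (fun u' => Tri C (seqs ps) u' Q)) :
    Tri C (seqs (p :: ps)) u Q := Tri.seq h

theorem Bd.tick (hb : Bd C u) (k : ℕ) : Bd C (u.tick k) := ⟨hb.1, hb.2, hb.3, hb.4⟩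

theorem Bd.set (hb : Bd C u) {x k : ℕ} (hx : x < C.p) (hk : k ≤ C.V) : Bd C (u.set x k) := by
  refine ⟨fun r hr => ?_, fun r hr hr' => ?_, hb.3, hb.4⟩
  · simp only [US.set_v]; split
    · exact hk
    · exact hb.var r hr
  · rw [US.set_v, if_neg (by omega)]; exact hb.glob r hr hr'

theorem Bd.store (hb : Bd C u) {a k : ℕ} (ha : C.W0 ≤ a) (hk : k ≤ C.Vm) : Bd C (u.store a k) := by
  refine ⟨hb.1, hb.2, fun r hr => ?_, fun r hr => ?_⟩
  · rw [US.store_m, if_neg (by omega)]; exact hb.inp r hr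
  · rw [US.store_m]; split
    · exact hk
    · exact hb.work r hr

theorem Tri.skip (h : Q (u.tick C.κ)) : Tri C skip u Q := by
  intro hb s hs
  refine ⟨_, u.tick C.κ, .const (Nat.two_pow_pos _), ?_, hb.tick _, h⟩
  refine ⟨fun r hr => ?_, hs.mem, hs.rest, ?_⟩
  · have : r ≠ 32 := by omega
    simp [State.setReg, State.tick, Function.update_apply, this, hs.var r hr]
  · have := hs.cost
    simp only [State.setReg, State.tick, US.tick_c, Cfg.κ]
    nlinarith

theorem Tri.nil (h : Q (u.tick C.κ)) : Tri C (seqs []) u Q := Tri.skip h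

theorem Tri.assign {x : ℕ} {e : E} (k : ℕ) (ok : e.ok = true) (hx : x < C.p)
    (he : Bd C u → e.eval u = k) (hk : Bd C u → k ≤ C.V)
    (h : Q ((u.set x k).tick C.κ)) : Tri C (assign x e) u Q := by
  intro hb s hs
  simp [E.ok] at ok
  have hx' := C.hp
  obtain ⟨s1, hc, h1, h2, h3, h4, h5, h6⟩ := E.code_exec hb e ok.1.1 33 s (by omega) (by omega) hs.var hs.mem
  rw [he hb] at h1
  refine ⟨_, _, .seq hc (.seq (.const (Nat.two_pow_pos _)) (.op ?_)), ?_, (hb.set hx (hk hb)).tick _, h⟩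
  · have := E.eval_lt (u := u) hb e ok.1.1 (r := x) (by omega)
    simpa [State.setReg, State.tick, Op.eval, Function.update_apply, h1, he hb] using this
  · refine ⟨fun r hr => ?_, h3.trans hs.mem, h4.trans hs.rest, ?_⟩
    · have : r ≠ 32 := by omega
      simp [State.setReg, State.tick, Op.eval, Function.update_apply, this, h2 r (by omega), hs.var r hr, h1]
    · have := hs.cost
      simp only [State.setReg, State.tick, US.tick_c, Cfg.κ, h5, h6, US.set_c]
      nlinarith [ok.2]

theorem Tri.store {ea e : E} (a k : ℕ) (ok : e.ok = true) (oka : ea.ok = true)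
    (hea : Bd C u → ea.eval u = a) (he : Bd C u → e.eval u = k)
    (ha : C.W0 ≤ a) (ha' : a < C.W0 + C.ws) (hk : Bd C u → k ≤ C.Vm)
    (h : Q ((u.store a k).tick (2 * C.κ))) : Tri C (store ea e) u Q := by
  intro hb s hs
  simp [E.ok] at ok oka
  obtain ⟨s1, hc, h1, h2, h3, h4, h5, h6⟩ := E.code_exec hb ea oka.1.1 32 s (by omega) (by omega) hs.var hs.mem
  obtain ⟨s2, ge, g1, g2, g3, g4, g5, g6⟩ := E.code_exec hb e ok.1.1 33 s1 (by omega) (by omega)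
    (fun r hr => (h2 r hr).trans (hs.var r hr)) (h3.trans hs.mem)
  rw [hea hb] at h1
  rw [he hb] at g1
  refine ⟨_, _, .seq hc (.seq ge (.store ?_)), ?_, (hb.store ha (hk hb)).tick _, h⟩
  · rw [g1, g2 32 (by omega), h1]
    exact (hk hb).trans_lt (C.hmem _ ha ha')
  · refine ⟨fun r hr => ?_, ?_, g4.trans (h4.trans hs.rest), ?_⟩
    · simp [State.setMem, State.tick, g2 r (by omega), h2 r hr, hs.var r hr]
    · simp [State.setMem, State.tick, US.store, US.tick, g1, g2 32 (by omega), h1, g3, h3, hs.mem]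
    · have := hs.cost
      simp only [State.setMem, State.tick, US.tick_c, Cfg.κ, g5, g6, h5, h6, US.store_c]
      nlinarith [ok.2, oka.2]

theorem Tri.ifE {e : E} {p q : Prog} (ok : e.ok = true)
    (h1 : e.eval u ≠ 0 → Tri C p (u.tick C.κ) Q) (h0 : e.eval u = 0 → Tri C q (u.tick C.κ) Q) :
    Tri C (ifE e p q) u Q := by
  intro hb s hs
  simp [E.ok] at ok
  obtain ⟨s1, he, g1, g2, g3, g4, g5, g6⟩ := E.code_exec hb e ok.1.1 32 s (by omega) (by omega) hs.var hs.mem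
  have hr : Rep C s1.tick (u.tick C.κ) := by
    refine ⟨fun r hr => (g2 r hr).trans (hs.var r hr), g3.trans hs.mem, g4.trans hs.rest, ?_⟩
    have := hs.cost
    simp only [State.tick, US.tick_c, Cfg.κ, g5, g6]
    nlinarith [ok.2]
  by_cases hz : e.eval u = 0
  · obtain ⟨s', u', k1, k2, k3, k4⟩ := h0 hz (hb.tick _) _ hr
    exact ⟨s', u', .seq he (.ite_false (g1.trans hz) k1), k2, k3, k4⟩
  · obtain ⟨s', u', k1, k2, k3, k4⟩ := h1 hz (hb.tick _) _ hr
    exact ⟨s', u', .seq he (.ite_true (by rw [g1]; exact hz) k1), k2, k3, k4⟩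

/-- A loop that makes exactly `N` rounds. -/
theorem Tri.whileE {e : E} {p : Prog} (ok : e.ok = true) (N : ℕ) (Inv : ℕ → US → Prop)
    (hbody : ∀ j u, j < N → Bd C u → Inv j u → e.eval u ≠ 0 ∧ Tri C p (u.tick C.κ) (Inv (j + 1)))
    (hend : ∀ u, Bd C u → Inv N u → e.eval u = 0)
    (h0 : Inv 0 u) (hQ : ∀ u, Bd C u → Inv N u → Q (u.tick C.κ)) :
    Tri C (whileE e p) u Q := by
  simp [E.ok] at ok
  -- Induction on the number `k` of rounds still to come.
  have key : ∀ k j, j + k = N → ∀ s u, Bd C u → Inv j u → Rep C s u →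
      ∃ s' u', Exec C.L C.σ (PiDel.whileE e p) s s' ∧ Rep C s' u' ∧ Bd C u' ∧ Q u' := by
    intro k
    induction k with
    | zero =>
      intro j hj s u hb hi hs
      obtain rfl : j = N := by omega
      obtain ⟨s1, he, g1, g2, g3, g4, g5, g6⟩ := E.code_exec hb e ok.1.1 32 s (by omega) (by omega) hs.var hs.mem
      refine ⟨s1.tick, u.tick C.κ, .seq he (.loop_false (g1.trans (hend u hb hi))), ?_, hb.tick _, hQ u hb hi⟩
      refine ⟨fun r hr => (g2 r hr).trans (hs.var r hr), g3.trans hs.mem, g4.trans hs.rest, ?_⟩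
      have := hs.cost
      simp only [State.tick, US.tick_c, Cfg.κ, g5, g6]
      nlinarith [ok.2]
    | succ k ih =>
      intro j hj s u hb hi hs
      obtain ⟨s1, he, g1, g2, g3, g4, g5, g6⟩ := E.code_exec hb e ok.1.1 32 s (by omega) (by omega) hs.var hs.mem
      obtain ⟨hz, ht⟩ := hbody j u (by omega) hb hi
      have hr : Rep C s1.tick (u.tick C.κ) := by
        refine ⟨fun r hr => (g2 r hr).trans (hs.var r hr), g3.trans hs.mem, g4.trans hs.rest, ?_⟩
        have := hs.cost
        simp only [State.tick, US.tick_c, Cfg.κ, g5, g6]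
        nlinarith [ok.2]
      obtain ⟨s2, u2, k1, k2, k3, k4⟩ := ht (hb.tick _) _ hr
      obtain ⟨s3, u3, l1, l2, l3, l4⟩ := ih (j + 1) (by omega) s2 u2 k3 k4 k2
      -- The run given by induction begins by evaluating the condition; that evaluation is exactly
      -- the end of the present round, so it is split off and moved there.
      cases l1 with
      | seq la lb =>
        exact ⟨s3, u3, .seq he (.loop_true (by rw [g1]; exact hz) (.seq k1 la) lb), l2, l3, l4⟩
  intro hb s hs
  exact key N 0 (by omega) s u hb h0 hs

/-- `for x < N`. -/
def forE (x : ℕ) (N : E) (p : Prog) : Prog :=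
  .seq (assign x (.c 0)) (whileE (.op .lt (.v x) N) (.seq p (assign x (.op .add (.v x) (.c 1)))))

theorem Tri.forE {x : ℕ} {eN : E} {p : Prog} (ok : (E.op .lt (.v x) eN).ok = true) (hx : x < C.p)
    (N : ℕ) (hNV : N ≤ C.V) (Inv : ℕ → US → Prop)
    (hN : ∀ j u, j ≤ N → Bd C u → Inv j u → eN.eval u = N)
    (hbody : ∀ j u, j < N → Bd C u → Inv j u → u.v x = j →
      Tri C p (u.tick C.κ) (fun u' => u'.v x = j ∧ Inv (j + 1) ((u'.set x (j + 1)).tick C.κ)))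
    (h0 : Inv 0 ((u.set x 0).tick C.κ))
    (hQ : ∀ u, Bd C u → Inv N u → u.v x = N → Q (u.tick C.κ)) :
    Tri C (forE x eN p) u Q := by
  have hp := C.hp
  have hx32 : x < 32 := by omega
  refine Tri.seq (Tri.assign 0 rfl hx (fun _ => rfl) (fun _ => Nat.zero_le _) ?_)
  refine Tri.whileE ok N (fun j u => u.v x = j ∧ Inv j u) ?_ ?_ ⟨by simp, h0⟩ ?_
  · intro j u hj hb ⟨hxj, hi⟩
    refine ⟨by simp [E.eval, Op.eval, hxj, hN j u hj.le hb hi, hj], ?_⟩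
    refine Tri.seq ((hbody j u hj hb hi hxj).mono ?_)
    rintro u' hb' ⟨h1, h2⟩
    refine Tri.assign (j + 1) ?_ hx (fun _ => by simp [E.eval, Op.eval, h1]) (fun _ => by omega) ?_
    · simp [E.ok, E.wf, E.deg, E.depth, E.size, hx32]
    · exact ⟨by simp, h2⟩
  · intro u hb ⟨hxj, hi⟩
    simp [E.eval, Op.eval, hxj, hN N u le_rfl hb hi]
  · rintro u hb ⟨hxj, hi⟩
    exact hQ u hb hi hxj

/-- `for x < N: acc := acc + e`. -/
def sumE (x : ℕ) (N : E) (acc : ℕ) (e : E) : Prog := forE x N (assign acc (.op .add (.v acc) e))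

/-- The final state is given exactly, so that consecutive sums can be handled by simplification. A
round costs a test, an addition and an increment; two more units pay for the initialization and the
last test. -/
theorem Tri.sumE {x acc : ℕ} {eN e : E} (N S : ℕ) (f : ℕ → ℕ) (ok : (E.op .lt (.v x) eN).ok = true)
    (ok' : (E.op .add (.v acc) e).ok = true) (hx : x < C.p) (hacc : acc < C.p) (hne : x ≠ acc)
    (hNV : N ≤ C.V)
    (hN : ∀ u', Bd C u' → (∀ r, r ≠ x → r ≠ acc → u'.v r = u.v r) → u'.m = u.m → eN.eval u' = N)
    (hf : ∀ j u', Bd C u' → (∀ r, r ≠ x → r ≠ acc → u'.v r = u.v r) → u'.m = u.m → u'.v x = j → j < N →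
      e.eval u' = f j)
    (hS : u.v acc + ∑ j ∈ Finset.range N, f j = S) (hV : S ≤ C.V)
    (hQ : Q (((u.set x N).set acc S).tick (C.κ * (3 * N + 2)))) :
    Tri C (sumE x eN acc e) u Q := by
  subst hS
  refine Tri.forE ok hx N hNV (fun j u' => (∀ r, r ≠ x → r ≠ acc → u'.v r = u.v r) ∧ u'.m = u.m ∧
    u'.rest = u.rest ∧ u'.v acc = u.v acc + ∑ j ∈ Finset.range j, f j ∧
      u'.c = u.c + C.κ * (3 * j + 1)) ?_ ?_ ?_ ?_
  · rintro j u' hj hb ⟨h1, h2, -⟩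
    exact hN u' hb h1 h2
  · rintro j u' hj hb ⟨h1, h2, h3, h4, h5⟩ hxj
    have he : e.eval (u'.tick C.κ) = f j := hf j _ (hb.tick _) h1 h2 hxj hj
    refine Tri.assign (u.v acc + ∑ j ∈ Finset.range (j + 1), f j) ok' hacc (fun _ => ?_) (fun _ => ?_) ?_
    · simp only [E.eval, Op.eval, he, US.tick_v, h4, Finset.sum_range_succ, add_assoc]
    · refine le_trans (Nat.add_le_add_left (Finset.sum_le_sum_of_subset (by
        intro i hi; simp at hi ⊢; omega)) _) hV
    · refine ⟨by simp [hne, hxj], ?_, h2, h3, ?_, ?_⟩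
      · intro r hr hr'
        simp [hr, hr', h1 r hr hr']
      · simp [hne.symm]
      · simp [h5]; ring
  · refine ⟨fun r hr _ => by simp [hr], rfl, rfl, by simp [hne.symm], by simp⟩
  · rintro u' hb ⟨h1, h2, h3, h4, h5⟩ hxN
    convert hQ using 1
    ext1
    · funext r
      by_cases hr : r = acc
      · simp [hr, h4]
      · by_cases hr' : r = x
        · simp [hr', hne, hxN]
        · simp [hr, hr', h1 r hr' hr]
    · exact h2
    · exact h3
    · simp [h5]; ring

end PiDel

namespace PiDel

/-! ### The functional content of the search -/

/-- Data of one test for an induced copy of a graph `H` on `m` vertices: `X` enumerates the vertex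
cover, `P i = h < m` says that `X i` shall be the image of `h`, and `τ` lists items `(a, b)`. -/
structure Tst where
  K : ℕ
  X : ℕ → ℕ
  P : ℕ → ℕ
  m : ℕ
  H : ℕ → ℕ → ℕ
  τ : List (ℕ × ℕ)

/-- The state of a scan: the current vertex, its score, and one plus the vertex found. -/
structure Scan where
  cur : ℕ
  cnt : ℕ
  res : ℕ

namespace Tst

variable (T : Tst)

/-- The number of preassigned neighbours of `h`. -/
def need (h : ℕ) : ℕ := ∑ i ∈ Finset.range T.K, if T.P i < T.m then T.H h (T.P i) else 0

/-- A required neighbour scores 1 and a forbidden one `need + 1`, which alone overshoots. So, if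
each neighbour is seen once, the total over a vertex equals `need` exactly when all required
neighbours and no forbidden ones are present. -/
def score (h b : ℕ) : ℕ := ∑ i ∈ Finset.range T.K,
  if T.X i = b ∧ T.P i < T.m then 1 + T.need h * (1 - T.H h (T.P i)) else 0

/-- `a` may be the image of `h`, as far as excluded vertices and the preassignment go. -/
def Cand (excl : List ℕ) (h a : ℕ) : Prop :=
  a ∉ excl ∧ ∀ i < T.K, T.X i = a ↔ T.P i = h

open Classical in
-- The end of a block cannot be foreseen, so the verdict on the current vertex is provisional and
-- renewed at every item; a success from an earlier block is left alone.
noncomputable def step (excl : List ℕ) (h : ℕ) (s : Scan) (it : ℕ × ℕ) : Scan where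
  cur := it.1
  cnt := (if it.1 = s.cur then s.cnt else 0) + T.score h it.2
  res := if s.res = 0 ∨ s.res = it.1 + 1 then
      (if (if it.1 = s.cur then s.cnt else 0) + T.score h it.2 = T.need h ∧ T.Cand excl h it.1
        then it.1 + 1 else 0)
    else s.res

noncomputable def find (excl : List ℕ) (h : ℕ) : ℕ := (T.τ.foldl (T.step excl h) ⟨0, 0, 0⟩).res

/-- If `h` is not preassigned, then all its neighbours are. -/
def Flag (h : ℕ) : Prop :=
  (∃ i < T.K, T.P i = h) ∨ ∑ j ∈ Finset.range T.m, T.H h j = T.need h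

/-- The images of the first `h` vertices, chosen greedily outside `S`. -/
noncomputable def images (S : List ℕ) : ℕ → List ℕ
  | 0 => []
  | h + 1 => images S h ++ [T.find (S ++ images S h) h - 1]

/-- A failed scan puts the junk vertex 0 into `images`, by truncated subtraction; only under this
condition do the images mean anything. -/
def Ok (S : List ℕ) (h : ℕ) : Prop :=
  ∀ g < h, T.Flag g ∧ T.find (S ++ T.images S g) g ≠ 0

theorem need_le (hH : ∀ h j, T.H h j ≤ 1) (h : ℕ) : T.need h ≤ T.K := by
  calc T.need h ≤ ∑ i ∈ Finset.range T.K, 1 := Finset.sum_le_sum fun i _ => by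
        split
        · exact hH _ _
        · exact Nat.zero_le _
    _ = T.K := by simp

theorem score_le (hH : ∀ h j, T.H h j ≤ 1) (h b : ℕ) : T.score h b ≤ T.K * (T.K + 1) := by
  calc T.score h b ≤ ∑ i ∈ Finset.range T.K, (T.K + 1) := Finset.sum_le_sum fun i _ => by
        have := T.need_le hH h
        split
        · have : T.need h * (1 - T.H h (T.P i)) ≤ T.need h * 1 := Nat.mul_le_mul_left _ (by omega)
          omega
        · exact Nat.zero_le _
    _ = T.K * (T.K + 1) := by simp

/-- Resets of the count are ignored; this crude bound is enough to keep the count inside its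
register. -/
theorem cnt_foldl_le (hH : ∀ h j, T.H h j ≤ 1) (excl : List ℕ) (h : ℕ) (l : List (ℕ × ℕ)) (s : Scan) :
    (l.foldl (T.step excl h) s).cnt ≤ s.cnt + l.length * (T.K * (T.K + 1)) := by
  induction l generalizing s with
  | nil => simp
  | cons it l ih =>
    have h1 := ih (T.step excl h s it)
    have h2 : (T.step excl h s it).cnt ≤ s.cnt + T.K * (T.K + 1) := by
      have := T.score_le hH h it.2
      simp only [step]; split <;> omega
    simp only [List.foldl_cons, List.length_cons, add_mul]
    omega

theorem cnt_foldl_take_le (hH : ∀ h j, T.H h j ≤ 1) (excl : List ℕ) (h : ℕ) {l : List (ℕ × ℕ)}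
    {N : ℕ} (hl : l.length ≤ N) :
    (l.foldl (T.step excl h) ⟨0, 0, 0⟩).cnt ≤ N * (T.K * (T.K + 1)) := by
  have := T.cnt_foldl_le hH excl h l ⟨0, 0, 0⟩
  have h2 := Nat.mul_le_mul_right (T.K * (T.K + 1)) hl
  simp only at this
  omega

end Tst

/-- The whole problem as data: vertex cover, family, items, and the base `B` of the counters. -/
structure Prob where
  n : ℕ
  K : ℕ
  l : ℕ
  q : ℕ
  X : ℕ → ℕ
  M : ℕ → ℕ
  H : ℕ → ℕ → ℕ → ℕ
  τ : List (ℕ × ℕ)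
  B : ℕ

namespace Prob

variable (D : Prob)

/-- The `t`-th test: digits of `t % B ^ K` as preassignment for the graph number `t / B ^ K`. -/
def tst (t : ℕ) : Tst where
  K := D.K
  X := D.X
  P := fun i => t % D.B ^ D.K / D.B ^ i % D.B
  m := D.M (t / D.B ^ D.K)
  H := D.H (t / D.B ^ D.K)
  τ := D.τ

def Hit (S : List ℕ) (t : ℕ) : Prop := (D.tst t).Ok S (D.tst t).m

/-- `t` is the first successful test. -/
def First (S : List ℕ) (t : ℕ) : Prop :=
  t < D.q * D.B ^ D.K ∧ D.Hit S t ∧ ∀ t' < t, ¬ D.Hit S t'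

theorem First.unique {D : Prob} {S : List ℕ} {t t' : ℕ} (h : D.First S t) (h' : D.First S t') : t = t' := by
  by_contra hne
  rcases lt_or_gt_of_ne hne with hlt | hlt
  · exact h'.2.2 t hlt h.2.1
  · exact h.2.2 t' hlt h'.2.1

end Prob

/-! ### The programs -/

/-- The address of cell `i` of work array `k`. -/
def addrE (k : ℕ) (i : E) : E := .op .add (.op .add (.v 29) (.op .mul (.c 3) i)) (.c k)

/-- Array 0 holds the branching digits, array 1 the preassignment, array 2 the deleted vertices
followed by the images chosen in the current test. Registers: 0 answer, 1 success flag, 2 to 4 scan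
state, 5 `need`, 9 vertex of the test graph, 13 and 14 pointer to that graph and its size, 15 number
of deleted vertices, 24 to 30 the constants K, q, ℓ, n, start of the family, start of the work area,
B. -/
def arrE (k : ℕ) (i : E) : E := .ld (addrE k i)

/-- Cells 0 to 3 hold n, K, ℓ and q. -/
def covE (i : E) : E := .ld (.op .add (.c 4) i)

/-- The matrix entry of the current graph in row `reg 9`. -/
def matE (j : E) : E :=
  .ld (.op .add (.op .add (.op .add (.v 13) (.c 1)) (.op .mul (.v 9) (.v 14))) j)

def notE (e : E) : E := .op .sub (.c 1) e

/-- Process an item `(reg 10, reg 11)`. -/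
def itemP : Prog := seqs [
  -- The count restarts when the vertex of the item changes.
  assign 3 (.op .mul (.v 3) (.op .eq (.v 10) (.v 4))),
  assign 4 (.v 10),
  sumE 8 (.v 24) 3 (.op .mul (.op .eq (covE (.v 8)) (.v 11))
    (.op .mul (.op .lt (arrE 1 (.v 8)) (.v 14))
      (.op .add (.c 1) (.op .mul (.v 5) (notE (matE (arrE 1 (.v 8)))))))),
  -- Register 6 counts violations of `Cand`: occurrences among the excluded vertices, then cover
  -- vertices on which identity and preassignment disagree.
  assign 6 (.c 0),
  sumE 8 (.op .add (.v 15) (.v 9)) 6 (.op .eq (arrE 2 (.v 8)) (.v 10)),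
  sumE 8 (.v 24) 6 (notE (.op .eq (.op .eq (covE (.v 8)) (.v 10))
    (.op .eq (arrE 1 (.v 8)) (.v 9)))),
  ifE (.op .add (.op .eq (.v 2) (.c 0)) (.op .eq (.v 2) (.op .add (.v 10) (.c 1))))
    (assign 2 (.op .mul (.op .mul (.op .eq (.v 3) (.v 5)) (.op .eq (.v 6) (.c 0)))
      (.op .add (.v 10) (.c 1))))
    skip]

/-- Look for an image of vertex `reg 9`; `drive` processes all items. -/
def findP (drive : Prog) : Prog := seqs [
  assign 5 (.c 0),
  sumE 8 (.v 24) 5 (.op .mul (.op .lt (arrE 1 (.v 8)) (.v 14)) (matE (arrE 1 (.v 8)))),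
  assign 6 (.c 0),
  sumE 8 (.v 14) 6 (matE (.v 8)),
  assign 7 (.c 0),
  sumE 8 (.v 24) 7 (.op .eq (arrE 1 (.v 8)) (.v 9)),
  -- This is `Flag`: fail if no cover vertex is assigned to the vertex and its degree (register 6)
  -- differs from `need`.
  assign 1 (.op .mul (.v 1) (notE (.op .mul (.op .eq (.v 7) (.c 0))
    (notE (.op .eq (.v 6) (.v 5)))))),
  assign 2 (.c 0),
  assign 3 (.c 0),
  assign 4 (.c 0),
  drive,
  assign 1 (.op .mul (.v 1) (notE (.op .eq (.v 2) (.c 0)))),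
  store (addrE 2 (.op .add (.v 15) (.v 9))) (.op .sub (.v 2) (.c 1))]

/-- A failure only clears the flag; going on to the last vertex keeps the number of rounds fixed. -/
def testP (drive : Prog) : Prog := seqs [
  assign 1 (.c 1),
  forE 9 (.v 14) (findP drive)]

/-- Increase the counter in array `k` with `N` digits; `reg 16` receives the carry. -/
def incrP (k : ℕ) (N : E) : Prog := seqs [
  assign 16 (.c 1),
  forE 8 N (seqs [
    assign 6 (.op .add (arrE k (.v 8)) (.v 16)),
    assign 16 (.op .eq (.v 6) (.v 30)),
    store (addrE k (.v 8)) (.op .mul (.v 6) (notE (.v 16)))])]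

/-- After the first success the remaining tests are skipped but the counter still runs, so array 2
keeps the first copy found and array 1 ends as zeros. -/
def searchP (drive : Prog) : Prog := seqs [
  assign 1 (.c 0),
  assign 13 (.v 28),
  forE 12 (.v 25) (seqs [
    assign 14 (.ld (.v 13)),
    assign 17 (.c 1),
    whileE (.v 17) (seqs [
      ifE (.v 1) skip (testP drive),
      incrP 1 (.v 24),
      assign 17 (notE (.v 16))]),
    assign 13 (.op .add (.op .add (.v 13) (.c 1)) (.op .mul (.v 14) (.v 14)))])]

/-- Recursion is replaced by a counter: digit `sn` tells which vertex of the copy found at depth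
`sn` is deleted. Common prefixes of branches are recomputed. -/
def branchP (drive : Prog) : Prog :=
  ifE (.op .lt (.v 26) (.v 24))
    (seqs [
      assign 19 (.c 1),
      whileE (.v 19) (seqs [
        forE 15 (.op .add (.v 26) (.c 1)) (seqs [
          searchP drive,
          assign 0 (notE (.op .mul (notE (.v 0)) (.v 1))),
          -- If no copy was found or the digit is too large, a junk vertex is stored. This is
          -- harmless, since any clean set of at most ℓ vertices is a solution, however it arose.
          store (addrE 2 (.v 15)) (arrE 2 (.op .add (.v 15) (arrE 0 (.v 15))))]),
        incrP 0 (.v 26),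
        assign 19 (notE (.v 16))])])
    (assign 0 (.c 1))

/-! ### Correctness of the programs -/

/-- The configuration `C` holds the problem `D`, the description of graph `i` of the family
starting in cell `off i`. -/
structure Setup (C : Cfg) (D : Prob) (off : ℕ → ℕ) : Prop where
  p : C.p = 24
  gK : C.g 24 = D.K
  gq : C.g 25 = D.q
  gl : C.g 26 = D.l
  gn : C.g 27 = D.n
  gf : C.g 28 = off 0
  gW : C.g 29 = C.W0
  gB : C.g 30 = D.B
  cov : ∀ i < D.K, 4 + i < C.W0 ∧ C.inp (4 + i) = D.X i
  size : ∀ i < D.q, off i < C.W0 ∧ C.inp (off i) = D.M i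
  mat : ∀ i < D.q, ∀ h < D.M i, ∀ j < D.M i, off i + 1 + h * D.M i + j < C.W0 ∧
    C.inp (off i + 1 + h * D.M i + j) = D.H i h j
  bit : ∀ i h j, D.H i h j ≤ 1
  off : ∀ i < D.q, off (i + 1) = off i + 1 + D.M i * D.M i ∧ off (i + 1) ≤ C.W0
  base : ∀ i < D.q, D.M i < D.B
  ws : 3 * (D.K + D.B) ≤ C.ws
  BVm : D.B ≤ C.Vm
  nVm : D.n ≤ C.Vm
  nV : D.n < C.V
  qV : D.q ≤ C.V
  KBV : 3 * (D.K + D.B) + C.W0 ≤ C.V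
  cntV : (D.τ.length + 1) * (D.K * (D.K + 1)) ≤ C.V
  items : ∀ it ∈ D.τ, it.1 < D.n
  B2 : 2 ≤ D.B

/-- The situation during test `t` with excluded set `S`. -/
structure Sit (C : Cfg) (D : Prob) (off : ℕ → ℕ) (t : ℕ) (u : US) : Prop where
  ptr : u.v 13 = off (t / D.B ^ D.K)
  m : u.v 14 = (D.tst t).m
  P : ∀ i < D.K, u.m (C.W0 + 3 * i + 1) = (D.tst t).P i

/-- The first `k` entries of the array of excluded and chosen vertices. -/
def US.pre (C : Cfg) (u : US) (k : ℕ) : List ℕ := (List.range k).map fun i => u.m (C.W0 + 3 * i + 2)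

variable {C : Cfg} {D : Prob} {off : ℕ → ℕ} {u : US} {t : ℕ}

theorem Bd.v24 (hb : Bd C u) (hS : Setup C D off) : u.v 24 = D.K := by
  rw [hb.glob 24 (by rw [hS.p]) (by norm_num), hS.gK]
theorem Bd.v25 (hb : Bd C u) (hS : Setup C D off) : u.v 25 = D.q := by
  rw [hb.glob 25 (by rw [hS.p]; norm_num) (by norm_num), hS.gq]
theorem Bd.v26 (hb : Bd C u) (hS : Setup C D off) : u.v 26 = D.l := by
  rw [hb.glob 26 (by rw [hS.p]; norm_num) (by norm_num), hS.gl]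
theorem Bd.v27 (hb : Bd C u) (hS : Setup C D off) : u.v 27 = D.n := by
  rw [hb.glob 27 (by rw [hS.p]; norm_num) (by norm_num), hS.gn]
theorem Bd.v28 (hb : Bd C u) (hS : Setup C D off) : u.v 28 = off 0 := by
  rw [hb.glob 28 (by rw [hS.p]; norm_num) (by norm_num), hS.gf]
theorem Bd.v29 (hb : Bd C u) (hS : Setup C D off) : u.v 29 = C.W0 := by
  rw [hb.glob 29 (by rw [hS.p]; norm_num) (by norm_num), hS.gW]
theorem Bd.v30 (hb : Bd C u) (hS : Setup C D off) : u.v 30 = D.B := by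
  rw [hb.glob 30 (by rw [hS.p]; norm_num) (by norm_num), hS.gB]

end PiDel

/-! ### Processing a single item of a scan -/

namespace PiDel
variable {C : Cfg} {D : Prob} {off : ℕ → ℕ} {u : US} {t : ℕ}

theorem sum_ite_one_le (N : ℕ) (p : ℕ → Prop) [DecidablePred p] :
    (∑ j ∈ Finset.range N, if p j then 1 else 0) ≤ N :=
  (Finset.sum_le_card_nsmul _ _ 1 fun i _ => by split <;> simp).trans (by simp)

theorem sum_ite_one_eq_zero (N : ℕ) (p : ℕ → Prop) [DecidablePred p] :
    (∑ j ∈ Finset.range N, if p j then 1 else 0) = 0 ↔ ∀ j < N, ¬ p j := by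
  simp only [Finset.sum_eq_zero_iff, Finset.mem_range]
  refine forall₂_congr fun j _ => ?_
  split <;> simp_all

/-- The deleted vertices and the images chosen so far are contiguous in array 2, so its prefix of
length `sn + h` is the whole list of excluded vertices. -/
theorem item_tri (hS : Setup C D off) (ht : t / D.B ^ D.K < D.q) (hs : Sit C D off t u) {h a b sn : ℕ}
    (hb : Bd C u)
    (h9 : u.v 9 = h) (hh : h < (D.tst t).m) (h10 : u.v 10 = a) (h11 : u.v 11 = b)
    (h5 : u.v 5 = (D.tst t).need h) (h15 : u.v 15 = sn) (hsn : sn < D.K)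
    (ha : a < D.n) (hcnt : u.v 3 + D.K * (D.K + 1) ≤ C.V) :
    Tri C itemP u fun u' =>
      (⟨u'.v 4, u'.v 3, u'.v 2⟩ : Scan) =
          (D.tst t).step (u.pre C (sn + h)) h ⟨u.v 4, u.v 3, u.v 2⟩ (a, b) ∧
        (∀ r, r ∉ [2, 3, 4, 6, 8] → u'.v r = u.v r) ∧ u'.m = u.m ∧ u'.rest = u.rest ∧
        u'.c ≤ u.c + C.κ * (20 * (D.K + D.B)) := by
  classical
  have hp := hS.p
  have hV := C.hV
  have hK := hb.v24 hS
  have hW := hb.v29 hS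
  have hbase := hS.base _ ht
  have hmeq : (D.tst t).m = D.M (t / D.B ^ D.K) := rfl
  have hKBV := hS.KBV
  have hX : ∀ i < D.K, u.m (4 + i) = D.X i := fun i hi => by
    rw [hb.inp _ (hS.cov i hi).1, (hS.cov i hi).2]
  have hH : ∀ j < (D.tst t).m, u.m (off (t / D.B ^ D.K) + 1 + h * (D.tst t).m + j) = (D.tst t).H h j := by
    intro j hj
    have := hS.mat _ ht h hh j hj
    exact (hb.inp _ this.1).trans this.2
  have hP := hs.P
  have hptr := hs.ptr
  have hm' := hs.m
  have hnV := hS.nV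
  have hneed : (D.tst t).need h ≤ D.K := (D.tst t).need_le (fun h j => hS.bit _ h j) h
  have hsc : (D.tst t).score h b ≤ D.K * (D.K + 1) := (D.tst t).score_le (fun h j => hS.bit _ h j) h b
  set cnt0 := if a = u.v 4 then u.v 3 else 0 with hcnt0
  have hcnt0' : cnt0 ≤ u.v 3 := by rw [hcnt0]; split <;> simp
  unfold itemP
  refine Tri.cons (Tri.assign cnt0 rfl (by omega) (fun _ => ?_) (fun _ => by omega) ?_)
  · simp only [E.eval, Op.eval, h10, hcnt0]; split <;> simp
  refine Tri.cons (Tri.assign a rfl (by omega) (fun _ => by simpa [E.eval] using h10) (fun _ => by omega) ?_)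
  refine Tri.cons (Tri.sumE D.K (cnt0 + (D.tst t).score h b)
    (fun i => if D.X i = b ∧ (D.tst t).P i < (D.tst t).m then
      1 + (D.tst t).need h * (1 - (D.tst t).H h ((D.tst t).P i)) else 0)
    rfl rfl (by omega) (by omega) (by norm_num) (by omega) ?_ ?_ ?_ ?_ ?_)
  · intro u' _ hv hm
    simp [E.eval, hv, hK]
  · intro j u' _ hv hm hj hjK
    simp only [E.eval, covE, arrE, addrE, matE, notE, Op.eval, hm, hj, US.tick_m, US.set_m]
    simp only [hv 11 (by norm_num) (by norm_num), hv 29 (by norm_num) (by norm_num), hv 14 (by norm_num) (by norm_num),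
      hv 5 (by norm_num) (by norm_num), hv 13 (by norm_num) (by norm_num), hv 9 (by norm_num) (by norm_num),
      US.tick_v, US.set_v, hW, hptr, hm', h9, h5, h11, hX j hjK]
    norm_num [hW, hptr, hm', h9, h5, h11]
    rw [hP j hjK]
    by_cases h1 : D.X j = b <;> by_cases h2 : (D.tst t).P j < (D.tst t).m <;> simp [h1, h2]
    rw [hH _ h2]
    exact Or.inl rfl
  · simp; rfl
  · omega
  refine Tri.cons (Tri.assign 0 rfl (by omega) (fun _ => rfl) (fun _ => by simp) ?_)
  set s1 := ∑ i ∈ Finset.range (sn + h), if u.m (C.W0 + 3 * i + 2) = a then 1 else 0 with hs1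
  have hs1' : s1 ≤ sn + h := sum_ite_one_le _ _
  refine Tri.cons (Tri.sumE (sn + h) s1 (fun i => if u.m (C.W0 + 3 * i + 2) = a then 1 else 0)
    rfl rfl (by omega) (by omega) (by norm_num) (by omega) ?_ ?_ ?_ ?_ ?_)
  · intro u' _ hv hm
    simp [E.eval, Op.eval, hv, h15, h9]
  · intro j u' _ hv hm hj hjK
    simp only [E.eval, arrE, addrE, Op.eval, hm, hj, US.tick_m, US.set_m]
    rw [hv 29 (by norm_num) (by norm_num), hv 10 (by norm_num) (by norm_num)]
    simp [hW, h10]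
  · simp [hs1]
  · omega
  set s2 := ∑ i ∈ Finset.range D.K, if ¬ (D.X i = a ↔ (D.tst t).P i = h) then 1 else 0 with hs2
  have hs2' : s2 ≤ D.K := sum_ite_one_le _ _
  refine Tri.cons (Tri.sumE D.K (s1 + s2) (fun i => if ¬ (D.X i = a ↔ (D.tst t).P i = h) then 1 else 0)
    rfl rfl (by omega) (by omega) (by norm_num) (by omega) ?_ ?_ ?_ ?_ ?_)
  · intro u' _ hv hm
    simp [E.eval, hv, hK]
  · intro j u' _ hv hm hj hjK
    simp only [E.eval, covE, arrE, addrE, notE, Op.eval, hm, hj, US.tick_m, US.set_m]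
    rw [hv 29 (by norm_num) (by norm_num), hv 9 (by norm_num) (by norm_num), hv 10 (by norm_num) (by norm_num)]
    norm_num [hW, h9, h10]
    rw [hP j hjK, hX j hjK]
    by_cases h1 : D.X j = a <;> by_cases h2 : (D.tst t).P j = h <;> simp [h1, h2]
  · simp [hs2]
  · omega
  have hz1 : s1 = 0 ↔ a ∉ u.pre C (sn + h) := by
    rw [hs1, sum_ite_one_eq_zero]
    simp [US.pre]
  have hz2 : s2 = 0 ↔ ∀ i < D.K, (D.X i = a ↔ (D.tst t).P i = h) := by
    rw [hs2, sum_ite_one_eq_zero]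
    simp only [not_not]
  have hcost : C.κ + C.κ + C.κ * (3 * D.K + 2) + C.κ + C.κ * (3 * (sn + h) + 2) + C.κ * (3 * D.K + 2) + C.κ + C.κ + C.κ
      ≤ C.κ * (20 * (D.K + D.B)) := by
    have h2 := hS.B2
    calc _ = C.κ * (6 * D.K + 3 * (sn + h) + 12) := by ring
      _ ≤ _ := Nat.mul_le_mul_left _ (by omega)
  refine Tri.cons (Tri.ifE rfl (fun hz => ?_) (fun hz => ?_))
  · refine Tri.assign (if cnt0 + (D.tst t).score h b = (D.tst t).need h ∧ s1 + s2 = 0 then a + 1 else 0)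
      rfl (by omega) (fun _ => ?_) (fun _ => by split <;> omega) (Tri.nil ?_)
    · simp [E.eval, Op.eval, h10, h5]
      by_cases h1 : cnt0 + (D.tst t).score h b = (D.tst t).need h <;> by_cases h2 : s1 = 0 ∧ s2 = 0 <;>
        simp [h1, h2]
    · refine ⟨?_, ?_, rfl, rfl, ?_⟩
      · have hz' : u.v 2 = 0 ∨ u.v 2 = a + 1 := by
          by_contra hcon; push Not at hcon
          exact hz (by simp [E.eval, Op.eval, h10, hcon.1, hcon.2])
        have : s1 + s2 = 0 ↔ (D.tst t).Cand (u.pre C (sn + h)) h a := by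
          rw [Nat.add_eq_zero_iff, hz1, hz2]; rfl
        simp only [Tst.step, if_pos hz', this, ← hcnt0]
        norm_num
      · intro r hr
        simp at hr
        simp [hr]
      · simp
        omega
  · refine Tri.skip (Tri.nil ?_)
    refine ⟨?_, ?_, rfl, rfl, ?_⟩
    · have hz' : ¬ (u.v 2 = 0 ∨ u.v 2 = a + 1) := by
        intro hcon
        simp [E.eval, Op.eval, h10] at hz
        tauto
      simp only [Tst.step, if_neg hz', ← hcnt0]
      norm_num
    · intro r hr
      simp at hr
      simp [hr]
    · simp
      omega

end PiDel

/-! ### Finding one image and testing one preassignment -/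

namespace PiDel
variable {C : Cfg} {D : Prob} {off : ℕ → ℕ} {u : US} {t : ℕ}

/-- `drive` runs the scan over all items, at cost at most `T`. -/
def DriveSpec (C : Cfg) (D : Prob) (off : ℕ → ℕ) (drive : Prog) (T : ℕ) : Prop :=
  ∀ (t : ℕ) (u : US) (h sn : ℕ), t / D.B ^ D.K < D.q → Sit C D off t u → Bd C u → u.v 9 = h →
    h < (D.tst t).m → u.v 5 = (D.tst t).need h → u.v 15 = sn → sn < D.K →
    u.v 2 = 0 → u.v 3 = 0 → u.v 4 = 0 →
    Tri C drive u fun u' => u'.v 2 = (D.tst t).find (u.pre C (sn + h)) h ∧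
      (∀ r, r ∉ [2, 3, 4, 6, 8, 10, 11, 18] → u'.v r = u.v r) ∧ u'.m = u.m ∧ u'.c ≤ u.c + T

/-- Found vertices stem from items; the bound shows that they fit into a work cell. -/
theorem Tst.find_le (T : Tst) {n : ℕ} (h : ∀ it ∈ T.τ, it.1 < n) (excl : List ℕ) (v : ℕ) :
    T.find excl v ≤ n := by
  have key : ∀ (l : List (ℕ × ℕ)) (s : Scan), (∀ it ∈ l, it.1 < n) → s.res ≤ n →
      (l.foldl (T.step excl v) s).res ≤ n := by
    intro l
    induction l with
    | nil => intro s _ h; exact h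
    | cons it l ih =>
      intro s hl hs
      refine ih _ (fun x hx => hl x (List.mem_cons_of_mem _ hx)) ?_
      have := hl it List.mem_cons_self
      have hle : ∀ {p : Prop} {_ : Decidable p}, (if p then it.1 + 1 else 0) ≤ n := by
        intro p _; split <;> omega
      simp only [Tst.step]
      split
      · exact hle
      · exact hs
  exact key _ _ h (Nat.zero_le _)

theorem US.pre_succ (C : Cfg) (u : US) (k : ℕ) :
    u.pre C (k + 1) = u.pre C k ++ [u.m (C.W0 + 3 * k + 2)] := by
  simp [US.pre, List.range_succ]

theorem US.pre_congr {C : Cfg} {u u' : US} {k : ℕ}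
    (h : ∀ i < k, u'.m (C.W0 + 3 * i + 2) = u.m (C.W0 + 3 * i + 2)) : u'.pre C k = u.pre C k := by
  simp only [US.pre]
  refine List.map_congr_left fun i hi => h i (by simpa using hi)

theorem US.length_pre (C : Cfg) (u : US) (k : ℕ) : (u.pre C k).length = k := by simp [US.pre]

open Classical in
-- Register 1 carries the conjunction of all checks of the test so far. The image is stored even
-- after a failure.
theorem find_tri {drive : Prog} {T : ℕ} (hd : DriveSpec C D off drive T) (hS : Setup C D off)
    (ht : t / D.B ^ D.K < D.q) (hs : Sit C D off t u) {h sn : ℕ} (hb : Bd C u)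
    (h9 : u.v 9 = h) (hh : h < (D.tst t).m) (h15 : u.v 15 = sn) (hsn : sn < D.K) (h1 : u.v 1 ≤ 1) :
    Tri C (findP drive) u fun u' =>
      u'.v 1 = (if u.v 1 = 1 ∧ (D.tst t).Flag h ∧ (D.tst t).find (u.pre C (sn + h)) h ≠ 0 then 1 else 0) ∧
      (∀ r, r ∉ [1, 2, 3, 4, 5, 6, 7, 8, 10, 11, 18] → u'.v r = u.v r) ∧
      (∀ a, u'.m a = if a = C.W0 + 3 * (sn + h) + 2 then (D.tst t).find (u.pre C (sn + h)) h - 1 else u.m a) ∧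
      u'.c ≤ u.c + (T + C.κ * (20 * (D.K + D.B))) := by
  have hp := hS.p
  have hV := C.hV
  have hK := hb.v24 hS
  have hW := hb.v29 hS
  have hbase := hS.base _ ht
  have hmeq : (D.tst t).m = D.M (t / D.B ^ D.K) := rfl
  have hKBV := hS.KBV
  have hH : ∀ j < (D.tst t).m, u.m (off (t / D.B ^ D.K) + 1 + h * (D.tst t).m + j) = (D.tst t).H h j := by
    intro j hj
    have := hS.mat _ ht h hh j hj
    exact (hb.inp _ this.1).trans this.2
  have hP := hs.P
  have hptr := hs.ptr
  have hm' := hs.m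
  have hnV := hS.nV
  have hneed : (D.tst t).need h ≤ D.K := (D.tst t).need_le (fun h j => hS.bit _ h j) h
  have hfind := (D.tst t).find_le hS.items (u.pre C (sn + h)) h
  unfold findP
  refine Tri.cons (Tri.assign 0 rfl (by omega) (fun _ => rfl) (fun _ => by simp) ?_)
  refine Tri.cons (Tri.sumE D.K ((D.tst t).need h)
    (fun i => if (D.tst t).P i < (D.tst t).m then (D.tst t).H h ((D.tst t).P i) else 0)
    rfl rfl (by omega) (by omega) (by norm_num) (by omega) ?_ ?_ ?_ (by omega) ?_)
  · intro u' _ hv hm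
    simp [E.eval, hv, hK]
  · intro j u' _ hv hm hj hjK
    simp only [E.eval, arrE, addrE, matE, Op.eval, hm, hj, US.tick_m, US.set_m]
    rw [hv 29 (by norm_num) (by norm_num), hv 14 (by norm_num) (by norm_num),
      hv 13 (by norm_num) (by norm_num), hv 9 (by norm_num) (by norm_num)]
    norm_num [hW, hptr, hm', h9]
    rw [hP j hjK]
    by_cases h2 : (D.tst t).P j < (D.tst t).m <;> simp [h2]
    rw [hH _ h2]
  · simp; rfl
  refine Tri.cons (Tri.assign 0 rfl (by omega) (fun _ => rfl) (fun _ => by simp) ?_)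
  set s1 := ∑ i ∈ Finset.range (D.tst t).m, (D.tst t).H h i with hs1
  have hs1' : s1 ≤ (D.tst t).m := by
    refine (Finset.sum_le_card_nsmul _ _ 1 fun i _ => hS.bit _ _ _).trans (by simp)
  refine Tri.cons (Tri.sumE (D.tst t).m s1 (fun i => (D.tst t).H h i)
    rfl rfl (by omega) (by omega) (by norm_num) (by omega) ?_ ?_ ?_ (by omega) ?_)
  · intro u' _ hv hm
    simp [E.eval, hv, hm']
  · intro j u' _ hv hm hj hjK
    simp only [E.eval, matE, Op.eval, hm, hj, US.tick_m, US.set_m]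
    rw [hv 14 (by norm_num) (by norm_num),
      hv 13 (by norm_num) (by norm_num), hv 9 (by norm_num) (by norm_num)]
    norm_num [hptr, hm', h9]
    rw [hH _ hjK]
  · simp [hs1]
  refine Tri.cons (Tri.assign 0 rfl (by omega) (fun _ => rfl) (fun _ => by simp) ?_)
  set s2 := ∑ i ∈ Finset.range D.K, if (D.tst t).P i = h then 1 else 0 with hs2
  have hs2' : s2 ≤ D.K := sum_ite_one_le _ _
  refine Tri.cons (Tri.sumE D.K s2 (fun i => if (D.tst t).P i = h then 1 else 0)
    rfl rfl (by omega) (by omega) (by norm_num) (by omega) ?_ ?_ ?_ (by omega) ?_)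
  · intro u' _ hv hm
    simp [E.eval, hv, hK]
  · intro j u' _ hv hm hj hjK
    simp only [E.eval, arrE, addrE, Op.eval, hm, hj, US.tick_m, US.set_m]
    rw [hv 29 (by norm_num) (by norm_num), hv 9 (by norm_num) (by norm_num)]
    norm_num [hW, h9]
    rw [hP j hjK]
  · simp [hs2]
  -- `s2` counts the cover vertices assigned to `h`, and `s1` is the degree of `h` in the test
  -- graph.
  have hflag : (D.tst t).Flag h ↔ (s2 ≠ 0 ∨ s1 = (D.tst t).need h) := by
    rw [hs2, Ne, sum_ite_one_eq_zero, Tst.Flag]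
    push Not
    rfl
  refine Tri.cons (Tri.assign (if u.v 1 = 1 ∧ (D.tst t).Flag h then 1 else 0) rfl (by omega) (fun _ => ?_)
    (fun _ => by split <;> omega) ?_)
  · simp only [E.eval, notE, Op.eval, hflag]
    norm_num
    have : u.v 1 = 0 ∨ u.v 1 = 1 := by omega
    rcases this with e | e <;> by_cases e2 : s2 = 0 <;> by_cases e3 : s1 = (D.tst t).need h <;> simp [e, e2, e3]
  refine Tri.cons (Tri.assign 0 rfl (by omega) (fun _ => rfl) (fun _ => by simp) ?_)
  refine Tri.cons (Tri.assign 0 rfl (by omega) (fun _ => rfl) (fun _ => by simp) ?_)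
  refine Tri.cons (Tri.assign 0 rfl (by omega) (fun _ => rfl) (fun _ => by simp) ?_)
  refine Tri.cons (Tri.bd fun hb3 => (hd t _ h sn ht ⟨?_, ?_, ?_⟩ hb3 ?_ hh ?_ ?_ hsn ?_ ?_ ?_).mono ?_)
  · simpa using hptr
  · simpa using hm'
  · simpa using hP
  · simpa using h9
  · simp
  · simpa using h15
  · simp
  · simp
  · simp
  rintro u2 hb2 ⟨g1, g2, g3, g4⟩
  have g1' : u2.v 2 = (D.tst t).find (US.pre C u (sn + h)) h := g1
  have hu1 : u2.v 1 = if u.v 1 = 1 ∧ (D.tst t).Flag h then 1 else 0 := by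
    rw [g2 1 (by simp)]; simp
  refine Tri.cons (Tri.assign (if u.v 1 = 1 ∧ (D.tst t).Flag h ∧ u2.v 2 ≠ 0 then 1 else 0) rfl (by omega) (fun _ => ?_)
    (fun _ => by split <;> omega) ?_)
  · simp only [E.eval, notE, Op.eval, hu1]
    by_cases e : u.v 1 = 1 ∧ (D.tst t).Flag h <;> by_cases e2 : u2.v 2 = 0 <;> simp [e, e2]
  refine Tri.cons (Tri.store (C.W0 + 3 * (sn + h) + 2) (u2.v 2 - 1) rfl rfl (fun hb' => ?_) (fun _ => ?_) (by omega) ?_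
    (fun _ => ?_) (Tri.nil ?_))
  · have := hb'.v29 hS
    simp only [addrE, E.eval, Op.eval, this]
    simp [g2, h15, h9]
  · simp [E.eval, Op.eval]
  · have := hS.ws
    omega
  · have := hS.nVm
    rw [g1']
    omega
  refine ⟨by simp [g1'], ?_, ?_, ?_⟩
  · intro r hr
    simp at hr
    simp [hr, g2]
  · intro a
    simp [g1', g3]
  · simp at g4 ⊢
    have h2 := hS.B2
    have : C.κ + C.κ * (3 * D.K + 2) + C.κ + C.κ * (3 * (D.tst t).m + 2) + C.κ + C.κ * (3 * D.K + 2) + C.κ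
        + C.κ + C.κ + C.κ + C.κ + 2 * C.κ + C.κ ≤ C.κ * (20 * (D.K + D.B)) := by
      calc _ = C.κ * (6 * D.K + 3 * (D.tst t).m + 17) := by ring
        _ ≤ _ := Nat.mul_le_mul_left _ (by omega)
    omega

open Classical in
-- The invariant of the loop: array 2 holds S followed by the images of the first `j` vertices,
-- which is just the exclusion list of the next scan.
theorem test_tri {drive : Prog} {T : ℕ} (hd : DriveSpec C D off drive T) (hS : Setup C D off)
    (ht : t / D.B ^ D.K < D.q) (hs : Sit C D off t u) {sn : ℕ}
    (h15 : u.v 15 = sn) (hsn : sn < D.K) :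
    Tri C (testP drive) u fun u' =>
      u'.v 1 = (if D.Hit (u.pre C sn) t then 1 else 0) ∧
      (∀ r, r ∉ [1, 2, 3, 4, 5, 6, 7, 8, 9, 10, 11, 18] → u'.v r = u.v r) ∧
      (∀ a, (∀ i, sn ≤ i → a ≠ C.W0 + 3 * i + 2) → u'.m a = u.m a) ∧
      u'.pre C (sn + (D.tst t).m) = u.pre C sn ++ (D.tst t).images (u.pre C sn) (D.tst t).m ∧
      u'.c ≤ u.c + D.B * (T + C.κ * (30 * (D.K + D.B))) := by
  have hp := hS.p
  have hV := C.hV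
  have hKBV := hS.KBV
  have hbase := hS.base _ ht
  have hmeq : (D.tst t).m = D.M (t / D.B ^ D.K) := rfl
  have hm' := hs.m
  have hB2 := hS.B2
  set S := u.pre C sn with hSdef
  have hm1 : (D.tst t).m + 1 ≤ D.B := by omega
  unfold testP
  refine Tri.cons (Tri.assign 1 rfl (by omega) (fun _ => rfl) (fun _ => by omega) ?_)
  refine Tri.cons (Tri.forE rfl (by omega) (D.tst t).m (by omega) (fun j u' =>
    u'.v 1 = (if (D.tst t).Ok S j then 1 else 0) ∧
      (∀ r, r ∉ [1, 2, 3, 4, 5, 6, 7, 8, 9, 10, 11, 18] → u'.v r = u.v r) ∧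
      (∀ a, (∀ i, sn ≤ i → a ≠ C.W0 + 3 * i + 2) → u'.m a = u.m a) ∧
      u'.pre C (sn + j) = S ++ (D.tst t).images S j ∧
      u'.c ≤ u.c + 2 * C.κ + j * (T + C.κ * (20 * (D.K + D.B) + 2))) ?_ ?_ ?_ ?_)
  · rintro j u' hj hb' ⟨-, h2, -⟩
    simp [E.eval, h2, hm']
  · rintro j u' hj hb' ⟨h1, h2, h3, h4, h5⟩ hx
    refine (find_tri (h := j) hd hS ht (sn := sn) (t := t) ⟨?_, ?_, ?_⟩ (hb'.tick _) ?_ hj ?_ hsn ?_).mono ?_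
    · simp [h2, hs.ptr]
    · simp [h2, hs.m]
    · intro i hi
      rw [← hs.P i hi]
      exact h3 _ (fun i' _ => by omega)
    · simpa using hx
    · simp [h2, h15]
    · simp only [US.tick_v, h1]; split <;> simp
    · rintro u2 hb2 ⟨g1, g2, g3, g4⟩
      have e : US.pre C (u'.tick C.κ) (sn + j) = S ++ (D.tst t).images S j := h4
      rw [e] at g1 g3
      refine ⟨by simp [g2, hx], ?_, ?_, ?_, ?_, ?_⟩
      · simp only [US.tick_v, US.set_v, g1, h1]
        norm_num
        have : (D.tst t).Ok S (j + 1) ↔ (D.tst t).Ok S j ∧ (D.tst t).Flag j ∧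
            ¬ (D.tst t).find (S ++ (D.tst t).images S j) j = 0 := by
          simp only [Tst.Ok, Nat.lt_succ_iff_lt_or_eq]
          constructor
          · intro H; exact ⟨fun g hg => H g (Or.inl hg), H j (Or.inr rfl)⟩
          · rintro ⟨H1, H2⟩ g (hg | rfl)
            · exact H1 g hg
            · exact H2
        simp [this]
      · intro r hr
        have := h2 r hr
        simp at hr
        simp [hr, g2, this]
      · intro a ha
        simp only [US.tick_m, US.set_m]
        rw [g3, if_neg (ha _ (by omega))]
        exact h3 a ha
      · rw [← add_assoc, US.pre_succ]
        have : US.pre C ((u2.set 9 (j + 1)).tick C.κ) (sn + j) = u'.pre C (sn + j) := by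
          refine US.pre_congr fun i hi => ?_
          simp only [US.tick_m, US.set_m]
          rw [g3, if_neg (by omega)]; rfl
        rw [this, h4]
        simp only [US.tick_m, US.set_m, g3, Tst.images, if_true, List.append_assoc]
      · simp at g4 ⊢
        have e : (j + 1) * (T + C.κ * (20 * (D.K + D.B) + 2)) = j * (T + C.κ * (20 * (D.K + D.B) + 2))
          + T + C.κ * (20 * (D.K + D.B)) + 2 * C.κ := by ring
        omega
  · refine ⟨by simp [Tst.Ok], ?_, fun _ _ => rfl, by simp [Tst.images]; rfl, by simp; omega⟩
    intro r hr
    simp at hr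
    simp [hr]
  · rintro u' hb' ⟨h1, h2, h3, h4, h5⟩ hx
    refine Tri.nil ⟨?_, ?_, ?_, ?_, ?_⟩
    · exact h1
    · exact h2
    · exact h3
    · exact h4
    · have : 2 * C.κ + (D.tst t).m * (T + C.κ * (20 * (D.K + D.B) + 2)) + C.κ + C.κ ≤
          D.B * (T + C.κ * (30 * (D.K + D.B))) := by
        calc _ ≤ 4 * C.κ + (D.tst t).m * (T + C.κ * (30 * (D.K + D.B))) := by
              have : (D.tst t).m * (T + C.κ * (20 * (D.K + D.B) + 2)) ≤ (D.tst t).m * (T + C.κ * (30 * (D.K + D.B))) :=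
                Nat.mul_le_mul_left _ (Nat.add_le_add_left (Nat.mul_le_mul_left _ (by omega)) _)
              omega
          _ ≤ (1 + (D.tst t).m) * (T + C.κ * (30 * (D.K + D.B))) := by
              have : 4 * C.κ ≤ C.κ * (30 * (D.K + D.B)) := by
                rw [mul_comm]; exact Nat.mul_le_mul_left _ (by omega)
              rw [add_mul]; omega
          _ ≤ _ := Nat.mul_le_mul_right _ (by omega)
      simp at h5 ⊢
      omega

end PiDel

/-! ### Counters in base B and the search through all tests -/

namespace PiDel
variable {C : Cfg} {D : Prob} {off : ℕ → ℕ} {u : US} {t : ℕ}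

/-- A carry reaches digit `i` exactly when all lower digits wrap around, that is, when `B ^ i`
divides `j + 1`; and it passes on exactly when the digit then becomes `B`. -/
theorem digit_succ {B j i : ℕ} (hB : 2 ≤ B) :
    (j / B ^ i % B + if B ^ i ∣ j + 1 then 1 else 0) *
        (1 - if (j / B ^ i % B + if B ^ i ∣ j + 1 then 1 else 0) = B then 1 else 0) = (j + 1) / B ^ i % B ∧
      ((j / B ^ i % B + if B ^ i ∣ j + 1 then 1 else 0) = B ↔ B ^ (i + 1) ∣ j + 1) := by
  have hlt : j / B ^ i % B < B := Nat.mod_lt _ (by omega)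
  rw [Nat.succ_div]
  by_cases hd : B ^ i ∣ j + 1
  · have hx : (j + 1) / B ^ i = j / B ^ i + 1 := by rw [Nat.succ_div, if_pos hd]
    simp only [hd, if_true]
    have h2 : B ^ (i + 1) ∣ j + 1 ↔ B ∣ j / B ^ i + 1 := by
      rw [← hx, pow_succ, Nat.dvd_div_iff_mul_dvd hd]
    have h3 : j / B ^ i % B + 1 = B ↔ B ∣ j / B ^ i + 1 := by
      rw [← Nat.mod_add_div (j / B ^ i) B, add_right_comm,
        (Nat.dvd_add_iff_left (Dvd.intro _ rfl)).symm]
      simp only [Nat.add_mul_mod_self_left, Nat.mod_mod]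
      constructor
      · intro h; rw [h]
      · intro h; exact le_antisymm hlt (Nat.le_of_dvd (by omega) h)
    refine ⟨?_, by rw [h2, h3]⟩
    by_cases h4 : j / B ^ i % B + 1 = B
    · simp [h4, Nat.dvd_iff_mod_eq_zero.1 (h3.1 h4)]
    · have : j / B ^ i % B + 1 < B := by omega
      simp only [h4, if_false]
      rw [Nat.add_mod, Nat.mod_eq_of_lt (by omega : 1 < B), Nat.mod_eq_of_lt this]
      simp
  · have h2 : ¬ B ^ (i + 1) ∣ j + 1 := fun h => hd ((pow_dvd_pow B (Nat.le_succ i)).trans h)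
    simp only [hd, h2, if_false, add_zero]
    refine ⟨?_, by simp; omega⟩
    rw [if_neg (by omega)]; simp

/-- Serves both the branching counter (array 0) and the preassignment counter (array 1). A carry out
of the top digit signals that all numbers have been visited. -/
theorem incr_tri (hS : Setup C D off) {eN : E} (hok : (E.op .lt (.v 8) eN).ok = true)
    {k N j : ℕ} (hk : k < 2)
    (hN : ∀ u', Bd C u' → eN.eval u' = N) (hNK : N ≤ D.K) (hj : j < D.B ^ N)
    (hdig : ∀ i < N, u.m (C.W0 + 3 * i + k) = j / D.B ^ i % D.B) :
    Tri C (incrP k eN) u fun u' =>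
      (∀ i < N, u'.m (C.W0 + 3 * i + k) = (j + 1) / D.B ^ i % D.B) ∧
      u'.v 16 = (if j + 1 < D.B ^ N then 0 else 1) ∧
      (∀ r, r ∉ [6, 8, 16] → u'.v r = u.v r) ∧
      (∀ a, (∀ i, a ≠ C.W0 + 3 * i + k) → u'.m a = u.m a) ∧
      u'.c ≤ u.c + C.κ * (8 * (D.K + D.B)) := by
  have hp := hS.p
  have hV := C.hV
  have hKBV := hS.KBV
  have hB2 := hS.B2
  have hBV := hS.BVm
  have hVm := C.hVm
  have hws := hS.ws
  have k0 : k = 0 ∨ k = 1 := by omega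
  have ok1 : ∀ i : ℕ, i = k → (addrE k (.v 8)).ok = true ∧
      (E.op .add (arrE k (.v 8)) (.v 16)).ok = true := by
    rintro i -; rcases k0 with rfl | rfl <;> exact ⟨rfl, rfl⟩
  unfold incrP
  refine Tri.cons (Tri.assign 1 rfl (by omega) (fun _ => rfl) (fun _ => by omega) ?_)
  refine Tri.cons (Tri.forE hok (by omega) N (by omega) (fun i u' =>
    (∀ i' < i, u'.m (C.W0 + 3 * i' + k) = (j + 1) / D.B ^ i' % D.B) ∧
    (∀ i', i ≤ i' → i' < N → u'.m (C.W0 + 3 * i' + k) = j / D.B ^ i' % D.B) ∧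
    u'.v 16 = (if D.B ^ i ∣ j + 1 then 1 else 0) ∧
    (∀ r, r ∉ [6, 8, 16] → u'.v r = u.v r) ∧
      (∀ a, (∀ i, a ≠ C.W0 + 3 * i + k) → u'.m a = u.m a) ∧
      u'.c ≤ u.c + C.κ * (2 + 8 * i)) ?_ ?_ ?_ ?_)
  · exact fun i u' _ hb' _ => hN u' hb'
  · rintro i u' hi hb' ⟨h1, h2, h3, h4, h5, h6⟩ hx
    obtain ⟨e1, e2⟩ := digit_succ (j := j) (i := i) hB2
    have hlt : j / D.B ^ i % D.B < D.B := Nat.mod_lt _ (by omega)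
    have hW := hb'.v29 hS
    have hBB := hb'.v30 hS
    have h2i := h2 i le_rfl hi
    set x := j / D.B ^ i % D.B + if D.B ^ i ∣ j + 1 then 1 else 0 with hxdef
    have hxB : x ≤ D.B := by rw [hxdef]; split <;> omega
    refine Tri.cons (Tri.assign x (ok1 k rfl).2 (by omega) (fun _ => ?_) (fun _ => by omega) ?_)
    · simp only [E.eval, arrE, addrE, Op.eval, US.tick_m, US.tick_v, hW, hx, h3, hxdef, h2i]
    refine Tri.cons (Tri.assign (if x = D.B then 1 else 0) rfl (by omega) (fun _ => ?_)
      (fun _ => by split <;> omega) ?_)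
    · simp [E.eval, Op.eval, hBB]
    have hle : (j + 1) / D.B ^ i % D.B ≤ D.B := (Nat.mod_lt _ (by omega)).le
    refine Tri.cons (Tri.store (C.W0 + 3 * i + k) ((j + 1) / D.B ^ i % D.B) rfl (ok1 k rfl).1
      (fun _ => ?_) (fun _ => ?_) (by omega) (by omega) (fun _ => by omega) (Tri.nil ?_))
    · simp [E.eval, addrE, Op.eval, hW, hx]
    · rw [← e1]; simp [E.eval, notE, Op.eval]
    refine ⟨by simp [hx], ?_, ?_, ?_, ?_, ?_, ?_⟩
    · intro i' hi'
      by_cases hii : i' = i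
      · simp [hii]
      · simp [hii, h1 i' (by omega)]
    · intro i' hi' hi'N
      have hii : i' ≠ i := by omega
      simp [hii, h2 i' (by omega) hi'N]
    · simp [e2]
    · intro r hr
      have := h4 r hr
      simp at hr
      simp [hr, this]
    · intro a ha
      simp [ha i, h5 a ha]
    · simp
      calc _ ≤ u.c + C.κ * (2 + 8 * i) + 7 * C.κ := by omega
        _ ≤ _ := by nlinarith
  · refine ⟨by simp, fun i _ hi => hdig i hi, by simp, ?_, fun _ _ => rfl, by simp; omega⟩
    intro r hr
    simp at hr
    simp [hr]
  · rintro u' hb' ⟨h1, h2, h3, h4, h5, h6⟩ hx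
    refine Tri.nil ⟨h1, ?_, h4, h5, ?_⟩
    · simp only [US.tick_v, h3]
      by_cases h : j + 1 < D.B ^ N
      · rw [if_pos h, if_neg]
        intro hd
        exact absurd (Nat.le_of_dvd (by omega) hd) (by omega)
      · rw [if_neg h, if_pos]
        rw [show j + 1 = D.B ^ N by omega]
    · simp
      calc _ ≤ u.c + C.κ * (2 + 8 * N) + 2 * C.κ := by omega
        _ = u.c + C.κ * (4 + 8 * N) := by ring
        _ ≤ _ := Nat.add_le_add_left (Nat.mul_le_mul_left _ (by omega)) _

/-- The index of a test is decoded into the graph number and the preassignment number. -/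
theorem tst_P {t hi j : ℕ} (hj : j < D.B ^ D.K) (ht : t = hi * D.B ^ D.K + j) :
    t / D.B ^ D.K = hi ∧ ∀ i, (D.tst t).P i = j / D.B ^ i % D.B := by
  have hpos : 0 < D.B ^ D.K := by omega
  subst ht
  refine ⟨by rw [mul_comm, Nat.mul_add_div hpos, Nat.div_eq_of_lt hj, add_zero], fun i => ?_⟩
  simp only [Prob.tst]
  rw [mul_comm, Nat.mul_add_mod, Nat.mod_eq_of_lt hj]

/-- Flag and chosen vertices after the tests before `t`. -/
def Searched (C : Cfg) (D : Prob) (S : List ℕ) (sn t : ℕ) (u : US) : Prop :=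
  (u.v 1 = 0 ∧ ∀ t' < t, ¬ D.Hit S t') ∨
  (u.v 1 = 1 ∧ ∃ t0 < t, D.Hit S t0 ∧ (∀ t' < t0, ¬ D.Hit S t') ∧
    u.pre C (sn + (D.tst t0).m) = S ++ (D.tst t0).images S (D.tst t0).m)

theorem Searched.congr {S : List ℕ} {sn t : ℕ} {u u' : US} (h : Searched C D S sn t u)
    (hv : u'.v 1 = u.v 1) (hm : ∀ i, u'.m (C.W0 + 3 * i + 2) = u.m (C.W0 + 3 * i + 2)) :
    Searched C D S sn t u' := by
  have : ∀ k, u'.pre C k = u.pre C k := fun k => US.pre_congr fun i _ => hm i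
  unfold Searched
  simp only [this, hv]
  exact h

/-- Bound for the cost of one round of the search. -/
def Cfg.round (C : Cfg) (D : Prob) (T : ℕ) : ℕ := D.B * (T + C.κ * (30 * (D.K + D.B)))

/-- The two nested loops visit the test indices in increasing order, so the copy kept belongs to the
least successful index. -/
theorem search_tri {drive : Prog} {T : ℕ} (hd : DriveSpec C D off drive T) (hS : Setup C D off)
    (hb : Bd C u) {sn : ℕ} (h15 : u.v 15 = sn) (hsn : sn < D.K)
    (hP : ∀ i < D.K, u.m (C.W0 + 3 * i + 1) = 0) :
    Tri C (searchP drive) u fun u' =>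
      Searched C D (u.pre C sn) sn (D.q * D.B ^ D.K) u' ∧
      (∀ i < D.K, u'.m (C.W0 + 3 * i + 1) = 0) ∧
      (∀ r, r ∉ [1, 2, 3, 4, 5, 6, 7, 8, 9, 10, 11, 12, 13, 14, 16, 17, 18] → u'.v r = u.v r) ∧
      (∀ a, (∀ i, a ≠ C.W0 + 3 * i + 1) → (∀ i, sn ≤ i → a ≠ C.W0 + 3 * i + 2) → u'.m a = u.m a) ∧
      u'.c ≤ u.c + (5 * C.κ + D.q * (10 * C.κ + D.B ^ D.K * (C.round D T + C.κ * (20 * (D.K + D.B))))) := by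
  have hp := hS.p
  have hV := C.hV
  have hKBV := hS.KBV
  have hB2 := hS.B2
  have hqV := hS.qV
  have hf := hb.v28 hS
  have hpos : 0 < D.B ^ D.K := Nat.pow_pos (by omega)
  set S := u.pre C sn with hSdef
  set R := C.round D T + C.κ * (20 * (D.K + D.B)) with hR
  have hf0 : off 0 ≤ C.V := by rw [← hf]; exact hb.var _ (by norm_num)
  unfold searchP
  refine Tri.cons (Tri.assign 0 rfl (by omega) (fun _ => rfl) (fun _ => by omega) ?_)
  refine Tri.cons (Tri.assign (off 0) rfl (by omega) (fun _ => by simpa [E.eval] using hf) (fun _ => hf0) ?_)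
  refine Tri.cons (Tri.forE rfl (by omega) D.q hqV (fun hi u' =>
    Searched C D S sn (hi * D.B ^ D.K) u' ∧ u'.v 13 = off hi ∧ (∀ i < D.K, u'.m (C.W0 + 3 * i + 1) = 0) ∧
    (∀ r, r ∉ [1, 2, 3, 4, 5, 6, 7, 8, 9, 10, 11, 12, 13, 14, 16, 17, 18] → u'.v r = u.v r) ∧
      (∀ a, (∀ i, a ≠ C.W0 + 3 * i + 1) → (∀ i, sn ≤ i → a ≠ C.W0 + 3 * i + 2) → u'.m a = u.m a) ∧
      u'.c ≤ u.c + (3 * C.κ + hi * (10 * C.κ + D.B ^ D.K * R))) ?_ ?_ ?_ ?_)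
  · intro j u' _ hb' _
    simpa [E.eval] using hb'.v25 hS
  · rintro hi u1 hhi hb1 ⟨a1, a2, a3, a4, a5, a6⟩ hx
    have hsz := hS.size hi hhi
    have hoff := hS.off hi hhi
    have hm : u1.m (off hi) = D.M hi := (hb1.inp _ hsz.1).trans hsz.2
    have hMV : D.M hi ≤ C.V := by rw [← hm]; exact hb1.mem _
    refine Tri.cons (Tri.assign (D.M hi) rfl (by omega) (fun _ => by simp [E.eval, a2, hm]) (fun _ => hMV) ?_)
    refine Tri.cons (Tri.assign 1 rfl (by omega) (fun _ => rfl) (fun _ => by omega) ?_)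
    refine Tri.cons (Tri.whileE rfl (D.B ^ D.K) (fun j u' =>
      Searched C D S sn (hi * D.B ^ D.K + j) u' ∧ u'.v 13 = off hi ∧ u'.v 14 = D.M hi ∧ u'.v 12 = hi ∧
      u'.v 17 = (if j < D.B ^ D.K then 1 else 0) ∧
      (∀ i < D.K, u'.m (C.W0 + 3 * i + 1) = j / D.B ^ i % D.B) ∧
      (∀ r, r ∉ [1, 2, 3, 4, 5, 6, 7, 8, 9, 10, 11, 12, 13, 14, 16, 17, 18] → u'.v r = u.v r) ∧
      (∀ a, (∀ i, a ≠ C.W0 + 3 * i + 1) → (∀ i, sn ≤ i → a ≠ C.W0 + 3 * i + 2) → u'.m a = u.m a) ∧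
      u'.c ≤ u1.c + (3 * C.κ + j * R)) ?_ ?_ ?_ ?_)
    · rintro j u2 hj hb2 ⟨b1, b2, b3, b4, b5, b6, b7, b8, b9⟩
      refine ⟨by simp [E.eval, b5, hj], ?_⟩
      obtain ⟨tq, tP⟩ := tst_P (D := D) (hi := hi) hj rfl
      set t := hi * D.B ^ D.K + j with ht
      -- So far only array 1 and the entries of array 2 from `sn` on were written, so S is intact.
      have hpre : u2.pre C sn = S := US.pre_congr fun i hi =>
        b8 _ (fun i' => by omega) (fun i' hi' => by omega)
      have hmid : Tri C (ifE (.v 1) skip (testP drive)) (u2.tick C.κ) fun u' =>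
          Searched C D S sn (t + 1) u' ∧
          (∀ r, r ∉ [1, 2, 3, 4, 5, 6, 7, 8, 9, 10, 11, 18] → u'.v r = u2.v r) ∧
          (∀ a, (∀ i, sn ≤ i → a ≠ C.W0 + 3 * i + 2) → u'.m a = u2.m a) ∧
          u'.c ≤ u2.c + (3 * C.κ + C.round D T) := by
        refine Tri.ifE rfl (fun hz => Tri.skip ?_) (fun hz => ?_)
        · refine ⟨?_, fun _ _ => rfl, fun _ _ => rfl, by simp; omega⟩
          have hz' : u2.v 1 ≠ 0 := hz
          rcases b1 with ⟨c1, -⟩ | ⟨c1, t0, c2, c3⟩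
          · exact absurd c1 hz'
          · exact Or.inr ⟨c1, t0, by omega, c3⟩
        · refine (test_tri (t := t) hd hS (by rw [tq]; exact hhi) (sn := sn) ⟨?_, ?_, ?_⟩ ?_ hsn).mono ?_
          · simpa [tq] using b2
          · simpa [Prob.tst, tq] using b3
          · intro i hi'
            rw [tP]
            exact b6 i hi'
          · simpa [b7] using h15
          · rintro u3 hb3 ⟨c1, c2, c3, c4, c5⟩
            have hpre' : US.pre C ((u2.tick C.κ).tick C.κ) sn = S := hpre
            rw [hpre'] at c1 c4
            refine ⟨?_, fun r hr => by simpa using c2 r hr, fun a ha => by simpa using c3 a ha, ?_⟩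
            · have hz' : u2.v 1 = 0 := hz
              rcases b1 with ⟨-, d2⟩ | ⟨d1, -⟩
              · by_cases hh : D.Hit S t
                · exact Or.inr ⟨by simp [c1, hh], t, by omega, hh, d2, c4⟩
                · refine Or.inl ⟨by simp [c1, hh], fun t' ht' => ?_⟩
                  rcases Nat.lt_succ_iff_lt_or_eq.1 ht' with h | rfl
                  · exact d2 _ h
                  · exact hh
              · omega
            · simp [Cfg.round] at c5 ⊢
              omega
      refine Tri.cons (hmid.mono ?_)
      rintro u3 hb3 ⟨c1, c2, c3, c4⟩
      refine Tri.cons ((incr_tri (N := D.K) (j := j) hS rfl (by norm_num) (fun u' hb' => by simpa [E.eval] using hb'.v24 hS)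
        le_rfl hj (fun i hi' => by rw [c3 _ (fun i' _ => by omega)]; exact b6 i hi')).mono ?_)
      rintro u4 hb4 ⟨d1, d2, d3, d4, d5⟩
      refine Tri.cons (Tri.assign (if j + 1 < D.B ^ D.K then 1 else 0) rfl (by omega) (fun _ => ?_)
        (fun _ => by split <;> omega) (Tri.nil ?_))
      · simp only [notE, E.eval, Op.eval, d2]; split <;> simp
      refine ⟨?_, ?_, ?_, ?_, ?_, ?_, ?_, ?_, ?_⟩
      · exact c1.congr (by simp [d3]) (fun i => by simp [d4 _ (fun i' => by omega : ∀ i', C.W0 + 3 * i + 2 ≠ C.W0 + 3 * i' + 1)])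
      · simp [d3, c2, b2]
      · simp [d3, c2, b3]
      · simp [d3, c2, b4]
      · simp
      · intro i hi'
        simpa using d1 i hi'
      · intro r hr
        have e1 := b7 r hr
        simp at hr
        simp [hr, d3, c2, e1]
      · intro a ha ha'
        simp [d4 a ha, c3 a ha', b8 a ha ha']
      · simp
        have : 3 * C.κ + C.round D T + C.κ * (8 * (D.K + D.B)) + C.κ + C.κ ≤ R := by
          rw [hR]
          have : C.κ * (8 * (D.K + D.B)) + 5 * C.κ ≤ C.κ * (20 * (D.K + D.B)) := by
            calc _ = C.κ * (8 * (D.K + D.B) + 5) := by ring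
              _ ≤ _ := Nat.mul_le_mul_left _ (by omega)
          omega
        have e : (j + 1) * R = j * R + R := by ring
        omega
    · rintro u2 hb2 ⟨b1, b2, b3, b4, b5, -⟩
      simp [E.eval, b5]
    · refine ⟨?_, ?_, ?_, ?_, ?_, ?_, ?_, ?_, ?_⟩
      · exact a1.congr (by simp) (fun i => rfl)
      · simp [a2]
      · simp
      · simp [hx]
      · simp [hpos]
      · intro i hi'
        simpa using a3 i hi'
      · intro r hr
        have e1 := a4 r hr
        simp at hr
        simp [hr, e1]
      · intro a ha ha'
        simp [a5 a ha ha']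
      · simp; omega
    · rintro u2 hb2 ⟨b1, b2, b3, b4, b5, b6, b7, b8, b9⟩
      refine Tri.cons (Tri.assign (off (hi + 1)) rfl (by omega) (fun _ => ?_) (fun _ => by omega) (Tri.nil ?_))
      · simp [E.eval, Op.eval, b2, b3, hoff.1]
      refine ⟨by simp [b4], ?_, ?_, ?_, ?_, ?_, ?_⟩
      · rw [add_mul, one_mul]
        exact b1.congr (by simp) (fun i => rfl)
      · simp
      · intro i hi'
        -- The counter has overflowed: the lower K digits of `B ^ K` vanish, as the next graph
        -- requires.
        simp only [US.tick_m, US.set_m, b6 i hi']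
        rw [Nat.pow_div (by omega) (by omega)]
        exact Nat.mod_eq_zero_of_dvd (dvd_pow_self _ (by omega))
      · intro r hr
        have e1 := b7 r hr
        simp at hr
        simp [hr, e1]
      · intro a ha ha'
        simp [b8 a ha ha']
      · simp
        have e : (hi + 1) * (10 * C.κ + D.B ^ D.K * R) = hi * (10 * C.κ + D.B ^ D.K * R) + 10 * C.κ + D.B ^ D.K * R := by ring
        omega
  · refine ⟨Or.inl ⟨by simp, by simp⟩, by simp, hP, ?_, fun _ _ _ => rfl, by simp; omega⟩
    intro r hr
    simp at hr
    simp [hr]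
  · rintro u' hb' ⟨a1, a2, a3, a4, a5, a6⟩ hx
    exact Tri.nil ⟨a1.congr rfl (fun _ => rfl), a3, a4, a5, by simp; omega⟩

end PiDel

/-! ### Branching over the deletion set -/

namespace PiDel
variable {C : Cfg} {D : Prob} {off : ℕ → ℕ} {u : US} {t : ℕ}

/-- No test succeeds: the graph without `S` contains no graph of the family. -/
def Prob.Clean (D : Prob) (S : List ℕ) : Prop := ∀ t < D.q * D.B ^ D.K, ¬ D.Hit S t

/-- Branching according to the digits `dig`, from depth `k` and set `S`, ends in a clean set. -/
inductive Wins (D : Prob) (dig : ℕ → ℕ) : ℕ → List ℕ → Prop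
  | clean {k : ℕ} {S : List ℕ} (hk : k ≤ D.l) (h : D.Clean S) : Wins D dig k S
  | step {k : ℕ} {S : List ℕ} {t : ℕ} (hk : k < D.l) (ht : D.First S t) (hd : dig k < (D.tst t).m)
      (h : Wins D dig (k + 1) (S ++ [((D.tst t).images S (D.tst t).m).getD (dig k) 0])) :
      Wins D dig k S

def Prob.dig (D : Prob) (j i : ℕ) : ℕ := j / D.B ^ i % D.B

/-- Bound for the cost of a search. -/
def Cfg.scost (C : Cfg) (D : Prob) (T : ℕ) : ℕ :=
  5 * C.κ + D.q * (10 * C.κ + D.B ^ D.K * (C.round D T + C.κ * (20 * (D.K + D.B))))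

theorem US.getD_pre (C : Cfg) (u : US) {k i : ℕ} (h : i < k) :
    (u.pre C k).getD i 0 = u.m (C.W0 + 3 * i + 2) := by
  simp [US.pre, List.getD_eq_getElem?_getD, h]

/-- The answer register never falls back from 1, and is raised only by a failed search with at most
ℓ deleted vertices. Conversely, the search is deterministic, so array 2 follows the path of a
winning digit string until such a failure occurs. The exponent `min D.l (D.K - 1)` is ℓ when ℓ < K
and also serves the trivial case. -/
theorem branch_tri {drive : Prog} {T : ℕ} (hd : DriveSpec C D off drive T) (hS : Setup C D off)
    (hb : Bd C u) (h0 : u.v 0 = 0) (hz : ∀ a, C.W0 ≤ a → u.m a = 0) :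
    Tri C (branchP drive) u fun u' =>
      (D.l < D.K → (u'.v 0 = 1 → ∃ S : List ℕ, S.length ≤ D.l ∧ D.Clean S) ∧
        ((∃ j < D.B ^ D.l, Wins D (D.dig j) 0 []) → u'.v 0 = 1)) ∧
      (D.K ≤ D.l → u'.v 0 = 1) ∧
      u'.c ≤ u.c + (5 * C.κ + D.B ^ min D.l (D.K - 1) * (D.K * (C.scost D T + 20 * C.κ) + C.κ * (20 * (D.K + D.B)))) := by
  have hp := hS.p
  have hV := C.hV
  have hKBV := hS.KBV
  have hB2 := hS.B2
  have hws := hS.ws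
  have hl := hb.v26 hS
  have hK := hb.v24 hS
  have hpos : 0 < D.B ^ D.l := Nat.pow_pos (by omega)
  set SC := C.scost D T with hSC
  set R := D.K * (SC + 20 * C.κ) + C.κ * (20 * (D.K + D.B)) with hR
  unfold branchP
  refine Tri.ifE rfl (fun hlt => ?_) (fun hge => ?_)
  swap
  · have hge' : ¬ D.l < D.K := by simpa [E.eval, Op.eval, hl, hK] using hge
    refine Tri.assign 1 rfl (by omega) (fun _ => rfl) (fun _ => by omega) ?_
    exact ⟨fun h => absurd h hge', fun _ => by simp, by simp; omega⟩
  have hlt' : D.l < D.K := by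
    by_contra hcon
    exact hlt (by simp [E.eval, Op.eval, hl, hK, hcon])
  have hmin : min D.l (D.K - 1) = D.l := by omega
  rw [hmin]
  refine Tri.cons (Tri.assign 1 rfl (by omega) (fun _ => rfl) (fun _ => by omega) ?_)
  refine Tri.cons (Tri.whileE rfl (D.B ^ D.l) (fun j u' =>
    u'.v 0 ≤ 1 ∧ (u'.v 0 = 1 → ∃ S : List ℕ, S.length ≤ D.l ∧ D.Clean S) ∧
    (∀ j' < j, Wins D (D.dig j') 0 [] → u'.v 0 = 1) ∧
    u'.v 19 = (if j < D.B ^ D.l then 1 else 0) ∧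
    (∀ i < D.l, u'.m (C.W0 + 3 * i + 0) = D.dig j i) ∧
    (∀ i < D.K, u'.m (C.W0 + 3 * i + 1) = 0) ∧
    u'.c ≤ u.c + (2 * C.κ + j * R)) ?_ ?_ ?_ ?_)
  · rintro j u1 hj hb1 ⟨a1, a2, a3, a4, a5, a6, a7⟩
    refine ⟨by simp [E.eval, a4, hj], ?_⟩
    refine Tri.cons (Tri.forE rfl (by omega) (D.l + 1) (by omega) (fun sn u' =>
      u'.v 0 ≤ 1 ∧ (u'.v 0 = 1 → ∃ S : List ℕ, S.length ≤ D.l ∧ D.Clean S) ∧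
      (u1.v 0 = 1 → u'.v 0 = 1) ∧
      (Wins D (D.dig j) 0 [] → u'.v 0 = 1 ∨ (sn ≤ D.l ∧ Wins D (D.dig j) sn (u'.pre C sn))) ∧
      (∀ i < D.l, u'.m (C.W0 + 3 * i + 0) = D.dig j i) ∧
      (∀ i < D.K, u'.m (C.W0 + 3 * i + 1) = 0) ∧
      u'.c ≤ u1.c + (2 * C.κ + sn * (SC + 10 * C.κ))) ?_ ?_ ?_ ?_)
    · intro sn u' _ hb' _
      simp [E.eval, Op.eval, hb'.v26 hS]
    · rintro sn u2 hsn hb2 ⟨b1, b2, b3, b4, b5, b6, b7⟩ hx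
      refine Tri.cons (Tri.bd fun hbt => (search_tri (sn := sn) hd hS hbt (by simpa using hx) (by omega)
        (by simpa using b6)).mono ?_)
      rintro u3 hb3 ⟨c1, c2, c3, c4, c5⟩
      have hpt : US.pre C (u2.tick C.κ) sn = u2.pre C sn := rfl
      rw [hpt] at c1
      have hpre : u3.pre C sn = u2.pre C sn := US.pre_congr fun i hi =>
        c4 _ (fun i' => by omega) (fun i' hi' => by omega)
      have hu31 : u3.v 1 ≤ 1 := by rcases c1 with ⟨e, -⟩ | ⟨e, -⟩ <;> omega
      have hu30 : u3.v 0 = u2.v 0 := by rw [c3 0 (by simp)]; rfl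
      obtain ⟨w, hwd⟩ : ∃ w, w = if u2.v 0 = 1 ∨ u3.v 1 = 0 then 1 else 0 := ⟨_, rfl⟩
      have hw1 : w = 1 ↔ (u2.v 0 = 1 ∨ u3.v 1 = 0) := by rw [hwd]; split <;> simp_all
      have hwle : w ≤ 1 := by rw [hwd]; split <;> simp
      refine Tri.cons (Tri.assign w rfl (by omega) (fun _ => ?_)
        (fun _ => by omega) ?_)
      · simp only [notE, E.eval, Op.eval, hu30, hwd]
        have e1 : u2.v 0 = 0 ∨ u2.v 0 = 1 := by omega
        have e2 : u3.v 1 = 0 ∨ u3.v 1 = 1 := by omega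
        rcases e1 with e1 | e1 <;> rcases e2 with e2 | e2 <;> simp [e1, e2]
      have hW := hb3.v29 hS
      set d := u3.m (C.W0 + 3 * sn + 0) with hdd
      refine Tri.cons (Tri.store (C.W0 + 3 * sn + 2) (u3.m (C.W0 + 3 * (sn + d) + 2)) rfl rfl (fun _ => ?_)
        (fun _ => ?_) (by omega) (by omega) (fun _ => hb3.work _ (by omega)) (Tri.nil ?_))
      · simp [addrE, E.eval, Op.eval, hW, c3, hx]
      · simp [arrE, addrE, E.eval, Op.eval, hW, c3, hx, hdd]
      refine ⟨by simp [c3, hx], ?_, ?_, ?_, ?_, ?_, ?_, ?_⟩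
      · simpa using hwle
      · simp only [US.tick_v, US.set_v, US.store_v]
        norm_num
        rw [hw1]
        intro h
        by_cases e : u2.v 0 = 1
        · exact b2 e
        · rcases h with h | h
          · exact absurd h e
          · rcases c1 with ⟨-, e2⟩ | ⟨e2, -⟩
            · exact ⟨u2.pre C sn, by rw [US.length_pre]; omega, e2⟩
            · omega
      · intro h
        simp [hw1, b3 h]
      · intro hw
        simp only [US.tick_v, US.set_v, US.store_v]
        norm_num
        rw [hw1]
        rcases b4 hw with h | ⟨hle, hW'⟩
        · exact Or.inl (Or.inl h)
        · rcases c1 with ⟨e1, e2⟩ | ⟨e1, t0, e2, e3, e4, e5⟩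
          · exact Or.inl (Or.inr e1)
          · right
            have hF : D.First (u2.pre C sn) t0 := ⟨e2, e3, e4⟩
            cases hW' with
            | clean _ hc => exact absurd e3 (hc t0 e2)
            | step hk ht hdg h =>
              -- The copy in memory is the one the winning path refers to.
              obtain rfl := hF.unique ht
              refine ⟨hk, ?_⟩
              have hds : d = D.dig j sn := by
                rw [hdd, ← b5 sn hk]
                exact c4 _ (fun i => by omega) (fun i _ => by omega)
              convert h using 1
              rw [US.pre_succ]
              congr 1
              · rw [← hpre]
                refine US.pre_congr fun i hi => ?_
                have : ¬ (C.W0 + 3 * i + 2 = C.W0 + 3 * sn + 2) := by omega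
                simp; omega
              · have h6 := US.getD_pre C u3 (k := sn + (D.tst t0).m) (i := sn + d) (by omega)
                rw [e5, List.getD_append_right _ _ _ _ (by rw [US.length_pre]; omega), US.length_pre] at h6
                simp only [US.tick_m, US.set_m, US.store_m, if_true]
                rw [← h6, ← hds, Nat.add_sub_cancel_left]
      · intro i hi
        have : ¬ (C.W0 + 3 * i + 0 = C.W0 + 3 * sn + 2) := by omega
        simp only [US.tick_m, US.set_m, US.store_m, this, if_false]
        rw [c4 _ (fun i' => by omega) (fun i' _ => by omega)]
        exact b5 i hi
      · intro i hi
        have : ¬ (C.W0 + 3 * i + 1 = C.W0 + 3 * sn + 2) := by omega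
        simp only [US.tick_m, US.set_m, US.store_m, this, if_false]
        exact c2 i hi
      · simp [Cfg.scost] at c5 hSC ⊢
        have e : (sn + 1) * (SC + 10 * C.κ) = sn * (SC + 10 * C.κ) + SC + 10 * C.κ := by ring
        omega
    · refine ⟨by simpa using a1, by simpa using a2, by simp, ?_, by simpa using a5, by simpa using a6, by simp; omega⟩
      intro h
      exact Or.inr ⟨Nat.zero_le _, h⟩
    · rintro u2 hb2 ⟨b1, b2, b3, b4, b5, b6, b7⟩ hx
      have hlV : D.B ^ D.l ≠ 0 := by omega
      refine Tri.cons ((incr_tri (N := D.l) (k := 0) (j := j) hS rfl (by norm_num)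
        (fun u' hb' => by simpa [E.eval] using hb'.v26 hS) (by omega) hj (by simpa [Prob.dig] using b5)).mono ?_)
      rintro u3 hb3 ⟨d1, d2, d3, d4, d5⟩
      refine Tri.cons (Tri.assign (if j + 1 < D.B ^ D.l then 1 else 0) rfl (by omega) (fun _ => ?_)
        (fun _ => by split <;> omega) (Tri.nil ?_))
      · simp only [notE, E.eval, Op.eval, d2]; split <;> simp
      have hu30 : u3.v 0 = u2.v 0 := by rw [d3 0 (by simp)]; rfl
      refine ⟨by simpa [hu30] using b1, by simpa [hu30] using b2, ?_, by simp, by simpa [Prob.dig] using d1, ?_, ?_⟩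
      · intro j' hj' hw
        simp only [US.tick_v, US.set_v, hu30]
        norm_num
        rcases Nat.lt_succ_iff_lt_or_eq.1 hj' with h | rfl
        · exact b3 (a3 j' h hw)
        · rcases b4 hw with h | ⟨h, -⟩
          · exact h
          · omega
      · intro i hi
        simp only [US.tick_m, US.set_m]
        rw [d4 _ (fun i' => by omega)]
        exact b6 i hi
      · simp at d5 ⊢
        have e : (j + 1) * R = j * R + R := by ring
        have e2 : (D.l + 1) * (SC + 10 * C.κ) ≤ D.K * (SC + 10 * C.κ) := Nat.mul_le_mul_right _ (by omega)
        have e3 : C.κ * (8 * (D.K + D.B)) + 10 * C.κ ≤ C.κ * (20 * (D.K + D.B)) := by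
          calc _ = C.κ * (8 * (D.K + D.B) + 10) := by ring
            _ ≤ _ := Nat.mul_le_mul_left _ (by omega)
        have e4 : R = D.K * (SC + 10 * C.κ) + D.K * (10 * C.κ) + C.κ * (20 * (D.K + D.B)) := by
          rw [hR]; ring
        omega
  · rintro u2 hb2 ⟨b1, b2, b3, b4, -⟩
    simp [E.eval, b4]
  · refine ⟨by simp [h0], by simp [h0], by simp, by simp [hpos], ?_, ?_, by simp; omega⟩
    · intro i _
      simp [Prob.dig, hz]
    · intro i _
      exact hz _ (by omega)
  · rintro u2 hb2 ⟨b1, b2, b3, b4, b5, b6, b7⟩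
    refine Tri.nil ⟨fun _ => ⟨b2, fun ⟨j, hj, hw⟩ => b3 j hj hw⟩, fun h => by omega, ?_⟩
    simp
    omega

end PiDel

namespace PiDel
variable {C : Cfg} {D : Prob} {off : ℕ → ℕ} {u : US} {t : ℕ}

/-! ### Scanning the items on the two machines -/

def US.setRest (u : US) (l : List (ℕ × ℕ)) : US := { u with rest := l }

@[simp] theorem US.setRest_v (u : US) (l : List (ℕ × ℕ)) : (u.setRest l).v = u.v := rfl
@[simp] theorem US.setRest_m (u : US) (l : List (ℕ × ℕ)) : (u.setRest l).m = u.m := rfl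
@[simp] theorem US.setRest_rest (u : US) (l : List (ℕ × ℕ)) : (u.setRest l).rest = l := rfl
@[simp] theorem US.setRest_c (u : US) (l : List (ℕ × ℕ)) : (u.setRest l).c = u.c := rfl

theorem Tri.rewind {Q : US → Prop} (h : Q ((u.setRest C.σ).tick (C.α + C.β))) :
    Tri C .rewind u Q := by
  intro hb s hs
  refine ⟨_, (u.setRest C.σ).tick (C.α + C.β), .rewind, ?_, ⟨hb.1, hb.2, hb.3, hb.4⟩, h⟩
  refine ⟨hs.var, hs.mem, rfl, ?_⟩
  have := hs.cost
  simp only [State.tick, US.tick_c, US.setRest_c]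
  nlinarith

theorem Tri.next_item {Q : US → Prop} {e x y a b : ℕ} {l : List (ℕ × ℕ)} (he : e < C.p) (hx : x < C.p)
    (hy : y < C.p) (hr : u.rest = (a, b) :: l) (ha : a ≤ C.V) (hb : b ≤ C.V)
    (h : Q (((((u.set e 1).set x a).set y b).setRest l).tick C.α)) :
    Tri C (.next e x y) u Q := by
  intro hbd s hs
  have hp := C.hp
  have hV := C.hV
  have hlt : ∀ z ≤ C.V, ∀ r < 32, z < 2 ^ C.L.reg r := fun z hz r hr => by
    have h1 := C.hreg r (by omega)
    exact (hz.trans (Nat.le_self_pow (by norm_num) _)).trans_lt h1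
  have hb' := ((hbd.set he (k := 1) (by omega)).set hx ha).set hy hb
  refine ⟨_, ((((u.set e 1).set x a).set y b).setRest l).tick C.α, .next_item (hs.rest.trans hr) (hlt 1 (by omega) _ (by omega)) (hlt a ha _ (by omega))
    (hlt b hb _ (by omega)), ?_, ⟨hb'.1, hb'.2, hb'.3, hb'.4⟩, h⟩
  refine ⟨fun r hr => ?_, hs.mem, rfl, ?_⟩
  · simp [State.setReg, State.tick, Function.update_apply, hs.var r hr]
  · have := hs.cost
    simp only [State.tick, State.setReg, US.tick_c, US.setRest_c, US.set_c]
    nlinarith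

theorem Tri.next_end {Q : US → Prop} {e x y : ℕ} (he : e < C.p) (hr : u.rest = [])
    (h : Q ((u.set e 0).tick C.α)) : Tri C (.next e x y) u Q := by
  intro hbd s hs
  refine ⟨_, _, .next_end (hs.rest.trans hr), ?_, (hbd.set he (Nat.zero_le _)).tick _, h⟩
  refine ⟨fun r hr => ?_, hs.mem, hs.rest, ?_⟩
  · simp [State.setReg, State.tick, Function.update_apply, hs.var r hr]
  · have := hs.cost
    simp only [State.tick, State.setReg, US.tick_c, US.set_c]
    nlinarith

/-- Process all items of one pass over the stream. -/
def streamP : Prog := seqs [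
  .rewind,
  .next 18 10 11,
  whileE (.v 18) (seqs [itemP, .next 18 10 11])]

/-- With `α = 0` every ordinary statement is free, and a scan is charged for its single `rewind`. -/
theorem stream_drive (hS : Setup C D off) (hα : C.α = 0) (hτ : D.τ = C.σ) (hVσ : ∀ it ∈ D.τ, it.2 ≤ C.V) :
    DriveSpec C D off streamP C.β := by
  intro t u h sn ht hs hb h9 hh h5 h15 hsn h2 h3 h4
  have hp := hS.p
  have hκ : C.κ = 0 := by simp [Cfg.κ, hα]
  set N := D.τ.length with hN
  set ex := u.pre C (sn + h) with hex
  have hnV := hS.nV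
  -- With `j` items processed, the next one has already been read into registers 10 and 11; hence
  -- the unread part is `drop (j + 1)`.
  let Inv : ℕ → US → Prop := fun j u' =>
    (⟨u'.v 4, u'.v 3, u'.v 2⟩ : Scan) = (D.τ.take j).foldl ((D.tst t).step ex h) ⟨0, 0, 0⟩ ∧
    (u'.v 18 = if j < N then 1 else 0) ∧ u'.rest = D.τ.drop (j + 1) ∧
    (∀ hj : j < N, u'.v 10 = D.τ[j].1 ∧ u'.v 11 = D.τ[j].2) ∧
    (∀ r, r ∉ [2, 3, 4, 6, 8, 10, 11, 18] → u'.v r = u.v r) ∧ u'.m = u.m ∧ u'.c ≤ u.c + C.β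
  have hnext : ∀ j u', u'.rest = D.τ.drop j →
      (⟨u'.v 4, u'.v 3, u'.v 2⟩ : Scan) = (D.τ.take j).foldl ((D.tst t).step ex h) ⟨0, 0, 0⟩ →
      (∀ r, r ∉ [2, 3, 4, 6, 8, 10, 11, 18] → u'.v r = u.v r) → u'.m = u.m → u'.c ≤ u.c + C.β →
      Tri C (.next 18 10 11) u' (fun u2 => Tri C (seqs []) u2 (Inv j) ∧ Inv j u2) := by
    intro j u' hr hf hv hm hc
    have goal : ∀ u2, Inv j u2 → Tri C (seqs []) u2 (Inv j) ∧ Inv j u2 := by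
      rintro u2 ⟨i1, i2, i3, i4, i5, i6, i7⟩
      exact ⟨Tri.nil ⟨i1, i2, i3, i4, i5, i6, by simpa [hκ] using i7⟩, i1, i2, i3, i4, i5, i6, i7⟩
    by_cases hj : j < N
    · have hd : u'.rest = (D.τ[j].1, D.τ[j].2) :: D.τ.drop (j + 1) := by
        rw [hr, List.drop_eq_getElem_cons hj]
      have hmem : D.τ[j] ∈ D.τ := List.getElem_mem hj
      refine Tri.next_item (by omega) (by omega) (by omega) hd ((hS.items _ hmem).le.trans hnV.le) (hVσ _ hmem)
        (goal _ ⟨by simpa using hf, by simp [hj], by simp, fun _ => by simp, ?_, by simpa using hm, by simpa [hα] using hc⟩)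
      intro r hr'
      have := hv r hr'
      simp at hr'
      simp [hr', this]
    · have hd : u'.rest = [] := by rw [hr, List.drop_eq_nil_iff]; omega
      refine Tri.next_end (by omega) hd
        (goal _ ⟨by simpa using hf, by simp [hj], ?_, fun hj' => absurd hj' hj, ?_, by simpa using hm, by simpa [hα] using hc⟩)
      · simp only [US.tick_rest, US.set_rest, hd]
        symm; rw [List.drop_eq_nil_iff]; omega
      · intro r hr'
        have := hv r hr'
        simp at hr'
        simp [hr', this]
  unfold streamP
  refine Tri.cons (Tri.rewind ?_)
  refine Tri.cons ((hnext 0 _ (by simp [hτ]) (by simp [h2, h3, h4]) (by simp) (by simp) (by simp [hα])).mono ?_)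
  rintro u1 hb1 ⟨-, hi1⟩
  refine Tri.cons (Tri.whileE rfl N Inv ?_ ?_ hi1 ?_)
  · rintro j u2 hj hb2 ⟨i1, i2, i3, i4, i5, i6, i7⟩
    refine ⟨by simp [E.eval, i2, hj], ?_⟩
    obtain ⟨e1, e2⟩ := i4 hj
    have hmem : D.τ[j] ∈ D.τ := List.getElem_mem hj
    have hcnt : u2.v 3 + D.K * (D.K + 1) ≤ C.V := by
      have h1 : u2.v 3 = ((D.τ.take j).foldl ((D.tst t).step ex h) ⟨0, 0, 0⟩).cnt := by rw [← i1]
      have h2 := (D.tst t).cnt_foldl_take_le (fun h j => hS.bit _ h j) ex h (l := D.τ.take j) (N := D.τ.length)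
        (by simp)
      have h3 := hS.cntV
      rw [add_mul, one_mul] at h3
      have : (D.tst t).K = D.K := rfl
      rw [this] at h2
      omega
    refine Tri.cons (Tri.bd fun hbt => (item_tri (t := t) (h := h) (sn := sn) (a := D.τ[j].1) (b := D.τ[j].2) hS ht
      ⟨?_, ?_, ?_⟩ hbt ?_ hh e1 e2 ?_ ?_ hsn (hS.items _ hmem) hcnt).mono ?_)
    · simpa [i5] using hs.ptr
    · simpa [i5] using hs.m
    · simpa [i6] using hs.P
    · simpa [i5] using h9
    · simpa [i5] using h5
    · simpa [i5] using h15
    · rintro u3 hb3 ⟨f1, f2, f3, f4, f5⟩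
      refine Tri.cons ((hnext (j + 1) u3 ?_ ?_ ?_ ?_ ?_).mono fun u4 _ h => h.1)
      · rw [f4]; exact i3
      · have hpre : US.pre C (u2.tick C.κ) (sn + h) = ex := US.pre_congr fun i _ => by simp [i6]
        rw [f1, hpre]
        simp only [US.tick_v]
        rw [i1, List.take_succ_eq_append_getElem hj, List.foldl_append]
        rfl
      · intro r hr
        have := i5 r hr
        simp at hr
        simp [f2, hr, this]
      · rw [f3]; exact i6
      · simp [hκ] at f5; omega
  · rintro u2 _ ⟨-, i2, -⟩
    simp [E.eval, i2]
  · rintro u2 _ ⟨i1, i2, i3, i4, i5, i6, i7⟩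
    refine Tri.nil ⟨?_, i5, i6, by simpa [hκ] using i7⟩
    simp only [List.take_length, N] at i1
    simp only [US.tick_v, Tst.find]
    show u2.v 2 = (List.foldl ((D.tst t).step ex h) ⟨0, 0, 0⟩ D.τ).res
    rw [← i1]

/-- The items `(a, b)` with `a < n` and `b` in the cover adjacent to `a`, padded by `(a, n)`. -/
def ramItems (n K : ℕ) (X : ℕ → ℕ) (adj : ℕ → ℕ → ℕ) (a : ℕ) : List (ℕ × ℕ) :=
  (List.range a).flatMap fun a => (List.range K).map fun i => (a, if adj a (X i) = 1 then X i else n)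

theorem length_ramItems (n K : ℕ) (X : ℕ → ℕ) (adj : ℕ → ℕ → ℕ) (a : ℕ) :
    (ramItems n K X adj a).length = a * K := by
  simp [ramItems, List.length_flatMap]

/-- The matrix follows the four parameters and the K cover vertices. -/
def adjE : E :=
  .ld (.op .add (.op .add (.op .add (.c 4) (.v 24)) (.op .mul (.v 10) (.v 27))) (covE (.v 18)))

/-- Process all items by looking into the adjacency matrix. -/
def ramP : Prog := seqs [
  forE 10 (.v 27) (seqs [
    forE 18 (.v 24) (seqs [
      -- Arithmetic selection: the cover vertex if the bit is 1, the padding `n` if it is 0.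
      assign 11 (.op .add (.op .mul adjE (covE (.v 18))) (.op .mul (notE adjE) (.v 27))),
      itemP])])]

/-- Only the cover columns of the matrix are read, which makes a scan linear in n; padding makes the
number of items independent of the graph. -/
theorem ram_drive (hS : Setup C D off) (adj : ℕ → ℕ → ℕ) (hbit : ∀ a b, adj a b ≤ 1)
    (hadj : ∀ a < D.n, ∀ b < D.n, 4 + D.K + a * D.n + b < C.W0 ∧ C.inp (4 + D.K + a * D.n + b) = adj a b)
    (hX : ∀ i < D.K, D.X i < D.n)
    (hτ : D.τ = ramItems D.n D.K D.X adj D.n) :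
    DriveSpec C D off ramP (C.κ * (D.n * D.K * (50 * (D.K + D.B)))) := by
  intro t u h sn ht hs hb h9 hh h5 h15 hsn h2 h3 h4
  have hp := hS.p
  have hnV := hS.nV
  have hKBV := hS.KBV
  have hB2 := hS.B2
  set ex := u.pre C (sn + h) with hex
  have hlen : D.τ.length = D.n * D.K := by rw [hτ, length_ramItems]
  have hn1 : 1 ≤ D.n := by have := hX sn hsn; omega
  set R := C.κ * (30 * (D.K + D.B)) with hR
  unfold ramP
  refine Tri.cons (Tri.forE rfl (by omega) D.n hnV.le (fun a u' =>
    (⟨u'.v 4, u'.v 3, u'.v 2⟩ : Scan) = (ramItems D.n D.K D.X adj a).foldl ((D.tst t).step ex h) ⟨0, 0, 0⟩ ∧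
    (∀ r, r ∉ [2, 3, 4, 6, 8, 10, 11, 18] → u'.v r = u.v r) ∧ u'.m = u.m ∧
    u'.c ≤ u.c + (2 * C.κ + a * (10 * C.κ + D.K * R))) ?_ ?_ ?_ ?_)
  · intro j u' _ hb' _
    simpa [E.eval] using hb'.v27 hS
  · rintro a u1 ha hb1 ⟨a1, a2, a3, a4⟩ hx
    refine Tri.cons (Tri.forE rfl (by omega) D.K (by omega) (fun i u' =>
      (⟨u'.v 4, u'.v 3, u'.v 2⟩ : Scan) = (ramItems D.n D.K D.X adj a ++
        (List.range i).map fun i => (a, if adj a (D.X i) = 1 then D.X i else D.n)).foldl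
          ((D.tst t).step ex h) ⟨0, 0, 0⟩ ∧
      u'.v 10 = a ∧
      (∀ r, r ∉ [2, 3, 4, 6, 8, 10, 11, 18] → u'.v r = u.v r) ∧ u'.m = u.m ∧
      u'.c ≤ u1.c + (2 * C.κ + i * R)) ?_ ?_ ?_ ?_)
    · intro j u' _ hb' _
      simpa [E.eval] using hb'.v24 hS
    · rintro i u2 hi hb2 ⟨i1, i2, i3, i4, i5⟩ hx2
      set b := if adj a (D.X i) = 1 then D.X i else D.n with hbdef
      have hXi := hX i hi
      have hbV : b ≤ C.V := by rw [hbdef]; split <;> omega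
      refine Tri.cons (Tri.assign b rfl (by omega) (fun _ => ?_) (fun _ => hbV) ?_)
      · have e1 : u2.m (4 + i) = D.X i := (hb2.inp _ (hS.cov i hi).1).trans (hS.cov i hi).2
        have e2 : u2.m (4 + D.K + a * D.n + D.X i) = adj a (D.X i) :=
          (hb2.inp _ (hadj a ha _ hXi).1).trans (hadj a ha _ hXi).2
        simp only [E.eval, Op.eval, adjE, covE, notE, US.tick_v, US.tick_m, hb2.v24 hS, hb2.v27 hS, i2, hx2, e1, e2,
          hbdef]
        have e3 := hbit a (D.X i)
        have : adj a (D.X i) = 0 ∨ adj a (D.X i) = 1 := by omega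
        rcases this with e | e <;> simp [e]
      have hcnt : u2.v 3 + D.K * (D.K + 1) ≤ C.V := by
        have h1 : u2.v 3 = ((ramItems D.n D.K D.X adj a ++
          (List.range i).map fun i => (a, if adj a (D.X i) = 1 then D.X i else D.n)).foldl
          ((D.tst t).step ex h) ⟨0, 0, 0⟩).cnt := by rw [← i1]
        have h2 := (D.tst t).cnt_foldl_take_le (fun h j => hS.bit _ h j) ex h (l := ramItems D.n D.K D.X adj a ++
          (List.range i).map fun i => (a, if adj a (D.X i) = 1 then D.X i else D.n)) (N := D.τ.length)
          (by
            rw [hlen, List.length_append, length_ramItems, List.length_map, List.length_range]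
            have : (a + 1) * D.K ≤ D.n * D.K := Nat.mul_le_mul_right _ ha
            rw [add_mul] at this
            omega)
        have h3 := hS.cntV
        rw [add_mul, one_mul] at h3
        have : (D.tst t).K = D.K := rfl
        rw [this] at h2
        omega
      refine Tri.cons (Tri.bd fun hbt => (item_tri (t := t) (h := h) (sn := sn) (a := a) (b := b) hS ht
        ⟨?_, ?_, ?_⟩ hbt ?_ hh ?_ ?_ ?_ ?_ hsn ha ?_).mono ?_)
      · simpa [i3] using hs.ptr
      · simpa [i3] using hs.m
      · simpa [i4] using hs.P
      · simpa [i3] using h9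
      · simpa using i2
      · simp
      · simpa [i3] using h5
      · simpa [i3] using h15
      · simpa using hcnt
      · rintro u3 hb3 ⟨f1, f2, f3, f4, f5⟩
        refine Tri.nil ⟨by simp [f2, hx2], ?_, by simp [f2, i2], ?_, ?_, ?_⟩
        · have hpre : US.pre C (((u2.tick C.κ).set 11 b).tick C.κ) (sn + h) = ex :=
            US.pre_congr fun i _ => by simp [i4]
          rw [hpre] at f1
          have f1' : (⟨u3.v 4, u3.v 3, u3.v 2⟩ : Scan) = (D.tst t).step ex h ⟨u2.v 4, u2.v 3, u2.v 2⟩ (a, b) := f1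
          simp only [US.tick_v, US.set_v]
          norm_num
          rw [f1', i1, List.range_succ, List.map_append]
          simp [hbdef, List.foldl_append]
        · intro r hr
          have := i3 r hr
          simp at hr
          simp [f2, hr, this]
        · simp [f3, i4]
        · simp at f5 ⊢
          have e : (i + 1) * R = i * R + R := by ring
          have : C.κ * (20 * (D.K + D.B)) + 5 * C.κ ≤ R := by
            calc _ = C.κ * (20 * (D.K + D.B) + 5) := by ring
              _ ≤ _ := Nat.mul_le_mul_left _ (by omega)
          omega
    · refine ⟨by simpa using a1, by simp [hx], ?_, by simpa using a3, by simp; omega⟩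
      intro r hr
      have := a2 r hr
      simp at hr
      simp [hr, this]
    · rintro u2 hb2 ⟨i1, i2, i3, i4, i5⟩ hx2
      refine Tri.nil ⟨by simpa using i2, ?_, ?_, by simpa using i4, ?_⟩
      · simp only [US.tick_v, US.set_v]
        norm_num
        rw [i1]
        congr 1
        simp [ramItems, List.range_succ]
      · intro r hr
        have := i3 r hr
        simp at hr
        simp [hr, this]
      · simp
        have e : (a + 1) * (10 * C.κ + D.K * R) = a * (10 * C.κ + D.K * R) + 10 * C.κ + D.K * R := by ring
        omega
  · refine ⟨by simp [ramItems, h2, h3, h4], ?_, by simp, by simp; omega⟩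
    intro r hr
    simp at hr
    simp [hr]
  · rintro u2 _ ⟨i1, i2, i3, i4⟩ _
    refine Tri.nil ⟨?_, i2, i3, ?_⟩
    · simp only [US.tick_v, Tst.find]
      show u2.v 2 = (List.foldl ((D.tst t).step ex h) ⟨0, 0, 0⟩ D.τ).res
      rw [hτ, ← i1]
    · simp
      have e1 : 1 ≤ D.n * D.K := Nat.mul_pos hn1 (by omega)
      have e2 : 4 * C.κ + D.n * (10 * C.κ + D.K * R) ≤ C.κ * (D.n * D.K * (50 * (D.K + D.B))) := by
        have e3 : D.n * 1 ≤ D.n * D.K := Nat.mul_le_mul_left _ (by omega)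
        have e4 : 1 * 14 ≤ (D.n * D.K) * (20 * (D.K + D.B)) := by
          refine Nat.mul_le_mul e1 (by omega)
        calc 4 * C.κ + D.n * (10 * C.κ + D.K * R)
            = C.κ * (4 + D.n * 10 + D.n * D.K * (30 * (D.K + D.B))) := by rw [hR]; ring
          _ ≤ C.κ * (D.n * D.K * (50 * (D.K + D.B))) := by
            refine Nat.mul_le_mul_left _ ?_
            have : D.n * D.K * (50 * (D.K + D.B)) = D.n * D.K * (20 * (D.K + D.B)) + D.n * D.K * (30 * (D.K + D.B)) := by ring
            rw [this]
            have : D.n * D.K * 20 ≤ D.n * D.K * (20 * (D.K + D.B)) := Nat.mul_le_mul_left _ (by omega)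
            omega
      omega

/-! ### Initialization -/

/-- Exceeding every size by at least one, this base has the size itself as a digit, which serves to
mark a cover vertex as unused. -/
def maxSize (M : ℕ → ℕ) : ℕ → ℕ
  | 0 => 1
  | j + 1 => max (maxSize M j) (M j + 1)

theorem lt_maxSize {M : ℕ → ℕ} {i j : ℕ} (h : i < j) : M i < maxSize M j := by
  induction j with
  | zero => omega
  | succ j ih =>
    simp only [maxSize]
    rcases Nat.lt_succ_iff_lt_or_eq.1 h with h | rfl
    · have := ih h; omega
    · omega

theorem maxSize_le {M : ℕ → ℕ} {j b : ℕ} (h : ∀ i < j, M i ≤ b) : maxSize M j ≤ b + 1 := by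
  induction j with
  | zero => simp [maxSize]
  | succ j ih =>
    have h1 := ih fun i hi => h i (by omega)
    have h2 := h j (by omega)
    simp only [maxSize]
    omega

theorem maxSize_mono {M : ℕ → ℕ} {i j : ℕ} (h : i ≤ j) : maxSize M i ≤ maxSize M j := by
  induction j with
  | zero => obtain rfl : i = 0 := by omega
            exact le_rfl
  | succ j ih =>
    rcases Nat.le_succ_iff.1 h with h | rfl
    · exact (ih h).trans (le_max_left _ _)
    · exact le_rfl

def initP (fb : E) : Prog := seqs [
  assign 24 (.ld (.c 1)),
  assign 25 (.ld (.c 3)),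
  assign 26 (.ld (.c 2)),
  assign 27 (.ld (.c 0)),
  assign 28 fb,
  assign 13 (.v 28),
  assign 30 (.c 1),
  forE 12 (.v 25) (seqs [
    assign 14 (.ld (.v 13)),
    -- By truncated subtraction, `x + (y - x)` is the maximum.
    assign 30 (.op .add (.v 30) (.op .sub (.op .add (.v 14) (.c 1)) (.v 30))),
    assign 13 (.op .add (.op .add (.v 13) (.c 1)) (.op .mul (.v 14) (.v 14)))]),
  assign 29 (.v 13)]

/-- The configuration during initialization, with no constant variables. -/
def Cfg.free (C : Cfg) : Cfg := { C with p := 32, hp := le_rfl }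

theorem init_tri (hS : Setup C D off) (hb : Bd C.free u) (hu : ∀ r, u.v r = 0)
    (h0 : C.inp 0 = D.n) (h1 : C.inp 1 = D.K) (h2 : C.inp 2 = D.l) (h3 : C.inp 3 = D.q) (h4 : 4 ≤ C.W0)
    (hl : D.l ≤ C.V) (hB : D.B = maxSize D.M D.q) (hoff : off D.q = C.W0) {fb : E} (ok : fb.ok = true)
    (hfb : ∀ u', u'.v 24 = D.K → u'.v 27 = D.n → fb.eval u' = off 0) (hf0 : off 0 ≤ C.V) :
    Tri C.free (initP fb) u fun u' =>
      u'.v 24 = D.K ∧ u'.v 25 = D.q ∧ u'.v 26 = D.l ∧ u'.v 27 = D.n ∧ u'.v 28 = off 0 ∧ u'.v 29 = C.W0 ∧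
      u'.v 30 = D.B ∧ u'.v 31 = 0 ∧ u'.v 0 = 0 ∧ u'.m = u.m ∧ u'.c ≤ u.c + C.κ * (12 + 8 * D.q) := by
  have hp : C.free.p = 32 := rfl
  have hVe : C.free.V = C.V := rfl
  have hV := C.hV
  have hKBV := hS.KBV
  have hqV := hS.qV
  have hnV := hS.nV
  have hκ : C.free.κ = C.κ := rfl
  have i0 : u.m 0 = D.n := (hb.inp 0 (by change 0 < C.W0; omega)).trans h0
  have i1 : u.m 1 = D.K := (hb.inp 1 (by change 1 < C.W0; omega)).trans h1
  have i2 : u.m 2 = D.l := (hb.inp 2 (by change 2 < C.W0; omega)).trans h2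
  have i3 : u.m 3 = D.q := (hb.inp 3 (by change 3 < C.W0; omega)).trans h3
  unfold initP
  refine Tri.cons (Tri.assign D.K rfl (by omega) (fun _ => by simpa [E.eval] using i1) (fun _ => by omega) ?_)
  refine Tri.cons (Tri.assign D.q rfl (by omega) (fun _ => by simpa [E.eval] using i3) (fun _ => by omega) ?_)
  refine Tri.cons (Tri.assign D.l rfl (by omega) (fun _ => by simpa [E.eval] using i2) (fun _ => by omega) ?_)
  refine Tri.cons (Tri.assign D.n rfl (by omega) (fun _ => by simpa [E.eval] using i0) (fun _ => by omega) ?_)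
  refine Tri.cons (Tri.assign (off 0) ok (by omega) (fun _ => hfb _ (by simp) (by simp)) (fun _ => by omega) ?_)
  refine Tri.cons (Tri.assign (off 0) rfl (by omega) (fun _ => by simp [E.eval]) (fun _ => by omega) ?_)
  refine Tri.cons (Tri.assign 1 rfl (by omega) (fun _ => rfl) (fun _ => by omega) ?_)
  refine Tri.cons (Tri.forE rfl (by omega) D.q (by omega) (fun j u' =>
    u'.v 24 = D.K ∧ u'.v 25 = D.q ∧ u'.v 26 = D.l ∧ u'.v 27 = D.n ∧ u'.v 28 = off 0 ∧ u'.v 13 = off j ∧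
      u'.v 30 = maxSize D.M j ∧ u'.v 31 = 0 ∧ u'.v 0 = 0 ∧ u'.m = u.m ∧ u'.c ≤ u.c + C.κ * (8 + 8 * j)) ?_ ?_ ?_ ?_)
  · rintro j u' _ _ ⟨-, h, -⟩
    simpa [E.eval] using h
  · rintro j u' hj hb' ⟨a1, a2, a3, a4, a5, a6, a7, a8, a9, a10, a11⟩ hx
    have hm : u'.m (off j) = D.M j := (hb'.inp _ (hS.size j hj).1).trans (hS.size j hj).2
    have hMB := hS.base j hj
    have hmb : maxSize D.M (j + 1) ≤ D.B := by rw [hB]; exact maxSize_mono (by omega)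
    have ho := hS.off j hj
    refine Tri.cons (Tri.assign (D.M j) rfl (by omega) (fun _ => by simp [E.eval, a6, hm]) (fun _ => by omega) ?_)
    refine Tri.cons (Tri.assign (maxSize D.M (j + 1)) rfl (by omega) (fun _ => ?_) (fun _ => by omega) ?_)
    · simp [E.eval, Op.eval, a7, maxSize]; omega
    refine Tri.cons (Tri.assign (off (j + 1)) rfl (by omega) (fun _ => ?_) (fun _ => by omega) (Tri.nil ?_))
    · simp [E.eval, Op.eval, a6, ho.1]
    refine ⟨by simp [hx], by simp [a1], by simp [a2], by simp [a3], by simp [a4], by simp [a5], by simp, by simp,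
      by simp [a8], by simp [a9], by simp [a10], ?_⟩
    simp [hκ]
    calc _ ≤ u.c + C.κ * (8 + 8 * j) + 8 * C.κ := by omega
      _ = _ := by ring
  · refine ⟨by simp, by simp, by simp, by simp, by simp, by simp, by simp [maxSize], by simp [hu], by simp [hu], by simp, ?_⟩
    simp [hκ]; omega
  · rintro u' hb' ⟨a1, a2, a3, a4, a5, a6, a7, a8, a9, a10, a11⟩ hx
    refine Tri.cons (Tri.assign C.W0 rfl (by omega) (fun _ => by simp [E.eval, a6, hoff]) (fun _ => by omega) (Tri.nil ?_))
    refine ⟨by simp [a1], by simp [a2], by simp [a3], by simp [a4], by simp [a5], by simp, by simp [a7, hB],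
      by simp [a8], by simp [a9], by simp [a10], ?_⟩
    simp [hκ]
    calc _ ≤ u.c + C.κ * (8 + 8 * D.q) + 4 * C.κ := by omega
      _ = _ := by ring

def mainP (fb : E) (drive : Prog) : Prog := .seq (initP fb) (branchP drive)

theorem main_exec {drive : Prog} {T : ℕ} (hd : DriveSpec C D off drive T) (hS : Setup C D off) (input : List ℕ)
    (hinput : C.inp = fun a => input.getD a 0) (hW : C.W0 = input.length)
    (h0 : C.inp 0 = D.n) (h1 : C.inp 1 = D.K) (h2 : C.inp 2 = D.l) (h3 : C.inp 3 = D.q) (h4 : 4 ≤ C.W0)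
    (hl : D.l ≤ C.V) (hB : D.B = maxSize D.M D.q) (hoff : off D.q = C.W0) {fb : E} (ok : fb.ok = true)
    (hfb : ∀ u', u'.v 24 = D.K → u'.v 27 = D.n → fb.eval u' = off 0) (hf0 : off 0 ≤ C.V) (hg : C.g 31 = 0) :
    ∃ s', Exec C.L C.σ (mainP fb drive) (State.start input) s' ∧
      (D.l < D.K → (s'.reg 0 = 1 → ∃ S : List ℕ, S.length ≤ D.l ∧ D.Clean S) ∧
        ((∃ j < D.B ^ D.l, Wins D (D.dig j) 0 []) → s'.reg 0 = 1)) ∧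
      (D.K ≤ D.l → s'.reg 0 = 1) ∧
      C.α * s'.time + C.β * s'.passes ≤ C.κ * (12 + 8 * D.q) +
        (5 * C.κ + D.B ^ min D.l (D.K - 1) * (D.K * (C.scost D T + 20 * C.κ) + C.κ * (20 * (D.K + D.B)))) := by
  let u : US := ⟨fun _ => 0, fun a => input.getD a 0, [], 0⟩
  have hz : ∀ a, C.W0 ≤ a → input.getD a 0 = 0 := fun a ha => by
    rw [List.getD_eq_default _ _ (by omega)]
  have hb : Bd C.free u := by
    refine ⟨fun r _ => Nat.zero_le _, fun r hr hr' => ?_, fun a _ => by rw [Cfg.free, hinput], fun a ha => ?_⟩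
    · change 32 ≤ r at hr; omega
    · change input.getD a 0 ≤ _
      rw [hz a ha]; exact Nat.zero_le _
  have hr : Rep C.free (State.start input) u := ⟨fun _ _ => rfl, rfl, rfl, by simp [State.start, u]⟩
  obtain ⟨s1, u1, e1, r1, b1, q1⟩ := init_tri hS hb (fun _ => rfl) h0 h1 h2 h3 h4 hl hB hoff ok hfb hf0 hb _ hr
  obtain ⟨a1, a2, a3, a4, a5, a6, a7, a8, a9, a10, a11⟩ := q1
  -- Variables 24 to 31 now have their final values, so the stronger invariant, which freezes them,
  -- holds from here on.
  have b1' : Bd C u1 := by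
    refine ⟨b1.1, fun r hr hr' => ?_, b1.3, b1.4⟩
    rw [hS.p] at hr
    have hc : r = 24 ∨ r = 25 ∨ r = 26 ∨ r = 27 ∨ r = 28 ∨ r = 29 ∨ r = 30 ∨ r = 31 := by omega
    rcases hc with rfl | rfl | rfl | rfl | rfl | rfl | rfl | rfl
    · rw [hS.gK, a1]
    · rw [hS.gq, a2]
    · rw [hS.gl, a3]
    · rw [hS.gn, a4]
    · rw [hS.gf, a5]
    · rw [hS.gW, a6]
    · rw [hS.gB, a7]
    · rw [hg, a8]
  have r1' : Rep C s1 u1 := ⟨r1.1, r1.2, r1.3, r1.4⟩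
  obtain ⟨s2, u2, e2, r2, b2, c1, c2, c3⟩ := branch_tri hd hS b1' a9
    (fun a ha => by rw [a10]; exact hz a ha) b1' _ r1'
  have hr0 := r2.var 0 (by norm_num)
  refine ⟨s2, .seq e1 e2, by rwa [hr0], by rwa [hr0], r2.cost.trans ?_⟩
  have : u.c = 0 := rfl
  omega

end PiDel

namespace PiDel

/-! ### Correctness of the scan -/

namespace Tst

variable (T : Tst)

/-- Inside a block of `v` a verdict in `{0, v + 1}` is renewed at each item, so the last item
decides, when the count is complete; any other verdict stays. -/
theorem foldl_block (excl : List ℕ) (h v : ℕ) (l : List ℕ) (hl : l ≠ []) (s : Scan) :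
    ((l.map fun b => (v, b)).foldl (T.step excl h) s).cur = v ∧
    ((l.map fun b => (v, b)).foldl (T.step excl h) s).cnt =
      (if v = s.cur then s.cnt else 0) + (l.map (T.score h)).sum ∧
    (¬ (s.res = 0 ∨ s.res = v + 1) → ((l.map fun b => (v, b)).foldl (T.step excl h) s).res = s.res) ∧
    ((s.res = 0 ∨ s.res = v + 1) →
      ((if v = s.cur then s.cnt else 0) + (l.map (T.score h)).sum = T.need h ∧ T.Cand excl h v →
        ((l.map fun b => (v, b)).foldl (T.step excl h) s).res = v + 1) ∧
      (¬ ((if v = s.cur then s.cnt else 0) + (l.map (T.score h)).sum = T.need h ∧ T.Cand excl h v) →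
        ((l.map fun b => (v, b)).foldl (T.step excl h) s).res = 0)) := by
  induction l generalizing s with
  | nil => exact absurd rfl hl
  | cons b l ih =>
    by_cases hl' : l = []
    · subst hl'
      simp only [List.map_cons, List.map_nil, List.foldl_cons, List.foldl_nil, List.sum_cons, List.sum_nil, add_zero]
      refine ⟨rfl, rfl, fun h' => ?_, fun h' => ⟨fun h2 => ?_, fun h2 => ?_⟩⟩
      · simp only [step, if_neg h']
      · simp only [step, if_pos h', if_pos h2]
      · simp only [step, if_pos h', if_neg h2]
    · obtain ⟨i1, i2, i3, i4⟩ := ih hl' (T.step excl h s (v, b))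
      simp only [List.map_cons, List.foldl_cons, List.sum_cons]
      have hc : (T.step excl h s (v, b)).cur = v := rfl
      have hn : (T.step excl h s (v, b)).cnt = (if v = s.cur then s.cnt else 0) + T.score h b := rfl
      simp only [hc, if_true, hn, add_assoc] at i2 i3 i4
      have hr : ((T.step excl h s (v, b)).res = 0 ∨ (T.step excl h s (v, b)).res = v + 1) ↔
          (s.res = 0 ∨ s.res = v + 1) := by
        by_cases h' : s.res = 0 ∨ s.res = v + 1
        · simp only [step, if_pos h']
          simp only [h', iff_true]
          have hite : ∀ {p : Prop} {_ : Decidable p}, (if p then v + 1 else 0) = 0 ∨ (if p then v + 1 else 0) = v + 1 := by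
            intro p _; split <;> simp
          exact hite
        · simp only [step, if_neg h']
      refine ⟨i1, i2, fun h' => ?_, fun h' => i4 (hr.2 h')⟩
      rw [i3 (hr.not.2 h')]
      simp only [step, if_neg h']

/-- Each vertex has only one block, so no count is inherited at its start (`hcur`) and a stored find
belongs to another vertex (`hres`), hence survives. Empty blocks leave no trace and are exempt. -/
theorem foldl_blocks (excl : List ℕ) (h : ℕ) (nb : ℕ → List ℕ) (order : List ℕ) (hnd : order.Nodup) (s : Scan)
    (hcur : s.cur ∉ order ∨ s.cnt = 0)
    (hres : ∀ v ∈ order, s.res ≠ v + 1)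
    (hgood : ∀ v, s.res = v + 1 → ((nb v).map (T.score h)).sum = T.need h ∧ T.Cand excl h v) :
    (∀ v, ((order.flatMap fun v => (nb v).map fun b => (v, b)).foldl (T.step excl h) s).res = v + 1 →
      ((nb v).map (T.score h)).sum = T.need h ∧ T.Cand excl h v) ∧
    (((order.flatMap fun v => (nb v).map fun b => (v, b)).foldl (T.step excl h) s).res = 0 →
      s.res = 0 ∧ ∀ v ∈ order, nb v ≠ [] → ¬ (((nb v).map (T.score h)).sum = T.need h ∧ T.Cand excl h v)) := by
  induction order generalizing s with
  | nil => exact ⟨hgood, fun h => ⟨h, by simp⟩⟩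
  | cons v order ih =>
    simp only [List.flatMap_cons, List.foldl_append]
    rw [List.nodup_cons] at hnd
    by_cases hv : nb v = []
    · rw [hv]
      obtain ⟨j1, j2⟩ := ih hnd.2 s (hcur.imp_left fun h h' => h (List.mem_cons_of_mem _ h'))
        (fun w hw => hres w (List.mem_cons_of_mem _ hw)) hgood
      refine ⟨j1, fun h0 => ⟨(j2 h0).1, fun w hw hne => ?_⟩⟩
      rcases List.mem_cons.1 hw with rfl | hw
      · exact absurd hv hne
      · exact (j2 h0).2 w hw hne
    · obtain ⟨b1, b2, b3, b4⟩ := T.foldl_block excl h v (nb v) hv s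
      set s' := ((nb v).map fun b => (v, b)).foldl (T.step excl h) s
      have hc0 : (if v = s.cur then s.cnt else 0) = 0 := by
        rcases hcur with h | h
        · rw [if_neg]; rintro rfl; exact h List.mem_cons_self
        · rw [h]; simp
      rw [hc0, zero_add] at b2 b4
      have hs'good : ∀ w, s'.res = w + 1 → ((nb w).map (T.score h)).sum = T.need h ∧ T.Cand excl h w := by
        intro w hw
        by_cases h' : s.res = 0 ∨ s.res = v + 1
        · by_cases h2 : ((nb v).map (T.score h)).sum = T.need h ∧ T.Cand excl h v
          · have := (b4 h').1 h2
            obtain rfl : w = v := by omega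
            exact h2
          · have := (b4 h').2 h2
            omega
        · exact hgood w (by rw [← b3 h', hw])
      have hs'res : ∀ w ∈ order, s'.res ≠ w + 1 := by
        intro w hw hcon
        by_cases h' : s.res = 0 ∨ s.res = v + 1
        · by_cases h2 : ((nb v).map (T.score h)).sum = T.need h ∧ T.Cand excl h v
          · have := (b4 h').1 h2
            obtain rfl : w = v := by omega
            exact hnd.1 hw
          · have := (b4 h').2 h2
            omega
        · exact hres w (List.mem_cons_of_mem _ hw) (by rw [← b3 h', hcon])
      obtain ⟨j1, j2⟩ := ih hnd.2 s' (Or.inl (by rw [b1]; exact hnd.1)) hs'res hs'good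
      refine ⟨j1, fun h0 => ?_⟩
      obtain ⟨k1, k2⟩ := j2 h0
      have hsr : s.res = 0 := by
        by_contra hne
        have h' : ¬ (s.res = 0 ∨ s.res = v + 1) := by
          rintro (h | h)
          · exact hne h
          · exact hres v List.mem_cons_self h
        rw [b3 h'] at k1
        exact hne k1
      refine ⟨hsr, fun w hw hne h2 => ?_⟩
      rcases List.mem_cons.1 hw with rfl | hw
      · have := (b4 (Or.inl hsr)).1 h2
        omega
      · exact k2 w hw hne h2

/-- The vertex `v` of `G` is a legal image of `h`. -/
def Good (G : ℕ → ℕ → Prop) (excl : List ℕ) (h v : ℕ) : Prop :=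
  T.Cand excl h v ∧ ∀ i < T.K, T.P i < T.m → (G v (T.X i) ↔ T.H h (T.P i) = 1)

/-- Scans find legal images whenever there is one with a neighbour. -/
def Scans (G : ℕ → ℕ → Prop) : Prop := ∀ excl h,
  (T.find excl h ≠ 0 → T.Good G excl h (T.find excl h - 1)) ∧
  (∀ v w, G v w → T.Good G excl h v → T.find excl h ≠ 0)

/-- Exchange of summation: instead of scores of items, multiplicities of cover vertices. -/
theorem sum_score (h : ℕ) (l : List ℕ) : (l.map (T.score h)).sum =
    ∑ i ∈ Finset.range T.K, if T.P i < T.m then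
      l.count (T.X i) * (1 + T.need h * (1 - T.H h (T.P i))) else 0 := by
  induction l with
  | nil => simp
  | cons b l ih =>
    rw [List.map_cons, List.sum_cons, ih, score, ← Finset.sum_add_distrib]
    refine Finset.sum_congr rfl fun i _ => ?_
    by_cases h1 : T.X i = b <;> by_cases h2 : T.P i < T.m
    · simp [h1, h2]; ring
    · simp [h2]
    · have : ¬ b = T.X i := fun h => h1 h.symm
      simp [h1, h2, this]
    · simp [h2]

/-- One forbidden neighbour already contributes `need + 1`. Without one, every term is at most its
share of `need`, and equal sums force equal terms. -/
theorem sum_score_eq_need_iff (hbit : ∀ h j, T.H h j ≤ 1) (G : ℕ → ℕ → Prop) [DecidableRel G] (h v : ℕ) (l : List ℕ)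
    (hl : ∀ i < T.K, l.count (T.X i) = if G v (T.X i) then 1 else 0) :
    (l.map (T.score h)).sum = T.need h ↔ ∀ i < T.K, T.P i < T.m → (G v (T.X i) ↔ T.H h (T.P i) = 1) := by
  rw [sum_score]
  constructor
  · intro hs
    have h1 : ∀ i < T.K, T.P i < T.m → G v (T.X i) → T.H h (T.P i) = 1 := by
      intro i hi hP hG
      by_contra hne
      have h0 : T.H h (T.P i) = 0 := by have := hbit h (T.P i); omega
      have := Finset.single_le_sum (f := fun i => if T.P i < T.m then
        l.count (T.X i) * (1 + T.need h * (1 - T.H h (T.P i))) else 0) (fun _ _ => Nat.zero_le _)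
        (Finset.mem_range.2 hi)
      rw [hs] at this
      simp [hP, hl i hi, hG, h0] at this
    have h2 : ∀ i ∈ Finset.range T.K, (if T.P i < T.m then
        l.count (T.X i) * (1 + T.need h * (1 - T.H h (T.P i))) else 0) ≤ if T.P i < T.m then T.H h (T.P i) else 0 := by
      intro i hi
      rw [Finset.mem_range] at hi
      by_cases hP : T.P i < T.m
      · by_cases hG : G v (T.X i)
        · simp [hP, hl i hi, hG, h1 i hi hP hG]
        · simp [hP, hl i hi, hG]
      · simp [hP]
    have h3 := (Finset.sum_eq_sum_iff_of_le h2).1 hs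
    intro i hi hP
    refine ⟨h1 i hi hP, fun hH => ?_⟩
    by_contra hG
    have := h3 i (Finset.mem_range.2 hi)
    simp [hP, hl i hi, hG, hH] at this
  · intro hG
    refine Finset.sum_congr rfl fun i hi => ?_
    rw [Finset.mem_range] at hi
    by_cases hP : T.P i < T.m
    · have := hG i hi hP
      have hb := hbit h (T.P i)
      by_cases hg : G v (T.X i)
      · simp [hP, hl i hi, hg, this.1 hg]
      · have : T.H h (T.P i) = 0 := by
          by_contra h0
          exact hg (this.2 (by omega))
        simp [hP, hl i hi, hg, this]
    · simp [hP]

/-- A non-empty block is demanded only for vertices with a neighbour, since a stream does not show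
the others. -/
theorem scans_of_blocks (hbit : ∀ h j, T.H h j ≤ 1) (G : ℕ → ℕ → Prop) (nb : ℕ → List ℕ) (order : List ℕ)
    (hnd : order.Nodup) (hτ : T.τ = order.flatMap fun v => (nb v).map fun b => (v, b))
    (hcount : ∀ v ∈ order, ∀ i < T.K, (G v (T.X i) ∧ (nb v).count (T.X i) = 1) ∨ (¬ G v (T.X i) ∧ (nb v).count (T.X i) = 0))
    (hcov : ∀ v w, G v w → v ∈ order ∧ nb v ≠ []) : T.Scans G := by
  classical
  intro excl h
  have hcount' : ∀ v ∈ order, ∀ i < T.K, (nb v).count (T.X i) = if G v (T.X i) then 1 else 0 := by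
    intro v hv i hi
    rcases hcount v hv i hi with ⟨h1, h2⟩ | ⟨h1, h2⟩ <;> simp [h1, h2]
  obtain ⟨h1, h2⟩ := T.foldl_blocks excl h nb order hnd ⟨0, 0, 0⟩ (Or.inr rfl) (by simp) (by simp)
  rw [← hτ] at h1 h2
  constructor
  · intro hne
    obtain ⟨v, hv⟩ := Nat.exists_eq_succ_of_ne_zero hne
    have hg := h1 v hv
    rw [hv]
    simp only [Nat.succ_eq_add_one, Nat.add_sub_cancel]
    -- Multiplicities are controlled only along `order`, so the vertex found must be traced back to
    -- an item.
    have hvo : v ∈ order := by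
      have key : ∀ (l : List (ℕ × ℕ)) (s : Scan), (l.foldl (T.step excl h) s).res = v + 1 → s.res = v + 1 ∨ v ∈ l.map Prod.fst := by
        intro l
        induction l with
        | nil => intro s hs; exact Or.inl hs
        | cons it l ih =>
          intro s hs
          rcases ih _ hs with h' | h'
          · simp only [step] at h'
            by_cases hit : v = it.1
            · right; simp [hit]
            · left
              by_cases hc : s.res = 0 ∨ s.res = it.1 + 1
              · rw [if_pos hc] at h'
                rcases ite_eq_or_eq ((if it.1 = s.cur then s.cnt else 0) + T.score h it.2 = T.need h ∧
                  T.Cand excl h it.1) (it.1 + 1) 0 with e | e <;> rw [e] at h' <;> omega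
              · rwa [if_neg hc] at h'
          · right; simp only [List.map_cons, List.mem_cons]; exact Or.inr h'
      rcases key _ _ hv with h' | h'
      · simp at h'
      · rw [hτ] at h'
        simp at h'
        exact h'.1
    exact ⟨hg.2, (T.sum_score_eq_need_iff hbit G h v _ (hcount' v hvo)).1 hg.1⟩
  · intro v w hG hgood hz
    obtain ⟨hv, hne⟩ := hcov v w hG
    exact (h2 hz).2 v hv hne ⟨(T.sum_score_eq_need_iff hbit G h v _ (hcount' v hv)).2 hgood.2, hgood.1⟩

end Tst

/-! ### Greedy search for induced copies -/

/-- `φ` maps the graph `H` on `m` vertices onto an induced subgraph of `G` that avoids `S`. -/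
structure Emb (m : ℕ) (H G : ℕ → ℕ → Prop) (S : List ℕ) (φ : ℕ → ℕ) : Prop where
  avoid : ∀ h < m, φ h ∉ S
  inj : ∀ h < m, ∀ g < m, φ h = φ g → h = g
  adj : ∀ h < m, ∀ g < m, (G (φ h) (φ g) ↔ H h g)

/-- `X` enumerates a vertex cover of the graph `G`, and the test graph has symmetric bits. -/
structure Tst.Legal (T : Tst) (G : ℕ → ℕ → Prop) : Prop where
  bit : ∀ h j, T.H h j ≤ 1
  Hsymm : ∀ h < T.m, ∀ j < T.m, T.H h j = T.H j h
  Gsymm : ∀ a b, G a b → G b a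
  Xinj : ∀ i < T.K, ∀ j < T.K, T.X i = T.X j → i = j
  cover : ∀ a b, G a b → (∃ i < T.K, T.X i = a) ∨ ∃ i < T.K, T.X i = b
  scans : T.Scans G

namespace Tst

variable {T : Tst} {G : ℕ → ℕ → Prop}

noncomputable def img (T : Tst) (S : List ℕ) (h : ℕ) : ℕ := T.find (S ++ T.images S h) h - 1

theorem images_eq (S : List ℕ) (h : ℕ) : T.images S h = (List.range h).map (T.img S) := by
  induction h with
  | zero => rfl
  | succ h ih =>
    rw [List.range_succ, List.map_append, ← ih]; rfl

/-- Injectivity of the preassignment on used cover vertices allows reindexing by the vertices of the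
test graph. -/
theorem need_eq (hP : ∀ i < T.K, ∀ j < T.K, T.P i < T.m → T.P i = T.P j → i = j) (h : ℕ) [DecidablePred fun g => ∃ i < T.K, T.P i = g] :
    T.need h = ∑ g ∈ Finset.range T.m, if ∃ i < T.K, T.P i = g then T.H h g else 0 := by
  rw [need, ← Finset.sum_filter, ← Finset.sum_filter]
  rw [← Finset.sum_image (s := (Finset.range T.K).filter fun i => T.P i < T.m) (g := T.P) (f := fun g => T.H h g)]
  · refine Finset.sum_congr ?_ fun _ _ => rfl
    ext g
    simp only [Finset.mem_image, Finset.mem_filter, Finset.mem_range]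
    constructor
    · rintro ⟨i, ⟨h1, h2⟩, rfl⟩
      exact ⟨h2, i, h1, rfl⟩
    · rintro ⟨h1, i, h2, rfl⟩
      exact ⟨i, ⟨h2, h1⟩, rfl⟩
  · intro i hi j hj hij
    simp at hi hj
    exact hP i hi.1 j hj.1 hi.2 hij

/-- `need` is then a partial sum of the degree, and equality means that no neighbour is missing from
it. -/
theorem flag_iff (hbit : ∀ h j, T.H h j ≤ 1)
    (hP : ∀ i < T.K, ∀ j < T.K, T.P i < T.m → T.P i = T.P j → i = j) (h : ℕ) :
    T.Flag h ↔ (∃ i < T.K, T.P i = h) ∨ ∀ g < T.m, T.H h g = 1 → ∃ i < T.K, T.P i = g := by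
  classical
  rw [Flag, need_eq hP]
  refine or_congr_right ?_
  have h2 : ∀ g ∈ Finset.range T.m, (if ∃ i < T.K, T.P i = g then T.H h g else 0) ≤ T.H h g := by
    intro g _; split <;> simp
  rw [eq_comm, Finset.sum_eq_sum_iff_of_le h2]
  simp only [Finset.mem_range]
  refine forall₂_congr fun g _ => ?_
  have := hbit h g
  by_cases hg : ∃ i < T.K, T.P i = g
  · simp [hg]
  · simp only [hg, if_false]
    constructor
    · intro h1 h2; omega
    · intro h1; by_contra h3; exact h1 (by omega)

/-- Pairs with a preassigned member are checked by the scans. Two other vertices have images outside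
the cover, hence non-adjacent, and `Flag` says that they are non-adjacent in the test graph as well.
-/
theorem Legal.sound (L : T.Legal G) {S : List ℕ} (hok : T.Ok S T.m) :
    Emb T.m (fun h g => T.H h g = 1) G S (T.img S) := by
  have hgood : ∀ h < T.m, T.Good G (S ++ (List.range h).map (T.img S)) h (T.img S h) := by
    intro h hh
    have := (L.scans (S ++ T.images S h) h).1 (hok h hh).2
    rw [images_eq] at this
    convert this using 1
    rw [img, images_eq]
  have hlt : ∀ g < T.m, ∀ h < g, T.img S h ≠ T.img S g := by
    intro g hg h hh heq
    refine (hgood g hg).1.1 (List.mem_append_right _ ?_)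
    rw [← heq]
    exact List.mem_map_of_mem (List.mem_range.2 hh)
  have hmap : ∀ i < T.K, T.P i < T.m → T.X i = T.img S (T.P i) := fun i hi hP =>
    ((hgood _ hP).1.2 i hi).2 rfl
  -- The enumeration includes non-injective preassignments; success excludes them, as both cover
  -- vertices would be the same image.
  have hP : ∀ i < T.K, ∀ j < T.K, T.P i < T.m → T.P i = T.P j → i = j := by
    intro i hi j hj hm he
    refine L.Xinj i hi j hj ?_
    rw [hmap i hi hm, hmap j hj (he ▸ hm), he]
  refine ⟨fun h hh hS => (hgood h hh).1.1 (List.mem_append_left _ hS), ?_, ?_⟩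
  · intro h hh g hg heq
    rcases lt_trichotomy h g with hl | hl | hl
    · exact absurd heq (hlt g hg h hl)
    · exact hl
    · exact absurd heq.symm (hlt h hh g hl)
  · intro h hh g hg
    by_cases hgm : ∃ i < T.K, T.P i = g
    · obtain ⟨i, hi, rfl⟩ := hgm
      rw [← hmap i hi hg]
      exact (hgood h hh).2 i hi hg
    · by_cases hhm : ∃ i < T.K, T.P i = h
      · obtain ⟨i, hi, rfl⟩ := hhm
        rw [← hmap i hi hh, L.Hsymm _ hh _ hg]
        refine Iff.trans ⟨L.Gsymm _ _, L.Gsymm _ _⟩ ((hgood g hg).2 i hi hh)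
      · constructor
        · intro hG
          rcases L.cover _ _ hG with ⟨i, hi, he⟩ | ⟨i, hi, he⟩
          · exact absurd ⟨i, hi, ((hgood h hh).1.2 i hi).1 he⟩ hhm
          · exact absurd ⟨i, hi, ((hgood g hg).1.2 i hi).1 he⟩ hgm
        · intro hH
          rcases (flag_iff L.bit hP h).1 (hok h hh).1 with h' | h'
          · exact absurd h' hhm
          · exact absurd (h' g hg hH) hgm

/-- Exchange argument: keep an embedding `ψ` that agrees with the greedy choices so far. If the next
choice `v` differs from `w = ψ h`, then both lie outside the cover and have the same neighbours
among the used cover vertices; composing `ψ` with the transposition of `v` and `w` restores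
agreement. -/
theorem Legal.complete (L : T.Legal G) {S : List ℕ} {φ : ℕ → ℕ}
    (hφ : Emb T.m (fun h g => T.H h g = 1) G S φ)
    (hnb : ∀ h < T.m, ∃ g < T.m, T.H h g = 1)
    (hP : ∀ i < T.K, ∀ g < T.m, (T.X i = φ g ↔ T.P i = g)) : T.Ok S T.m := by
  classical
  have hPinj : ∀ i < T.K, ∀ j < T.K, T.P i < T.m → T.P i = T.P j → i = j := by
    intro i hi j hj hm he
    refine L.Xinj i hi j hj ?_
    rw [(hP i hi _ hm).2 rfl, (hP j hj _ hm).2 he.symm]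
  have hflag : ∀ h < T.m, T.Flag h := by
    intro h hh
    rw [flag_iff L.bit hPinj]
    by_cases hm : ∃ i < T.K, T.P i = h
    · exact Or.inl hm
    · refine Or.inr fun g hg hH => ?_
      rcases L.cover _ _ ((hφ.adj h hh g hg).2 hH) with ⟨i, hi, he⟩ | ⟨i, hi, he⟩
      · exact absurd ⟨i, hi, (hP i hi h hh).1 he⟩ hm
      · exact ⟨i, hi, (hP i hi g hg).1 he⟩
  have key : ∀ h ≤ T.m, T.Ok S h ∧ ∃ ψ, Emb T.m (fun h g => T.H h g = 1) G S ψ ∧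
      (∀ i < T.K, ∀ g < T.m, (T.X i = ψ g ↔ T.P i = g)) ∧ ∀ g < h, ψ g = T.img S g := by
    intro h
    induction h with
    | zero => exact fun _ => ⟨fun g hg => absurd hg (Nat.not_lt_zero _), φ, hφ, hP, fun g hg => absurd hg (Nat.not_lt_zero _)⟩
    | succ h ih =>
      intro hh
      obtain ⟨ok, ψ, e, c, ag⟩ := ih (by omega)
      have hh' : h < T.m := hh
      have hw : T.Good G (S ++ T.images S h) h (ψ h) := by
        refine ⟨⟨?_, fun i hi => c i hi h hh'⟩, fun i hi hPi => ?_⟩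
        · rw [List.mem_append, not_or]
          refine ⟨e.avoid h hh', ?_⟩
          rw [images_eq]
          intro hmem
          obtain ⟨g, hg, hge⟩ := List.mem_map.1 hmem
          rw [List.mem_range] at hg
          rw [← ag g hg] at hge
          have := e.inj g (by omega) h hh' hge
          omega
        · rw [(c i hi _ hPi).2 rfl]
          exact e.adj h hh' _ hPi
      -- A neighbour of `h` gives `ψ h` a neighbour in G, so its block is not empty and the scan
      -- cannot fail.
      obtain ⟨g0, hg0, hH0⟩ := hnb h hh'
      have hfind := (L.scans (S ++ T.images S h) h).2 (ψ h) (ψ g0) ((e.adj h hh' g0 hg0).2 hH0) hw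
      have hv := (L.scans (S ++ T.images S h) h).1 hfind
      change T.Good G (S ++ T.images S h) h (T.img S h) at hv
      refine ⟨?_, ?_⟩
      · intro g hg
        rcases Nat.lt_succ_iff_lt_or_eq.1 hg with hg | rfl
        · exact ok g hg
        · exact ⟨hflag g hh', hfind⟩
      set v := T.img S h with hvdef
      set w := ψ h with hwdef
      by_cases hvw : v = w
      · refine ⟨ψ, e, c, fun g hg => ?_⟩
        rcases Nat.lt_succ_iff_lt_or_eq.1 hg with hg | rfl
        · exact ag g hg
        · exact hvw.symm
      -- A cover vertex equal to `v` or `w` would be assigned to `h`, and then both would equal it.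
      have hwX : ∀ i < T.K, T.X i ≠ w := fun i hi he =>
        hvw (((hv.1.2 i hi).2 ((hw.1.2 i hi).1 he)).symm.trans he)
      have hvX : ∀ i < T.K, T.X i ≠ v := fun i hi he =>
        hvw (he.symm.trans ((hw.1.2 i hi).2 ((hv.1.2 i hi).1 he)))
      have htw : ∀ i < T.K, T.P i < T.m → (G v (T.X i) ↔ G w (T.X i)) := fun i hi hm =>
        (hv.2 i hi hm).trans (hw.2 i hi hm).symm
      have hfix : ∀ i < T.K, Equiv.swap v w (T.X i) = T.X i := fun i hi =>
        Equiv.swap_apply_of_ne_of_ne (hvX i hi) (hwX i hi)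
      have hX1 : ∀ i < T.K, T.P i < T.m → ∀ a, (G (Equiv.swap v w a) (T.X i) ↔ G a (T.X i)) := by
        intro i hi hm a
        by_cases h1 : a = v
        · subst h1; rw [Equiv.swap_apply_left]; exact (htw i hi hm).symm
        · by_cases h2 : a = w
          · rw [h2, Equiv.swap_apply_right]; exact htw i hi hm
          · rw [Equiv.swap_apply_of_ne_of_ne h1 h2]
      have hGc : ∀ a b, G a b ↔ G b a := fun a b => ⟨L.Gsymm a b, L.Gsymm b a⟩
      refine ⟨fun g => Equiv.swap v w (ψ g), ⟨?_, ?_, ?_⟩, ?_, ?_⟩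
      · intro g hg
        by_cases h1 : ψ g = v
        · rw [h1, Equiv.swap_apply_left]; exact e.avoid h hh'
        · by_cases h2 : ψ g = w
          · rw [h2, Equiv.swap_apply_right]
            exact fun hS => hv.1.1 (List.mem_append_left _ hS)
          · rw [Equiv.swap_apply_of_ne_of_ne h1 h2]; exact e.avoid g hg
      · intro g hg g' hg' heq
        exact e.inj g hg g' hg' ((Equiv.swap v w).injective heq)
      · intro g hg g' hg'
        rw [← e.adj g hg g' hg']
        -- If an endpoint is in the cover, the swap fixes it and adjacency to it does not
        -- distinguish `v` from `w`; otherwise there is no edge before or after the swap.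
        by_cases hm : ∃ i < T.K, T.X i = ψ g'
        · obtain ⟨i, hi, he⟩ := hm
          have hPi : T.P i < T.m := by rw [(c i hi g' hg').1 he]; exact hg'
          rw [← he, hfix i hi]
          exact hX1 i hi hPi _
        · by_cases hm' : ∃ i < T.K, T.X i = ψ g
          · obtain ⟨i, hi, he⟩ := hm'
            have hPi : T.P i < T.m := by rw [(c i hi g hg).1 he]; exact hg
            rw [← he, hfix i hi, hGc, hGc (T.X i)]
            exact hX1 i hi hPi _
          · constructor
            · intro hG
              rcases L.cover _ _ hG with ⟨i, hi, he⟩ | ⟨i, hi, he⟩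
              · rw [eq_comm, Equiv.swap_apply_eq_iff, hfix i hi] at he
                exact absurd ⟨i, hi, he.symm⟩ hm'
              · rw [eq_comm, Equiv.swap_apply_eq_iff, hfix i hi] at he
                exact absurd ⟨i, hi, he.symm⟩ hm
            · intro hG
              rcases L.cover _ _ hG with h' | h'
              · exact absurd h' hm'
              · exact absurd h' hm
      · intro i hi g hg
        rw [← c i hi g hg]
        constructor
        · intro he
          rw [eq_comm, Equiv.swap_apply_eq_iff, hfix i hi] at he
          exact he.symm
        · intro he
          simp only [← he, hfix i hi]
      · intro g hg
        rcases Nat.lt_succ_iff_lt_or_eq.1 hg with hg | rfl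
        · have h1 : ψ g ≠ v := by
            intro he
            refine hv.1.1 (List.mem_append_right _ ?_)
            rw [images_eq, ← he, ag g hg]
            exact List.mem_map_of_mem (List.mem_range.2 hg)
          have h2 : ψ g ≠ w := by
            intro he
            have := e.inj g (by omega) h hh' he
            omega
          exact (Equiv.swap_apply_of_ne_of_ne h1 h2).trans (ag g hg)
        · simp only [← hwdef, Equiv.swap_apply_right, hvdef]
  exact (key T.m le_rfl).1

end Tst

theorem exists_digits {B : ℕ} (N : ℕ) (f : ℕ → ℕ) (hf : ∀ i < N, f i < B) :
    ∃ j < B ^ N, ∀ i < N, j / B ^ i % B = f i := by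
  induction N with
  | zero => exact ⟨0, by simp, by simp⟩
  | succ N ih =>
    obtain ⟨j, hj, hd⟩ := ih fun i hi => hf i (by omega)
    have hfN := hf N (by omega)
    have hB : 0 < B := by omega
    refine ⟨j + B ^ N * f N, ?_, fun i hi => ?_⟩
    · calc j + B ^ N * f N < B ^ N + B ^ N * f N := by omega
        _ = B ^ N * (f N + 1) := by ring
        _ ≤ B ^ N * B := Nat.mul_le_mul_left _ hfN
        _ = B ^ (N + 1) := (pow_succ _ _).symm
    · rcases Nat.lt_succ_iff_lt_or_eq.1 hi with hi | rfl
      · obtain ⟨r, rfl⟩ : ∃ r, N = i + (r + 1) := ⟨N - i - 1, by omega⟩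
        rw [pow_add, mul_assoc, Nat.add_mul_div_left _ _ (Nat.pow_pos hB), pow_succ, mul_assoc, mul_comm (B ^ r),
          mul_assoc, Nat.add_mul_mod_self_left]
        exact hd i hi
      · rw [Nat.add_mul_div_left _ _ (Nat.pow_pos hB), Nat.div_eq_of_lt hj, zero_add, Nat.mod_eq_of_lt hfN]

/-! ### Clean sets and branching -/

/-- `D` describes the family of graphs on `M i` vertices, `i < q`, and `G` with its vertex cover. -/
structure Prob.Legal (D : Prob) (G : ℕ → ℕ → Prop) : Prop where
  test : ∀ t < D.q * D.B ^ D.K, (D.tst t).Legal G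
  base : ∀ i < D.q, D.M i < D.B
  nb : ∀ i < D.q, ∀ h < D.M i, ∃ g < D.M i, D.H i h g = 1

def Prob.Has (D : Prob) (G : ℕ → ℕ → Prop) (S : List ℕ) : Prop :=
  ∃ i < D.q, ∃ φ, Emb (D.M i) (fun h g => D.H i h g = 1) G S φ

namespace Prob

variable {D : Prob} {G : ℕ → ℕ → Prop}

theorem Legal.clean_iff (L : D.Legal G) (S : List ℕ) : D.Clean S ↔ ¬ D.Has G S := by
  classical
  constructor
  · rintro hc ⟨hi, hq, φ, hφ⟩
    -- The right guess is read off the embedding; the value `D.M hi` is an admissible digit but no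
    -- vertex, so it means unused.
    let f : ℕ → ℕ := fun i => if h : ∃ g < D.M hi, D.X i = φ g then h.choose else D.M hi
    have hbase := L.base hi hq
    have hf : ∀ i < D.K, f i < D.B := by
      intro i _
      simp only [f]
      split
      · next h => have := h.choose_spec.1; omega
      · exact hbase
    obtain ⟨j, hj, hd⟩ := exists_digits D.K f hf
    obtain ⟨tq, tP⟩ := tst_P (D := D) (hi := hi) hj rfl
    set t := hi * D.B ^ D.K + j with ht
    have htlt : t < D.q * D.B ^ D.K := by
      calc t < hi * D.B ^ D.K + D.B ^ D.K := by omega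
        _ = (hi + 1) * D.B ^ D.K := by ring
        _ ≤ _ := Nat.mul_le_mul_right _ hq
    have hm : (D.tst t).m = D.M hi := by simp [tst, tq]
    have hH : (D.tst t).H = D.H hi := by simp [tst, tq]
    refine hc t htlt ((L.test t htlt).complete (φ := φ) ?_ ?_ ?_)
    · rw [hm, hH]; exact hφ
    · rw [hm, hH]; exact L.nb hi hq
    · intro i hi' g hg
      rw [tP, hd i hi']
      rw [hm] at hg
      change D.X i = φ g ↔ f i = g
      simp only [f]
      constructor
      · intro he
        have hex : ∃ g < D.M hi, D.X i = φ g := ⟨g, hg, he⟩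
        rw [dif_pos hex]
        exact hφ.inj _ hex.choose_spec.1 _ hg (hex.choose_spec.2.symm.trans he)
      · intro he
        by_cases hex : ∃ g < D.M hi, D.X i = φ g
        · rw [dif_pos hex] at he
          rw [← he]; exact hex.choose_spec.2
        · rw [dif_neg hex] at he
          omega
  · intro hn t ht hhit
    have hq : t / D.B ^ D.K < D.q := Nat.div_lt_of_lt_mul (by rwa [mul_comm])
    exact hn ⟨_, hq, _, (L.test t ht).sound hhit⟩

theorem Legal.exists_first {S : List ℕ} (h : ¬ D.Clean S) : ∃ t, D.First S t := by
  classical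
  simp only [Clean, not_forall, not_not] at h
  have h' : ∃ t, t < D.q * D.B ^ D.K ∧ D.Hit S t := by
    obtain ⟨t, h1, h2⟩ := h; exact ⟨t, h1, h2⟩
  refine ⟨Nat.find h', (Nat.find_spec h').1, (Nat.find_spec h').2, fun t' ht' hh => ?_⟩
  exact Nat.find_min h' ht' ⟨ht'.trans (Nat.find_spec h').1, hh⟩

theorem Wins.congr {dig dig' : ℕ → ℕ} {k : ℕ} {S : List ℕ} (h : Wins D dig k S)
    (hd : ∀ i, k ≤ i → i < D.l → dig i = dig' i) : Wins D dig' k S := by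
  induction h with
  | clean hk hc => exact .clean hk hc
  | @step k S t hk ht hdig h ih =>
    have e := hd k le_rfl hk
    refine .step hk ht (e ▸ hdig) ?_
    rw [← e]
    exact ih fun i hi hl => hd i (by omega) hl

/-- If some set `S'` with few further elements beyond `S` is clean, then branching can win. -/
theorem Legal.exists_wins (L : D.Legal G) (S' : Finset ℕ) (hS' : ∀ S : List ℕ, (∀ x ∈ S', x ∈ S) → D.Clean S) (hB : 0 < D.B)
    (r k : ℕ) (hk : k + r = D.l) (S : List ℕ) (hr : (S' \ S.toFinset).card ≤ r) :
    ∃ dig : ℕ → ℕ, (∀ i, dig i < D.B) ∧ Wins D dig k S := by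
  induction r generalizing k S with
  | zero =>
    refine ⟨fun _ => 0, fun _ => hB, .clean (by omega) (hS' S fun x hx => ?_)⟩
    by_contra hxS
    have : x ∈ S' \ S.toFinset := by simp [hx, hxS]
    have := Finset.card_pos.2 ⟨x, this⟩
    omega
  | succ r ih =>
    by_cases hc : D.Clean S
    · exact ⟨fun _ => 0, fun _ => hB, .clean (by omega) hc⟩
    · obtain ⟨t, ht⟩ := Legal.exists_first hc
      have hq : t / D.B ^ D.K < D.q := Nat.div_lt_of_lt_mul (by rw [mul_comm]; exact ht.1)
      have hemb := (L.test t ht.1).sound ht.2.1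
      -- Otherwise the copy would avoid `S'` too, although every list containing `S'` is clean.
      have hex : ∃ d < (D.tst t).m, (D.tst t).img S d ∈ S' := by
        by_contra hcon
        push Not at hcon
        refine (L.clean_iff (S ++ S'.toList)).1 (hS' _ fun x hx => List.mem_append_right _ (by simpa using hx))
          ⟨_, hq, (D.tst t).img S, ⟨fun h hh => ?_, hemb.inj, hemb.adj⟩⟩
        rw [List.mem_append, not_or]
        exact ⟨hemb.avoid h hh, by simpa using hcon h hh⟩
      obtain ⟨d, hd, hdS⟩ := hex
      have hget : ((D.tst t).images S (D.tst t).m).getD d 0 = (D.tst t).img S d := by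
        rw [Tst.images_eq]; simp [List.getD_eq_getElem?_getD, hd]
      obtain ⟨dig, hdig, hw⟩ := ih (k + 1) (by omega) (S ++ [(D.tst t).img S d]) (by
        have hsub : S' \ (S ++ [(D.tst t).img S d]).toFinset ⊂ S' \ S.toFinset := by
          refine Finset.ssubset_iff_subset_ne.2 ⟨?_, ?_⟩
          · intro x hx
            simp only [Finset.mem_sdiff, List.mem_toFinset, List.mem_append, not_or] at hx ⊢
            exact ⟨hx.1, hx.2.1⟩
          · intro he
            have : (D.tst t).img S d ∈ S' \ S.toFinset := by
              simp only [Finset.mem_sdiff, List.mem_toFinset]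
              exact ⟨hdS, hemb.avoid d hd⟩
            rw [← he] at this
            simp at this
        have := Finset.card_lt_card hsub
        omega)
      refine ⟨Function.update dig k d, fun i => ?_, .step (by omega) ht (by simpa using hd) ?_⟩
      · by_cases hi : i = k
        · subst hi; rw [Function.update_self]; exact hd.trans (L.base _ hq)
        · rw [Function.update_of_ne hi]; exact hdig i
      · rw [Function.update_self, hget]
        exact Wins.congr hw fun i hi _ => by rw [Function.update_of_ne (by omega)]

end Prob

end PiDel

namespace PiDel

/-! ### Vertex-minimal graphs are small -/

section Size

variable {P : GraphProperty} {c : ℕ}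

/-- Treat the vertices of `Z` one by one, deleting the edges that leave the set `D` of the current
graph. Edges only disappear, so bounds gained earlier persist. -/
theorem GraphProperty.CharacterizedBy.exists_sparse (hc : P.CharacterizedBy c) {m : ℕ} {H : SimpleGraph (Fin m)}
    (hH : P.holds H) (Z : Finset (Fin m)) :
    ∃ H' ≤ H, P.holds H' ∧ ∀ y ∈ Z, ∃ D : Finset (Fin m), D.card ≤ c ∧ ∀ u, H'.Adj y u → u ∈ D := by
  classical
  induction Z using Finset.induction_on with
  | empty => exact ⟨H, le_rfl, hH, by simp⟩
  | insert y Z _ ih =>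
    obtain ⟨H', hle, hH', hZ⟩ := ih
    obtain ⟨D, hy, hD, h⟩ := hc m H' hH' y
    let H'' : SimpleGraph (Fin m) :=
      { Adj := fun a b => H'.Adj a b ∧ (a = y → b ∈ D) ∧ (b = y → a ∈ D)
        symm := ⟨fun a b h => ⟨h.1.symm, h.2.2, h.2.1⟩⟩
        loopless := ⟨fun a h => H'.loopless.irrefl a h.1⟩ }
    refine ⟨H'', fun a b h => hle h.1, h H'' ?_ ?_, fun z hz => ?_⟩
    · intro a b ha hb
      simp [H'', ha, hb]
    · intro u hu
      refine ⟨fun h => h.1, fun h => ⟨h, fun _ => hu, fun hy' => ?_⟩⟩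
      subst hy'
      exact hu
    · rcases Finset.mem_insert.1 hz with rfl | hz
      · exact ⟨D, hD, fun u hu => hu.2.1 rfl⟩
      · obtain ⟨D', h1, h2⟩ := hZ z hz
        exact ⟨D', h1, fun u hu => h2 u hu.1⟩

/-- The sparsified graph is still in the property, hence connected with an edge. A vertex outside
`Y` therefore keeps a neighbour, necessarily in `Y`, and is counted in one of the small sets. -/
theorem GraphProperty.CharacterizedBy.card_le_of_cover (hc : P.CharacterizedBy c)
    (hP : ∀ (m : ℕ) (H : SimpleGraph (Fin m)), P.holds H → H.Connected ∧ ∃ x y, H.Adj x y)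
    {m : ℕ} {H : SimpleGraph (Fin m)} (hH : P.holds H) (Y : Finset (Fin m))
    (hY : ∀ a b, H.Adj a b → a ∈ Y ∨ b ∈ Y) : m ≤ (c + 1) * Y.card := by
  classical
  obtain ⟨H', hle, hH', hZ⟩ := hc.exists_sparse hH Y
  choose! D hD hn using hZ
  obtain ⟨hcon, x, y, hxy⟩ := hP m H' hH'
  have hcov : (Finset.univ : Finset (Fin m)) ⊆ Y ∪ Y.biUnion D := by
    intro v _
    by_cases hv : v ∈ Y
    · exact Finset.mem_union_left _ hv
    · have : Nontrivial (Fin m) := ⟨x, y, hxy.ne⟩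
      obtain ⟨u, hu⟩ := hcon.preconnected.exists_adj_of_nontrivial v
      have huY : u ∈ Y := (hY v u (hle hu)).resolve_left hv
      exact Finset.mem_union_right _ (Finset.mem_biUnion.2 ⟨u, huY, hn u huY v hu.symm⟩)
  calc m = (Finset.univ : Finset (Fin m)).card := by simp
    _ ≤ (Y ∪ Y.biUnion D).card := Finset.card_le_card hcov
    _ ≤ Y.card + Y.card * c := (Finset.card_union_le _ _).trans
        (Nat.add_le_add_left (Finset.card_biUnion_le_card_mul _ _ _ hD) _)
    _ = (c + 1) * Y.card := by ring

end Size

/-! ### Freeness is decided by the listed graphs -/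

section Free

variable {P : GraphProperty} {c : ℕ} {I : Inst} {F : List FinGraph}

/-- A contained graph of the property with fewest vertices is vertex-minimal. Its vertices mapped
into `X` form a cover of at most K vertices, so the size bound puts it on the list up to
isomorphism. -/
theorem Inst.free_iff (hP : ∀ (m : ℕ) (H : SimpleGraph (Fin m)), P.holds H → H.Connected ∧ ∃ x y, H.Adj x y)
    (hc : P.CharacterizedBy c) (hF : P.ListsMinimal ((c + 1) * I.K) F) (s : Set (Fin I.n)) :
    P.Free (I.G.induce s) ↔ ∀ H ∈ F, ¬ H.graph.IsIndContained (I.G.induce s) := by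
  classical
  refine ⟨fun h H hH => h _ _ (hF.1 H hH).1.1, fun h => ?_⟩
  by_contra hn
  simp only [GraphProperty.Free, not_forall, not_not] at hn
  have hn' : ∃ m, ∃ H : SimpleGraph (Fin m), P.holds H ∧ H.IsIndContained (I.G.induce s) := by
    obtain ⟨m, H, h1, h2⟩ := hn
    exact ⟨m, H, h1, h2⟩
  obtain ⟨H, hH, ⟨f⟩⟩ := Nat.find_spec hn'
  have hmin := fun m => Nat.find_min hn' (m := m)
  revert H
  generalize Nat.find hn' = m at hmin
  intro H hH f
  have hvm : P.VertexMinimal ⟨m, H⟩ := by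
    refine ⟨hH, fun S hS => ?_⟩
    rintro ⟨k, H1, h1, ⟨e⟩⟩
    refine hmin k ?_ ⟨H1, h1, ⟨(e.toEmbedding.trans (SimpleGraph.Embedding.induce S)).trans f⟩⟩
    have := Fintype.card_lt_of_injective_not_surjective (fun x => (e x).1 : Fin k → Fin m)
      (fun x y h => e.injective (Subtype.ext h)) (by
      intro hsurj
      refine hS (Set.eq_univ_of_forall fun x => ?_)
      obtain ⟨y, rfl⟩ := hsurj x
      exact (e y).2)
    simpa using this
  let Y : Finset (Fin m) := Finset.univ.filter fun h => (f h).1 ∈ I.X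
  have hYcard : Y.card ≤ I.K := by
    refine Finset.card_le_card_of_injOn (fun h => (f h).1) (fun h hh => ?_) ?_
    · have := hh
      simp only [Y, Finset.coe_filter, Finset.mem_univ, true_and, Set.mem_ofPred_eq] at this
      exact this
    · intro a _ b _ hab
      exact f.injective (Subtype.ext hab)
  have hsize : m ≤ (c + 1) * I.K := by
    refine (hc.card_le_of_cover hP hH Y fun a b hab => ?_).trans (Nat.mul_le_mul_left _ hYcard)
    have hadj : I.G.Adj (f a).1 (f b).1 := by
      have := f.map_rel_iff.2 hab
      exact this
    simpa [Y] using I.cover hadj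
  obtain ⟨H', hH', ⟨e⟩⟩ := hF.2 ⟨m, H⟩ hvm hsize
  exact h H' hH' ⟨e.symm.toEmbedding.trans f⟩

theorem Inst.isYes_of_K_le (hP : ∀ (m : ℕ) (H : SimpleGraph (Fin m)), P.holds H → H.Connected ∧ ∃ x y, H.Adj x y)
    (h : I.K ≤ I.ℓ) : I.IsYes P := by
  refine ⟨I.X, h, fun m H hH => ?_⟩
  rintro ⟨f⟩
  obtain ⟨-, x, y, hxy⟩ := hP m H hH
  have hadj : I.G.Adj (f x).1 (f y).1 := f.map_rel_iff.2 hxy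
  rcases I.cover hadj with h' | h'
  · exact (f x).2 h'
  · exact (f y).2 h'

end Free

/-! ### The deletion problem over the natural numbers -/

/-- Adjacency of the graph of an instance, on natural numbers. -/
def Inst.adj (I : Inst) (a b : ℕ) : Prop := ∃ (ha : a < I.n) (hb : b < I.n), I.G.Adj ⟨a, ha⟩ ⟨b, hb⟩

open Classical in
/-- The adjacency matrix, zero outside of its range. -/
noncomputable def FinGraph.bit (H : FinGraph) (a b : ℕ) : ℕ :=
  if ∃ (ha : a < H.m) (hb : b < H.m), H.graph.Adj ⟨a, ha⟩ ⟨b, hb⟩ then 1 else 0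

theorem FinGraph.bit_le (H : FinGraph) (a b : ℕ) : H.bit a b ≤ 1 := by
  unfold bit; split <;> simp

theorem FinGraph.bit_eq_one (H : FinGraph) {a b : ℕ} :
    H.bit a b = 1 ↔ ∃ (ha : a < H.m) (hb : b < H.m), H.graph.Adj ⟨a, ha⟩ ⟨b, hb⟩ := by
  unfold bit; split <;> simp_all

theorem FinGraph.bit_comm (H : FinGraph) (a b : ℕ) : H.bit a b = H.bit b a := by
  unfold bit
  congr 1
  exact propext ⟨fun ⟨h1, h2, h3⟩ => ⟨h2, h1, h3.symm⟩, fun ⟨h1, h2, h3⟩ => ⟨h2, h1, h3.symm⟩⟩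

/-- Without isolated vertices in `H`, every image has a neighbour and so is a genuine vertex below
`I.n`; nothing else forces this. -/
theorem Inst.exists_emb_iff (I : Inst) (H : FinGraph) (hnb : ∀ h < H.m, ∃ g < H.m, H.bit h g = 1) (S : List ℕ) :
    (∃ φ, Emb H.m (fun h g => H.bit h g = 1) I.adj S φ) ↔
      H.graph.IsIndContained (I.G.induce {v | v.val ∉ S}) := by
  constructor
  · rintro ⟨φ, e⟩
    have hlt : ∀ h < H.m, φ h < I.n := by
      intro h hh
      obtain ⟨g, hg, hb⟩ := hnb h hh
      exact ((e.adj h hh g hg).2 hb).1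
    refine ⟨⟨⟨fun h => ⟨⟨φ h, hlt h h.2⟩, e.avoid h h.2⟩, fun a b hab => ?_⟩, fun {a b} => ?_⟩⟩
    · simp only [Subtype.mk.injEq, Fin.mk.injEq] at hab
      exact Fin.ext (e.inj a a.2 b b.2 hab)
    · have := e.adj a a.2 b b.2
      rw [FinGraph.bit_eq_one] at this
      constructor
      · intro h
        obtain ⟨_, _, h'⟩ := this.1 ⟨hlt a a.2, hlt b b.2, h⟩
        exact h'
      · intro h
        obtain ⟨_, _, h'⟩ := this.2 ⟨a.2, b.2, h⟩
        exact h'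
  · rintro ⟨f⟩
    have hφ : ∀ h (hh : h < H.m), (if hh : h < H.m then ((f ⟨h, hh⟩).1 : ℕ) else 0) = (f ⟨h, hh⟩).1 :=
      fun h hh => dif_pos hh
    refine ⟨fun h => if hh : h < H.m then ((f ⟨h, hh⟩).1 : ℕ) else 0, fun h hh => ?_, fun h hh g hg he => ?_,
      fun h hh g hg => ?_⟩
    · rw [hφ h hh]; exact (f ⟨h, hh⟩).2
    · rw [hφ h hh, hφ g hg] at he
      have := f.injective (Subtype.ext (Fin.ext he))
      simpa using this
    · rw [hφ h hh, hφ g hg, FinGraph.bit_eq_one]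
      have := f.map_rel_iff (a := ⟨h, hh⟩) (b := ⟨g, hg⟩)
      constructor
      · rintro ⟨_, _, h'⟩
        exact ⟨hh, hg, this.1 h'⟩
      · rintro ⟨_, _, h'⟩
        exact ⟨Fin.isLt _, Fin.isLt _, this.2 h'⟩

/-- The problem given by an instance and a list of graphs, with the scanned list `τ` of items. -/
noncomputable def Inst.prob (I : Inst) (F : List FinGraph) (τ : List (ℕ × ℕ)) : Prob where
  n := I.n
  K := I.K
  l := I.ℓ
  q := F.length
  X := fun i => ((I.X.sort (· ≤ ·)).map Fin.val).getD i 0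
  M := fun i => (F.getD i ⟨0, ⊥⟩).m
  H := fun i => (F.getD i ⟨0, ⊥⟩).bit
  τ := τ
  B := maxSize (fun i => (F.getD i ⟨0, ⊥⟩).m) F.length

theorem getD_mem {α : Type*} (l : List α) (d : α) {i : ℕ} (h : i < l.length) : l.getD i d ∈ l := by
  rw [List.getD_eq_getElem _ _ h]; exact List.getElem_mem h

section Prob

variable {I : Inst} {F : List FinGraph} {τ : List (ℕ × ℕ)}

theorem Inst.length_sort : ((I.X.sort (· ≤ ·)).map Fin.val).length = I.K := by
  simp [Inst.K]

theorem Inst.prob_X_lt {i : ℕ} (hi : i < I.K) : (I.prob F τ).X i < I.n := by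
  have := getD_mem ((I.X.sort (· ≤ ·)).map Fin.val) 0 (i := i) (by rwa [Inst.length_sort])
  rw [List.mem_map] at this
  obtain ⟨a, -, ha⟩ := this
  change ((I.X.sort (· ≤ ·)).map Fin.val).getD i 0 < I.n
  rw [← ha]; exact a.2

theorem Inst.exists_prob_X {a : Fin I.n} (ha : a ∈ I.X) : ∃ i < I.K, (I.prob F τ).X i = a := by
  have : a.val ∈ (I.X.sort (· ≤ ·)).map Fin.val := List.mem_map_of_mem (by simpa using ha)
  obtain ⟨i, hi, he⟩ := List.getElem_of_mem this
  refine ⟨i, by rwa [Inst.length_sort] at hi, ?_⟩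
  change ((I.X.sort (· ≤ ·)).map Fin.val).getD i 0 = a
  rw [List.getD_eq_getElem _ _ hi, he]

theorem Inst.prob_X_inj {i j : ℕ} (hi : i < I.K) (hj : j < I.K) (h : (I.prob F τ).X i = (I.prob F τ).X j) : i = j := by
  have hnd : ((I.X.sort (· ≤ ·)).map Fin.val).Nodup := (Finset.sort_nodup _ _).map Fin.val_injective
  rw [← Inst.length_sort] at hi hj
  change ((I.X.sort (· ≤ ·)).map Fin.val).getD i 0 = ((I.X.sort (· ≤ ·)).map Fin.val).getD j 0 at h
  rw [List.getD_eq_getElem _ _ hi, List.getD_eq_getElem _ _ hj] at h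
  exact (hnd.getElem_inj_iff).1 h

variable {P : GraphProperty} {c : ℕ}

theorem exists_bit (hP : ∀ (m : ℕ) (H : SimpleGraph (Fin m)), P.holds H → H.Connected ∧ ∃ x y, H.Adj x y)
    {H : FinGraph} (hH : P.holds H.graph) : 2 ≤ H.m ∧ ∀ h < H.m, ∃ g < H.m, H.bit h g = 1 := by
  obtain ⟨hcon, x, y, hxy⟩ := hP _ _ hH
  have : Nontrivial (Fin H.m) := ⟨x, y, hxy.ne⟩
  refine ⟨Fin.nontrivial_iff_two_le.1 inferInstance, fun h hh => ?_⟩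
  obtain ⟨u, hu⟩ := hcon.preconnected.exists_adj_of_nontrivial ⟨h, hh⟩
  exact ⟨u, u.2, FinGraph.bit_eq_one _ |>.2 ⟨hh, u.2, hu⟩⟩

theorem Inst.prob_legal (hP : ∀ (m : ℕ) (H : SimpleGraph (Fin m)), P.holds H → H.Connected ∧ ∃ x y, H.Adj x y)
    (hF : ∀ H ∈ F, P.holds H.graph)
    (hs : ∀ t, ((I.prob F τ).tst t).Scans I.adj) : (I.prob F τ).Legal I.adj := by
  refine ⟨fun t _ => ⟨fun h j => FinGraph.bit_le _ _ _, fun h _ j _ => FinGraph.bit_comm _ _ _,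
    fun a b ⟨h1, h2, h3⟩ => ⟨h2, h1, h3.symm⟩, fun i hi j hj h => Inst.prob_X_inj (F := F) (τ := τ) hi hj h, ?_, hs t⟩,
    fun i hi => lt_maxSize hi, fun i hi => (exists_bit hP (hF _ (getD_mem _ _ hi))).2⟩
  rintro a b ⟨h1, h2, h3⟩
  rcases I.cover h3 with h | h
  · exact Or.inl (Inst.exists_prob_X (F := F) (τ := τ) h)
  · exact Or.inr (Inst.exists_prob_X (F := F) (τ := τ) h)

theorem Inst.prob_clean_iff (hP : ∀ (m : ℕ) (H : SimpleGraph (Fin m)), P.holds H → H.Connected ∧ ∃ x y, H.Adj x y)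
    (hc : P.CharacterizedBy c) (hF : P.ListsMinimal ((c + 1) * I.K) F)
    (hs : ∀ t, ((I.prob F τ).tst t).Scans I.adj) (S : List ℕ) :
    (I.prob F τ).Clean S ↔ P.Free (I.G.induce {v | v.val ∉ S}) := by
  have hF' : ∀ H ∈ F, P.holds H.graph := fun H hH => (hF.1 H hH).1.1
  rw [(Inst.prob_legal hP hF' hs).clean_iff, Inst.free_iff hP hc hF]
  constructor
  · intro h H hH hcont
    obtain ⟨i, hi, he⟩ := List.getElem_of_mem hH
    refine h ⟨i, hi, ?_⟩
    have hg : F.getD i ⟨0, ⊥⟩ = H := by rw [List.getD_eq_getElem _ _ hi, he]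
    change ∃ φ, Emb (F.getD i ⟨0, ⊥⟩).m (fun h g => (F.getD i ⟨0, ⊥⟩).bit h g = 1) _ _ _
    rw [hg]
    exact (I.exists_emb_iff H (exists_bit hP (hF' H hH)).2 S).2 hcont
  · rintro h ⟨i, hi, hφ⟩
    have hm : F.getD i ⟨0, ⊥⟩ ∈ F := getD_mem _ _ hi
    exact h _ hm ((I.exists_emb_iff _ (exists_bit hP (hF' _ hm)).2 S).1 hφ)

theorem Inst.isYes_of_clean (hP : ∀ (m : ℕ) (H : SimpleGraph (Fin m)), P.holds H → H.Connected ∧ ∃ x y, H.Adj x y)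
    (hc : P.CharacterizedBy c) (hF : P.ListsMinimal ((c + 1) * I.K) F)
    (hs : ∀ t, ((I.prob F τ).tst t).Scans I.adj)
    (h : ∃ S : List ℕ, S.length ≤ I.ℓ ∧ (I.prob F τ).Clean S) : I.IsYes P := by
  classical
  obtain ⟨S, hS, hcl⟩ := h
  rw [Inst.prob_clean_iff hP hc hF hs] at hcl
  refine ⟨Finset.univ.filter fun v => v.val ∈ S, ?_, ?_⟩
  swap
  · have : {v : Fin I.n | v ∉ Finset.univ.filter fun v => v.val ∈ S} = {v | v.val ∉ S} := by ext; simp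
    rwa [this]
  refine le_trans ?_ ((List.toFinset_card_le S).trans hS)
  refine Finset.card_le_card_of_injOn Fin.val (fun v hv => ?_) Fin.val_injective.injOn
  simpa using hv

theorem Inst.exists_wins_of_isYes (hP : ∀ (m : ℕ) (H : SimpleGraph (Fin m)), P.holds H → H.Connected ∧ ∃ x y, H.Adj x y)
    (hc : P.CharacterizedBy c) (hF : P.ListsMinimal ((c + 1) * I.K) F) (hq : 1 ≤ F.length)
    (hs : ∀ t, ((I.prob F τ).tst t).Scans I.adj) (h : I.IsYes P) :
    ∃ j < (I.prob F τ).B ^ I.ℓ, Wins (I.prob F τ) ((I.prob F τ).dig j) 0 [] := by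
  classical
  obtain ⟨S, hS, hfree⟩ := h
  have hF' : ∀ H ∈ F, P.holds H.graph := fun H hH => (hF.1 H hH).1.1
  have L := Inst.prob_legal (I := I) (τ := τ) hP hF' hs
  have hB : 0 < (I.prob F τ).B := lt_of_le_of_lt (Nat.zero_le _) (L.base 0 hq)
  have hcl : ∀ T : List ℕ, (∀ x ∈ S.image Fin.val, x ∈ T) → (I.prob F τ).Clean T := by
    intro T hT
    rw [Inst.prob_clean_iff hP hc hF hs]
    intro m H hH hcont
    refine hfree m H hH (hcont.trans ⟨SimpleGraph.induceHomOfLE _ fun v hv hvS => ?_⟩)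
    exact hv (hT _ (Finset.mem_image_of_mem _ hvS))
  obtain ⟨dig, hd, hw⟩ := L.exists_wins (S.image Fin.val) hcl hB I.ℓ 0 (by simp [Inst.prob]) []
    ((Finset.card_le_card Finset.sdiff_subset).trans (Finset.card_image_le.trans hS))
  obtain ⟨j, hj, hdj⟩ := exists_digits I.ℓ dig fun i _ => hd i
  exact ⟨j, hj, PiDel.Prob.Wins.congr hw fun i _ hi => (hdj i hi).symm⟩

end Prob

end PiDel

namespace PiDel

/-! ### Arithmetic bounds -/

/-- Once `n + 1 ≥ a` the factorial grows by at least the factor `a`; the constant `a ^ a` covers the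
beginning. -/
theorem exists_pow_le_mul_factorial (a : ℕ) (ha : 0 < a) : ∃ C, ∀ n : ℕ, a ^ n ≤ C * n.factorial := by
  refine ⟨a ^ a, fun n => ?_⟩
  induction n with
  | zero => simpa using Nat.one_le_pow _ _ ha
  | succ n ih =>
    by_cases h : n + 1 ≤ a
    · exact (Nat.pow_le_pow_right ha h).trans (Nat.le_mul_of_pos_right _ (Nat.factorial_pos _))
    · calc a ^ (n + 1) = a ^ n * a := pow_succ _ _
        _ ≤ a ^ a * n.factorial * (n + 1) := Nat.mul_le_mul ih (by omega)
        _ = a ^ a * (n + 1).factorial := by rw [Nat.factorial_succ]; ring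

/-- The product (n+1)⋯(2n) is at least n^n and equals n! times a central binomial coefficient. -/
theorem self_pow_le_four_pow_mul_factorial (n : ℕ) : n ^ n ≤ 4 ^ n * n.factorial := by
  calc n ^ n ≤ (n + 1) ^ n := Nat.pow_le_pow_left (Nat.le_succ n) n
    _ ≤ (n + 1).ascFactorial n := by
        have := Nat.pow_succ_le_ascFactorial (n + 1) n
        exact this
    _ = n.factorial * (n + n).choose n := Nat.ascFactorial_eq_factorial_mul_choose _ _
    _ ≤ n.factorial * 2 ^ (n + n) := Nat.mul_le_mul_left _ (Nat.choose_le_two_pow _ _)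
    _ = 4 ^ n * n.factorial := by
        rw [← two_mul, pow_mul, mul_comm]; norm_num

/-- Write k = cK. Of the two factors k^K, one is kept as c^K K^K, and the other is at most 2^k · 4^k
K!. Together with 9^K ≤ 9^k and k^3 ≤ 8^k the exponential part is 576^k, which k! absorbs. -/
theorem exists_search_bound : ∃ C, ∀ c K : ℕ, 1 ≤ c → 1 ≤ K →
    (3 * (c * K)) ^ (2 * K + 3) ≤ C * (c ^ K * K ^ K * K.factorial * (c * K).factorial) := by
  obtain ⟨C, hC⟩ := exists_pow_le_mul_factorial 576 (by norm_num)
  refine ⟨27 * C, fun c K hc hK => ?_⟩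
  set k := c * K with hk
  have hKk : K ≤ k := Nat.le_mul_of_pos_left _ hc
  have h1 : k ^ K = c ^ K * K ^ K := mul_pow _ _ _
  have h2 : c ^ K ≤ 2 ^ k := by
    rw [hk, pow_mul]; exact Nat.pow_le_pow_left Nat.lt_two_pow_self.le _
  have h3 : k ^ 3 ≤ 8 ^ k := by
    calc k ^ 3 ≤ (2 ^ k) ^ 3 := Nat.pow_le_pow_left Nat.lt_two_pow_self.le _
      _ = 8 ^ k := by rw [← pow_mul, mul_comm, pow_mul]; norm_num
  have h4 : 9 ^ K ≤ 9 ^ k := Nat.pow_le_pow_right (by norm_num) hKk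
  have h5 : 4 ^ K ≤ 4 ^ k := Nat.pow_le_pow_right (by norm_num) hKk
  have h6 := self_pow_le_four_pow_mul_factorial K
  calc (3 * k) ^ (2 * K + 3) = 27 * 9 ^ K * (k ^ K * k ^ K * k ^ 3) := by
        rw [mul_pow, pow_add 3, pow_mul 3, pow_add k, two_mul, pow_add k]; ring
    _ = 27 * (c ^ K * K ^ K) * (9 ^ K * c ^ K * k ^ 3) * K ^ K := by rw [h1]; ring
    _ ≤ 27 * (c ^ K * K ^ K) * (9 ^ k * 2 ^ k * 8 ^ k) * (4 ^ k * K.factorial) := by gcongr; exact h6.trans (by gcongr)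
    _ = 27 * (c ^ K * K ^ K) * K.factorial * 576 ^ k := by
        rw [show 576 = 9 * 2 * 8 * 4 by norm_num, mul_pow, mul_pow, mul_pow]; ring
    _ ≤ 27 * (c ^ K * K ^ K) * K.factorial * (C * k.factorial) := Nat.mul_le_mul_left _ (hC k)
    _ = _ := by ring

/-- The two time bounds are comparable. -/
theorem time_bound_mono (q c K n : ℕ) :
    q * 2 ^ K * c ^ K * K ^ (K + 3) * K.factorial * (c * K).factorial * n ≤
      q * 2 ^ K * ((c + 1) * K) ^ K * K.factorial * K * ((c + 1) * K).factorial * ((c + 1) * K) ^ 2 * n := by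
  have h1 : c ^ K * K ^ K ≤ ((c + 1) * K) ^ K := by
    rw [← mul_pow]; exact Nat.pow_le_pow_left (Nat.mul_le_mul_right _ (Nat.le_succ c)) _
  have h2 : K ^ 2 ≤ ((c + 1) * K) ^ 2 := Nat.pow_le_pow_left (Nat.le_mul_of_pos_left _ (Nat.succ_pos c)) _
  have h3 : (c * K).factorial ≤ ((c + 1) * K).factorial :=
    Nat.factorial_le (Nat.mul_le_mul_right _ (Nat.le_succ c))
  calc _ = q * 2 ^ K * (c ^ K * K ^ K) * K.factorial * K * (c * K).factorial * K ^ 2 * n := by ring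
    _ ≤ _ := by gcongr

/-- Powers of E: K-1 for the branches, 1 for the depth, K for the preassignments, and 3 for the
vertices of a test graph, the items per vertex and the work per item. -/
theorem ram_cost_le {κ q n K B E l : ℕ} (hq : 1 ≤ q) (hn : 1 ≤ n) (hK : 1 ≤ K) (hB : 1 ≤ B) (hKE : K ≤ E) (hBE : B ≤ E) :
    κ * (12 + 8 * q) + (5 * κ + B ^ min l (K - 1) * (K * ((5 * κ + q * (10 * κ + B ^ K *
      ((B * (κ * (n * K * (50 * (K + B))) + κ * (30 * (K + B)))) + κ * (20 * (K + B))))) + 20 * κ) +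
      κ * (20 * (K + B)))) ≤ 300 * κ * (q * n * E ^ (2 * K + 3)) := by
  have hE : 1 ≤ E := hK.trans hKE
  have hKB : K + B ≤ 2 * E := by omega
  have hP : 1 ≤ E ^ K := Nat.one_le_pow _ _ hE
  have hP' : 1 ≤ E ^ (K - 1) := Nat.one_le_pow _ _ hE
  have hBK : B ^ K ≤ E ^ K := Nat.pow_le_pow_left hBE _
  have hBl : B ^ min l (K - 1) ≤ E ^ (K - 1) :=
    (Nat.pow_le_pow_right hB (min_le_right _ _)).trans (Nat.pow_le_pow_left hBE _)
  have r1 : B * (κ * (n * K * (50 * (K + B))) + κ * (30 * (K + B))) + κ * (20 * (K + B)) ≤ 200 * (κ * n * E ^ 3) := by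
    have hEn : 1 ≤ E * n := Nat.mul_pos hE hn
    have hEEn : 1 ≤ E * (E * n) := Nat.mul_pos hE hEn
    calc _ ≤ E * (κ * (n * E * (50 * (2 * E))) + κ * (30 * (2 * E))) + κ * (20 * (2 * E)) := by gcongr
      _ = 100 * (κ * n * E ^ 3) + 60 * (κ * E ^ 2) * 1 + 40 * (κ * E) * 1 := by ring
      _ ≤ 100 * (κ * n * E ^ 3) + 60 * (κ * E ^ 2) * (E * n) + 40 * (κ * E) * (E * (E * n)) := by gcongr
      _ = _ := by ring
  set R := κ * n * E ^ 3 with hR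
  have hκR : κ ≤ R := by
    rw [hR, mul_assoc]; exact Nat.le_mul_of_pos_right _ (Nat.mul_pos hn (Nat.pow_pos hE))
  have hκER : κ * E ≤ R := by
    rw [hR, mul_assoc]
    refine Nat.mul_le_mul_left _ ?_
    calc E = 1 * E ^ 1 := by simp
      _ ≤ n * E ^ 3 := Nat.mul_le_mul hn (Nat.pow_le_pow_right hE (by norm_num))
  have hqP : 1 ≤ q * E ^ K := Nat.mul_pos hq hP
  have r2 : 5 * κ + q * (10 * κ + B ^ K *
      ((B * (κ * (n * K * (50 * (K + B))) + κ * (30 * (K + B)))) + κ * (20 * (K + B)))) + 20 * κ ≤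
      235 * (q * E ^ K * R) := by
    calc _ ≤ 5 * R + q * (10 * R + E ^ K * (200 * R)) + 20 * R := by gcongr
      _ = 25 * R * 1 + q * 10 * R * 1 + 200 * (q * E ^ K * R) := by ring
      _ ≤ 25 * R * (q * E ^ K) + q * 10 * R * (E ^ K) + 200 * (q * E ^ K * R) := by gcongr
      _ = _ := by ring
  set S := q * E ^ K * R with hS
  have hRS : R ≤ S := Nat.le_mul_of_pos_left _ hqP
  have hqRS : q * R ≤ S := by
    rw [hS]; exact Nat.mul_le_mul_right _ (Nat.le_mul_of_pos_right _ hP)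
  have hEP : E ^ (K - 1) * E = E ^ K := by rw [← pow_succ]; congr 1; omega
  calc _ ≤ R * (12 + 8 * q) + (5 * R + E ^ (K - 1) * (E * (235 * S) + κ * (20 * (2 * E)))) := by gcongr
    _ = 17 * R + 8 * (q * R) + 235 * ((E ^ (K - 1) * E) * S) + 40 * E ^ (K - 1) * (κ * E) := by ring
    _ ≤ 17 * S * 1 + 8 * S * 1 + 235 * (E ^ K * S) + 40 * E ^ K * S := by
        rw [hEP, mul_one, mul_one]
        have : E ^ (K - 1) ≤ E ^ K := Nat.pow_le_pow_right hE (by omega)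
        gcongr
        exact hκER.trans hRS
    _ ≤ 17 * S * E ^ K + 8 * S * E ^ K + 235 * (E ^ K * S) + 40 * E ^ K * S := by gcongr
    _ = 300 * κ * (q * n * E ^ (2 * K + 3)) := by
        rw [hS, hR, pow_add, two_mul, pow_add]; ring

/-- The true exponent is 2K+1; it is rounded up so that both algorithms share `exists_search_bound`.
-/
theorem stream_cost_le {q K B E l : ℕ} (hK : 1 ≤ K) (hB : 1 ≤ B) (hKE : K ≤ E) (hBE : B ≤ E) :
    B ^ min l (K - 1) * (K * (q * (B ^ K * (B * 1)))) ≤ q * E ^ (2 * K + 3) := by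
  have hE : 1 ≤ E := hK.trans hKE
  have hBl : B ^ min l (K - 1) ≤ E ^ (K - 1) :=
    (Nat.pow_le_pow_right hB (min_le_right _ _)).trans (Nat.pow_le_pow_left hBE _)
  calc _ ≤ E ^ (K - 1) * (E * (q * (E ^ K * (E * 1)))) := by gcongr
    _ = q * ((E ^ (K - 1) * E ^ 1) * (E ^ K * E ^ 1)) := by ring
    _ = q * E ^ (2 * K + 1) := by rw [← pow_add, ← pow_add, ← pow_add]; congr 2; omega
    _ ≤ _ := Nat.mul_le_mul_left _ (Nat.pow_le_pow_right hE (by omega))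

end PiDel

namespace PiDel

/-! ### Reading the input -/

theorem getD_flatMap {α : Type*} (l : List α) (f : α → List ℕ) (k d : ℕ) (hf : ∀ x ∈ l, (f x).length = k)
    {i j : ℕ} (hi : i < l.length) (hj : j < k) : (l.flatMap f).getD (i * k + j) d = (f l[i]).getD j d := by
  induction l generalizing i with
  | nil => exact absurd hi (Nat.not_lt_zero _)
  | cons x l ih =>
    have hx := hf x List.mem_cons_self
    cases i with
    | zero =>
      rw [List.flatMap_cons, zero_mul, zero_add, List.getD_append _ _ _ _ (by omega)]
      rfl
    | succ i =>
      rw [List.flatMap_cons, List.getD_append_right _ _ _ _ (by rw [hx, Nat.succ_mul]; omega), hx]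
      have : (i + 1) * k + j - k = i * k + j := by rw [Nat.succ_mul]; omega
      rw [this, ih (fun y hy => hf y (List.mem_cons_of_mem _ hy)) (by simpa using hi)]
      rfl

theorem length_matrixCells {m : ℕ} (G : SimpleGraph (Fin m)) : (matrixCells G).length = m * m := by
  classical
  simp [matrixCells, List.length_flatMap]

theorem getD_matrixCells (H : FinGraph) {a b : ℕ} (ha : a < H.m) (hb : b < H.m) :
    (matrixCells H.graph).getD (a * H.m + b) 0 = H.bit a b := by
  classical
  rw [matrixCells, getD_flatMap _ _ H.m 0 (by simp) (by simpa using ha) hb]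
  simp [List.getD_eq_getElem?_getD, hb, FinGraph.bit, ha]

theorem le_one_of_mem_matrixCells {m : ℕ} {G : SimpleGraph (Fin m)} {x : ℕ} (hx : x ∈ matrixCells G) : x ≤ 1 := by
  classical
  simp only [matrixCells, List.mem_flatMap, List.mem_map] at hx
  obtain ⟨_, -, _, -, rfl⟩ := hx
  split <;> simp

theorem familyCells_append (F F' : List FinGraph) : familyCells (F ++ F') = familyCells F ++ familyCells F' :=
  List.flatMap_append

theorem familyCells_cons (H : FinGraph) (F : List FinGraph) :
    familyCells (H :: F) = (H.m :: matrixCells H.graph) ++ familyCells F :=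
  List.flatMap_cons

theorem length_familyCells_take_le (F : List FinGraph) (i : ℕ) :
    (familyCells (F.take i)).length ≤ (familyCells F).length := by
  conv_rhs => rw [← List.take_append_drop i F, familyCells_append, List.length_append]
  exact Nat.le_add_right _ _

theorem length_familyCells (F : List FinGraph) : (familyCells F).length = (F.map fun H => 1 + H.m * H.m).sum := by
  simp [familyCells, List.length_flatMap, length_matrixCells, add_comm]

theorem getD_append_familyCells (l : List ℕ) (F : List FinGraph) {i x : ℕ} (hi : i < F.length)
    (hx : x < 1 + (F.getD i ⟨0, ⊥⟩).m * (F.getD i ⟨0, ⊥⟩).m) :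
    l.length + (familyCells (F.take i)).length + x < (l ++ familyCells F).length ∧
    (l ++ familyCells F).getD (l.length + (familyCells (F.take i)).length + x) 0 =
      ((F.getD i ⟨0, ⊥⟩).m :: matrixCells (F.getD i ⟨0, ⊥⟩).graph).getD x 0 := by
  rw [List.getD_eq_getElem _ _ hi] at *
  have hsplit : familyCells F = familyCells (F.take i) ++
      ((F[i].m :: matrixCells F[i].graph) ++ familyCells (F.drop (i + 1))) := by
    rw [← familyCells_cons, ← familyCells_append, ← List.drop_eq_getElem_cons hi, List.take_append_drop]
  have hlen : x < (F[i].m :: matrixCells F[i].graph).length := by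
    simp only [List.length_cons, length_matrixCells]; omega
  constructor
  · rw [hsplit]; simp only [List.length_append]; omega
  · rw [hsplit, List.getD_append_right _ _ _ _ (by omega), List.getD_append_right _ _ _ _ (by omega),
      List.getD_append _ _ _ _ (by omega)]
    congr 1
    omega

theorem length_familyCells_take_succ (F : List FinGraph) {i : ℕ} (hi : i < F.length) :
    (familyCells (F.take (i + 1))).length =
      (familyCells (F.take i)).length + 1 + (F.getD i ⟨0, ⊥⟩).m * (F.getD i ⟨0, ⊥⟩).m := by
  rw [List.getD_eq_getElem _ _ hi, List.take_succ_eq_append_getElem hi, familyCells_append, familyCells_cons]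
  simp only [List.length_append, List.length_cons, length_matrixCells, familyCells, List.flatMap_nil, List.length_nil]
  omega

theorem length_headCells (I : Inst) (q : ℕ) : (I.headCells q).length = 4 + I.K := by
  simp [Inst.headCells, Inst.K]
  omega

/-- Where the description of the graph number `i` starts. -/
noncomputable def familyOffset (base : ℕ) (F : List FinGraph) (i : ℕ) : ℕ := base + (familyCells (F.take i)).length

/-- The graph `F[i]` needs less space than the whole family. -/
theorem maxSize_le_length_familyCells (F : List FinGraph) (hq : 1 ≤ F.length) :
    maxSize (fun i => (F.getD i ⟨0, ⊥⟩).m) F.length ≤ (familyCells F).length := by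
  have h : ∀ i < F.length, (F.getD i ⟨0, ⊥⟩).m + 1 ≤ (familyCells F).length := by
    intro i hi
    have h1 := length_familyCells_take_le F (i + 1)
    rw [length_familyCells_take_succ F hi] at h1
    have := Nat.le_mul_self (F.getD i ⟨0, ⊥⟩).m
    omega
  have hpos : 1 ≤ (familyCells F).length := le_trans (by omega) (h 0 hq)
  have := maxSize_le (M := fun i => (F.getD i ⟨0, ⊥⟩).m) (j := F.length) (b := (familyCells F).length - 1)
    fun i hi => by have := h i hi; omega
  omega

section Setup

variable {I : Inst} {F : List FinGraph} {τ : List (ℕ × ℕ)} {mid : List ℕ}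

theorem getD_head (x : ℕ) (hx : x < 4 + I.K) :
    (I.headCells F.length ++ mid ++ familyCells F).getD x 0 = (I.headCells F.length).getD x 0 := by
  rw [List.append_assoc, List.getD_append _ _ _ _ (by rwa [length_headCells])]

theorem Inst.length_input : (I.headCells F.length ++ mid ++ familyCells F).length =
    4 + I.K + mid.length + (familyCells F).length := by
  simp only [List.length_append, length_headCells]

theorem Inst.K_le_n : I.K ≤ I.n := by
  simpa [Inst.K] using Finset.card_le_univ I.X

/-- The number `s` bounds everything in sight. -/
structure Scale (I : Inst) (F : List FinGraph) (mid : List ℕ) (τ : List (ℕ × ℕ)) (s : ℕ) : Prop where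
  len : (I.headCells F.length ++ mid ++ familyCells F).length ≤ s
  n_lt : I.n < s
  mid_le : ∀ x ∈ mid, x ≤ 1
  count : τ.length ≤ I.n * I.n
  fst : ∀ it ∈ τ, it.1 < I.n
  graphs : ∀ H ∈ F, 2 ≤ H.m
  q_pos : 1 ≤ F.length

theorem le_pow_four {s x : ℕ} (hx : x ≤ s * s * (s * s)) : x ≤ s ^ 4 := hx.trans (by ring_nf; exact le_rfl)

namespace Scale

variable {s : ℕ} (h : Scale I F mid τ s)

include h

theorem B_le : (I.prob F τ).B ≤ (familyCells F).length := maxSize_le_length_familyCells F h.q_pos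

theorem two_lt_B : 2 < (I.prob F τ).B :=
  lt_of_le_of_lt (h.graphs _ (getD_mem _ ⟨0, ⊥⟩ h.q_pos)) (lt_maxSize (M := fun i => (F.getD i ⟨0, ⊥⟩).m) h.q_pos)

/-- The input contains K cover cells and at least B family cells, so the work area is at most three
times as long. -/
theorem length_sum : 3 * (I.K + (I.prob F τ).B) + (I.headCells F.length ++ mid ++ familyCells F).length ≤ 4 * s := by
  have h1 := h.B_le
  have h2 := Inst.length_input (I := I) (F := F) (mid := mid)
  have h3 := h.len
  omega

theorem four_le : 4 ≤ s := by
  have h2 := Inst.length_input (I := I) (F := F) (mid := mid)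
  have h3 := h.len
  omega

theorem small {x : ℕ} (hx : x ≤ 4 * s) : x ≤ s ^ 4 := by
  have h4 := h.four_le
  refine le_pow_four (hx.trans ?_)
  calc 4 * s ≤ s * s := Nat.mul_le_mul_right _ h4
    _ ≤ s * s * (s * s) := Nat.le_mul_of_pos_right _ (by positivity)

theorem input_le {x : ℕ} (hx : x ∈ I.headCells F.length ++ mid ++ familyCells F) : x ≤ s := by
  have h2 := Inst.length_input (I := I) (F := F) (mid := mid)
  have h3 := h.len
  have h4 := h.n_lt
  have h5 := Inst.K_le_n (I := I)
  have h6 := I.budget_le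
  have h7 := h.B_le
  have h8 : F.length ≤ (familyCells F).length := by
    rw [length_familyCells]
    calc F.length = (F.map fun _ => 1).sum := by simp
      _ ≤ _ := List.sum_le_sum fun H _ => Nat.le_add_right _ _
  simp only [List.mem_append, Inst.headCells, List.mem_cons, List.not_mem_nil, or_false, List.mem_map] at hx
  rcases hx with ((((rfl | rfl | rfl | rfl) | ⟨a, -, rfl⟩) | hx) | hx)
  · omega
  · omega
  · omega
  · omega
  · have := a.2; omega
  · have := h.mid_le x hx; omega
  · simp only [familyCells, List.mem_flatMap, List.mem_cons] at hx
    obtain ⟨H, hH, rfl | hx⟩ := hx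
    · obtain ⟨i, hi, rfl⟩ := List.getElem_of_mem hH
      have := lt_maxSize (M := fun i => (F.getD i ⟨0, ⊥⟩).m) hi
      rw [List.getD_eq_getElem _ _ hi] at this
      change F[i].m < (I.prob F τ).B at this
      omega
    · have := le_one_of_mem_matrixCells hx; omega

end Scale

/-- The configuration for an instance. -/
noncomputable def Scale.cfg {s : ℕ} (h : Scale I F mid τ s) (L : Layout) (σ : List (ℕ × ℕ)) (α β : ℕ)
    (hreg : ∀ r < 64, (s ^ 4) ^ 12 < 2 ^ L.reg r)
    (hmem : ∀ a, (I.headCells F.length ++ mid ++ familyCells F).length ≤ a →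
      a < (I.headCells F.length ++ mid ++ familyCells F).length + 3 * (I.K + (I.prob F τ).B) →
      I.n + (I.prob F τ).B < 2 ^ L.mem a) : Cfg where
  L := L
  σ := σ
  α := α
  β := β
  V := s ^ 4
  Vm := I.n + (I.prob F τ).B
  W0 := (I.headCells F.length ++ mid ++ familyCells F).length
  ws := 3 * (I.K + (I.prob F τ).B)
  inp := fun a => (I.headCells F.length ++ mid ++ familyCells F).getD a 0
  p := 24
  g := fun r => if r = 24 then I.K else if r = 25 then F.length else if r = 26 then I.ℓ else if r = 27 then I.n else
    if r = 28 then 4 + I.K + mid.length else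
    if r = 29 then (I.headCells F.length ++ mid ++ familyCells F).length else if r = 30 then (I.prob F τ).B else 0
  hV := h.small (by have := h.four_le; omega)
  hreg := hreg
  hinp := fun a ha => h.small ((h.input_le (getD_mem _ _ ha)).trans (by omega))
  hVm := h.small (by
    have h1 := h.n_lt
    have h2 := h.length_sum
    omega)
  hmem := hmem
  hp := by norm_num

theorem Scale.setup {s : ℕ} (h : Scale I F mid τ s) (L : Layout) (σ : List (ℕ × ℕ)) (α β : ℕ)
    (hreg : ∀ r < 64, (s ^ 4) ^ 12 < 2 ^ L.reg r)
    (hmem : ∀ a, (I.headCells F.length ++ mid ++ familyCells F).length ≤ a →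
      a < (I.headCells F.length ++ mid ++ familyCells F).length + 3 * (I.K + (I.prob F τ).B) →
      I.n + (I.prob F τ).B < 2 ^ L.mem a) :
    Setup (h.cfg L σ α β hreg hmem) (I.prob F τ) (familyOffset (4 + I.K + mid.length) F) := by
  have hlen : (I.headCells F.length ++ mid).length = 4 + I.K + mid.length := by simp [length_headCells]
  have h2 := Inst.length_input (I := I) (F := F) (mid := mid)
  have hfam : ∀ i < F.length, ∀ x < 1 + (F.getD i ⟨0, ⊥⟩).m * (F.getD i ⟨0, ⊥⟩).m, _ :=
    fun i hi x hx => getD_append_familyCells (I.headCells F.length ++ mid) F hi hx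
  rw [hlen] at hfam
  have h1 := h.n_lt
  have h3 := h.length_sum
  have h5 := Inst.K_le_n (I := I)
  have h4 := h.four_le
  refine ⟨rfl, rfl, rfl, rfl, rfl, rfl, rfl, rfl, ?_, ?_, ?_, fun i h j => FinGraph.bit_le _ _ _, ?_,
    fun i hi => lt_maxSize hi, le_rfl, Nat.le_add_left _ _, Nat.le_add_right _ _, ?_, h.small ?_, h.small h3, ?_,
    h.fst, h.two_lt_B.le⟩
  · intro i hi
    change i < I.K at hi
    refine ⟨?_, ?_⟩
    · change 4 + i < (I.headCells F.length ++ mid ++ familyCells F).length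
      omega
    · change (I.headCells F.length ++ mid ++ familyCells F).getD (4 + i) 0 = _
      rw [getD_head _ (by omega), Inst.headCells, List.getD_append_right _ _ _ _ (by simp)]
      simp [Inst.prob]
  · intro i hi
    have := hfam i hi 0 (by omega)
    exact this
  · intro i hi a ha b hb
    change a < (F.getD i ⟨0, ⊥⟩).m at ha
    change b < (F.getD i ⟨0, ⊥⟩).m at hb
    have hlt : a * (F.getD i ⟨0, ⊥⟩).m + b < (F.getD i ⟨0, ⊥⟩).m * (F.getD i ⟨0, ⊥⟩).m :=
      calc _ < a * (F.getD i ⟨0, ⊥⟩).m + (F.getD i ⟨0, ⊥⟩).m := by omega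
        _ = (a + 1) * (F.getD i ⟨0, ⊥⟩).m := by ring
        _ ≤ _ := Nat.mul_le_mul_right _ ha
    obtain ⟨e1, e2⟩ := hfam i hi (a * (F.getD i ⟨0, ⊥⟩).m + b + 1) (by omega)
    have he : familyOffset (4 + I.K + mid.length) F i + 1 + a * (I.prob F τ).M i + b =
        4 + I.K + mid.length + (familyCells (F.take i)).length + (a * (F.getD i ⟨0, ⊥⟩).m + b + 1) := by
      change 4 + I.K + mid.length + (familyCells (F.take i)).length + 1 + a * (F.getD i ⟨0, ⊥⟩).m + b = _
      omega
    rw [he]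
    refine ⟨e1, e2.trans ?_⟩
    rw [List.getD_cons_succ]
    exact getD_matrixCells _ ha hb
  · intro i hi
    change i < F.length at hi
    have e := length_familyCells_take_succ F hi
    have h1 := length_familyCells_take_le F (i + 1)
    refine ⟨?_, ?_⟩
    · simp only [familyOffset, e]
      change _ = 4 + I.K + mid.length + (familyCells (F.take i)).length + 1 + (F.getD i ⟨0, ⊥⟩).m * (F.getD i ⟨0, ⊥⟩).m
      omega
    · change 4 + I.K + mid.length + (familyCells (F.take (i + 1))).length ≤
        (I.headCells F.length ++ mid ++ familyCells F).length
      omega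
  · exact lt_of_lt_of_le h1 (h.small (by omega))
  · have := h.input_le (x := F.length) (by simp [Inst.headCells])
    change F.length ≤ _
    omega
  -- This count is what makes `V` a fourth power: up to n² items, each scoring up to K(K+1).
  · refine le_pow_four ?_
    have c := h.count
    change (τ.length + 1) * (I.K * (I.K + 1)) ≤ _
    refine Nat.mul_le_mul ?_ (Nat.mul_le_mul (by omega) (by omega))
    calc τ.length + 1 ≤ I.n * I.n + 1 := by omega
      _ ≤ (I.n + 1) * (I.n + 1) := by ring_nf; omega
      _ ≤ s * s := Nat.mul_le_mul h1 h1

end Setup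

end PiDel

namespace PiDel

section Run

variable {I : Inst} {F : List FinGraph} {τ : List (ℕ × ℕ)} {mid : List ℕ} {P : GraphProperty} {c : ℕ}

/-! ### The two presentations of the graph -/

/-- The padding value `I.n` is no cover vertex and scores nothing; as K ≥ 1, every vertex has a
non-empty block. -/
theorem ramItems_scans (hK : 1 ≤ I.K)
    (hτ : τ = ramItems I.n I.K (I.prob F τ).X (FinGraph.bit ⟨I.n, I.G⟩) I.n) (t : ℕ) :
    ((I.prob F τ).tst t).Scans I.adj := by
  classical
  refine Tst.scans_of_blocks _ (fun h j => FinGraph.bit_le _ _ _) I.adj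
    (fun v => (List.range I.K).map fun i =>
      if FinGraph.bit ⟨I.n, I.G⟩ v ((I.prob F τ).X i) = 1 then (I.prob F τ).X i else I.n)
    (List.range I.n) List.nodup_range ?_ ?_ ?_
  · refine hτ.trans ?_
    simp only [ramItems, List.map_map]
    rfl
  · intro v _ i hi
    change i < I.K at hi
    change (I.adj v ((I.prob F τ).X i) ∧ _ = 1) ∨ (¬ I.adj v ((I.prob F τ).X i) ∧ _ = 0)
    have hX := Inst.prob_X_lt (F := F) (τ := τ) hi
    have hadj : I.adj v ((I.prob F τ).X i) ↔ FinGraph.bit ⟨I.n, I.G⟩ v ((I.prob F τ).X i) = 1 :=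
      (FinGraph.bit_eq_one ⟨I.n, I.G⟩).symm
    rw [hadj]
    by_cases hb : FinGraph.bit ⟨I.n, I.G⟩ v ((I.prob F τ).X i) = 1
    · refine Or.inl ⟨hb, ?_⟩
      rw [List.count, List.countP_map]
      rw [List.countP_congr (q := fun j => j == i)]
      · exact List.count_eq_one_of_mem List.nodup_range (List.mem_range.2 hi)
      · intro j hj
        rw [List.mem_range] at hj
        simp only [Function.comp, beq_iff_eq]
        constructor
        · intro he
          split at he
          · exact Inst.prob_X_inj hj hi he
          · exact absurd (he.trans (show ((I.prob F τ).tst t).X i = (I.prob F τ).X i from rfl)) (by omega)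
        · rintro rfl
          rw [if_pos hb]; rfl
    · refine Or.inr ⟨hb, ?_⟩
      rw [List.count_eq_zero]
      intro hmem
      obtain ⟨j, hj, he⟩ := List.mem_map.1 hmem
      rw [List.mem_range] at hj
      change _ = (I.prob F τ).X i at he
      split at he
      · next h => rw [he] at h; exact hb h
      · omega
  · rintro v w ⟨h1, h2, h3⟩
    refine ⟨List.mem_range.2 h1, ?_⟩
    intro h
    have := congrArg List.length h
    simp at this
    omega

variable {σ : List (ℕ × ℕ)}

theorem IsALStream.exists_nat {n : ℕ} {G : SimpleGraph (Fin n)} (h : IsALStream G σ) :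
    ∃ (order : List ℕ) (nb : ℕ → List ℕ), order.Nodup ∧ (∀ v, v ∈ order ↔ v < n) ∧
      (∀ v, (nb v).Nodup ∧ ∀ u, u ∈ nb v ↔ ∃ (hv : v < n) (hu : u < n), G.Adj ⟨v, hv⟩ ⟨u, hu⟩) ∧
      σ = order.flatMap fun v => (nb v).map fun u => (v, u) := by
  obtain ⟨order, nbrs, h1, h2, h3, h4⟩ := h
  refine ⟨order.map Fin.val, fun v => if hv : v < n then (nbrs ⟨v, hv⟩).map Fin.val else [],
    h1.map Fin.val_injective, fun v => ?_, fun v => ?_, ?_⟩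
  · constructor
    · intro h
      obtain ⟨a, -, rfl⟩ := List.mem_map.1 h
      exact a.2
    · intro h
      exact List.mem_map.2 ⟨⟨v, h⟩, h2 _, rfl⟩
  · by_cases hv : v < n
    · simp only [dif_pos hv]
      refine ⟨(h3 _).1.map Fin.val_injective, fun u => ?_⟩
      constructor
      · intro h
        obtain ⟨a, ha, rfl⟩ := List.mem_map.1 h
        exact ⟨hv, a.2, ((h3 _).2 a).1 ha⟩
      · rintro ⟨_, hu, h⟩
        exact List.mem_map.2 ⟨⟨u, hu⟩, ((h3 _).2 _).2 h, rfl⟩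
    · simp [hv]
  · rw [h4, List.flatMap_map]
    refine List.flatMap_congr fun v _ => ?_
    simp [List.map_map, Function.comp_def]

theorem IsALStream.mem {n : ℕ} {G : SimpleGraph (Fin n)} (h : IsALStream G σ) {it : ℕ × ℕ} (hit : it ∈ σ) :
    it.1 < n ∧ it.2 < n := by
  obtain ⟨order, nbrs, -, -, -, rfl⟩ := h
  obtain ⟨v, -, hv⟩ := List.mem_flatMap.1 hit
  obtain ⟨u, -, rfl⟩ := List.mem_map.1 hv
  exact ⟨v.2, u.2⟩

theorem IsALStream.length_le {n : ℕ} {G : SimpleGraph (Fin n)} (h : IsALStream G σ) : σ.length ≤ n * n := by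
  obtain ⟨order, nbrs, h1, -, h3, rfl⟩ := h
  rw [List.length_flatMap]
  calc _ ≤ (order.map fun _ => n).sum := List.sum_le_sum fun v _ => by
        rw [List.length_map]
        simpa using (h3 v).1.length_le_card
    _ = order.length * n := by simp
    _ ≤ n * n := Nat.mul_le_mul_right _ (by simpa using h1.length_le_card)

theorem IsALStream.scans (h : IsALStream I.G σ) (t : ℕ) : ((I.prob F σ).tst t).Scans I.adj := by
  obtain ⟨order, nb, h1, h2, h3, h4⟩ := h.exists_nat
  refine Tst.scans_of_blocks _ (fun h j => FinGraph.bit_le _ _ _) I.adj nb order h1 h4 ?_ ?_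
  · intro v _ i _
    by_cases hb : I.adj v (((I.prob F σ).tst t).X i)
    · exact Or.inl ⟨hb, List.count_eq_one_of_mem (h3 v).1 (((h3 v).2 _).2 hb)⟩
    · exact Or.inr ⟨hb, List.count_eq_zero.2 fun hm => hb (((h3 v).2 _).1 hm)⟩
  · rintro v w ⟨hv, hw, hvw⟩
    exact ⟨(h2 v).2 hv, List.ne_nil_of_mem (((h3 v).2 w).2 ⟨hv, hw, hvw⟩)⟩

/-! ### Running the algorithm -/

theorem Scale.run {s : ℕ} (h : Scale I F mid τ s) (L : Layout) (σ : List (ℕ × ℕ)) (α β : ℕ)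
    (hreg : ∀ r < 64, (s ^ 4) ^ 12 < 2 ^ L.reg r)
    (hmem : ∀ a, (I.headCells F.length ++ mid ++ familyCells F).length ≤ a →
      a < (I.headCells F.length ++ mid ++ familyCells F).length + 3 * (I.K + (I.prob F τ).B) →
      I.n + (I.prob F τ).B < 2 ^ L.mem a)
    (hP : ∀ (m : ℕ) (H : SimpleGraph (Fin m)), P.holds H → H.Connected ∧ ∃ x y, H.Adj x y)
    (hc : P.CharacterizedBy c) (hF : P.ListsMinimal ((c + 1) * I.K) F)
    (hs : ∀ t, ((I.prob F τ).tst t).Scans I.adj) {fb : E} (ok : fb.ok = true)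
    (hfb : ∀ u', u'.v 24 = I.K → u'.v 27 = I.n → fb.eval u' = 4 + I.K + mid.length) {drive : Prog} {T : ℕ}
    (hd : DriveSpec (h.cfg L σ α β hreg hmem) (I.prob F τ) (familyOffset (4 + I.K + mid.length) F) drive T) :
    ∃ s' : State, Exec L σ (mainP fb drive) (State.start (I.headCells F.length ++ mid ++ familyCells F)) s' ∧
      (s'.reg 0 = 1 ↔ I.IsYes P) ∧
      α * s'.time + β * s'.passes ≤ 100 * α * (12 + 8 * F.length) + (5 * (100 * α) +
        (I.prob F τ).B ^ min I.ℓ (I.K - 1) * (I.K * ((h.cfg L σ α β hreg hmem).scost (I.prob F τ) T +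
          20 * (100 * α)) + 100 * α * (20 * (I.K + (I.prob F τ).B)))) := by
  have hS := h.setup L σ α β hreg hmem
  have h2 := Inst.length_input (I := I) (F := F) (mid := mid)
  have h3 := h.len
  have h4 := h.n_lt
  have hin : ∀ x < 4, (I.headCells F.length ++ mid ++ familyCells F).getD x 0 = (I.headCells F.length).getD x 0 :=
    fun x hx => getD_head x (by omega)
  have hoff : familyOffset (4 + I.K + mid.length) F F.length =
      (I.headCells F.length ++ mid ++ familyCells F).length := by
    simp only [familyOffset, List.take_length, h2]
  obtain ⟨s', e, r1, r2, r3⟩ := main_exec hd hS _ rfl rfl (hin 0 (by norm_num)) (hin 1 (by norm_num))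
    (hin 2 (by norm_num)) (hin 3 (by norm_num))
    (by change 4 ≤ (I.headCells F.length ++ mid ++ familyCells F).length; omega)
    (h.small (by have := I.budget_le; change I.ℓ ≤ _; omega)) rfl hoff ok hfb
    (by refine h.small ?_; change 4 + I.K + mid.length ≤ _; omega) rfl
  refine ⟨s', e, ?_, r3⟩
  rcases Nat.lt_or_ge I.ℓ I.K with hl | hl
  · exact ⟨fun h1 => Inst.isYes_of_clean hP hc hF hs ((r1 hl).1 h1),
      fun hy => (r1 hl).2 (Inst.exists_wins_of_isYes hP hc hF h.q_pos hs hy)⟩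
  · exact ⟨fun _ => Inst.isYes_of_K_le hP hl, fun _ => r2 hl⟩

/-- The parameters are positive and the listed graphs are small. -/
theorem param_bounds (hP : ∀ (m : ℕ) (H : SimpleGraph (Fin m)), P.holds H → H.Connected ∧ ∃ x y, H.Adj x y)
    (hc : P.CharacterizedBy c) (hF : P.ListsMinimal ((c + 1) * I.K) F) (hq : 1 ≤ F.length) :
    1 ≤ c ∧ 1 ≤ I.K ∧ 1 ≤ I.n ∧ (∀ H ∈ F, 2 ≤ H.m ∧ H.m ≤ 2 * (c * I.K)) ∧
      (I.prob F τ).B ≤ 3 * (c * I.K) := by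
  have hgraph : ∀ H ∈ F, 2 ≤ H.m := fun H hH => (exists_bit hP (hF.1 H hH).1.1).1
  have hmem := getD_mem F ⟨0, ⊥⟩ hq
  have h2 := hgraph _ hmem
  have hle := (hF.1 _ hmem).2
  have hK : 1 ≤ I.K := by
    by_contra h
    have : I.K = 0 := by omega
    rw [this] at hle
    omega
  -- For `c = 0` all edges could be removed without leaving the property.
  have hc1 : 1 ≤ c := by
    by_contra h
    obtain rfl : c = 0 := by omega
    obtain ⟨H', -, hH', hZ⟩ := hc.exists_sparse (hF.1 _ hmem).1.1 Finset.univ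
    obtain ⟨-, x, y, hxy⟩ := hP _ _ hH'
    obtain ⟨D, hD, hn⟩ := hZ x (Finset.mem_univ _)
    rw [Nat.le_zero, Finset.card_eq_zero] at hD
    subst hD
    simpa using hn y hxy
  have hkK : I.K ≤ c * I.K := Nat.le_mul_of_pos_left _ hc1
  have hsz : (c + 1) * I.K ≤ 2 * (c * I.K) := by rw [Nat.succ_mul]; omega
  have hKn : I.K ≤ I.n := Inst.K_le_n
  refine ⟨hc1, hK, hK.trans hKn, fun H hH => ⟨hgraph H hH, (hF.1 H hH).2.trans hsz⟩, ?_⟩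
  have := maxSize_le (M := fun i => (F.getD i ⟨0, ⊥⟩).m) (j := F.length) (b := 2 * (c * I.K))
    fun i hi => (hF.1 _ (getD_mem F _ hi)).2.trans hsz
  exact this.trans (by omega)

end Run

/-! ### The random access machine -/

def ramBase : E := .op .add (.op .add (.c 4) (.v 24)) (.op .mul (.v 27) (.v 27))

theorem exists_ram_constant : ∃ C : ℕ, ∀ (P : GraphProperty) (c : ℕ),
    (∀ (m : ℕ) (H : SimpleGraph (Fin m)), P.holds H → H.Connected ∧ ∃ x y, H.Adj x y) →
    P.CharacterizedBy c → ∀ (I : Inst) (F : List FinGraph), 1 ≤ F.length → P.ListsMinimal ((c + 1) * I.K) F →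
    ∀ w : ℕ, (I.ramInput F).length ^ 49 ≤ 2 ^ w →
      ∃ s : State, Exec (Layout.word w) [] (mainP ramBase ramP) (State.start (I.ramInput F)) s ∧
        (s.reg 0 = 1 ↔ I.IsYes P) ∧
        s.time ≤ C * (F.length * 2 ^ I.K * c ^ I.K * I.K ^ (I.K + 3) * I.K.factorial * (c * I.K).factorial * I.n) := by
  obtain ⟨C, hC⟩ := exists_search_bound
  refine ⟨30000 * C, fun P c hP hc I F hq hF w hw => ?_⟩
  let τ := ramItems I.n I.K (I.prob F []).X (FinGraph.bit ⟨I.n, I.G⟩) I.n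
  obtain ⟨hc1, hK1, hn1, hgr, hB⟩ := param_bounds (τ := τ) hP hc hF hq
  have hKn : I.K ≤ I.n := Inst.K_le_n
  have hnn : I.n ≤ I.n * I.n := Nat.le_mul_self _
  have hleneq : (I.ramInput F).length = 4 + I.K + I.n * I.n + (familyCells F).length := by
    simp only [Inst.ramInput, List.length_append, length_headCells, length_matrixCells]
  have h : Scale I F (matrixCells I.G) τ (I.ramInput F).length := by
    refine ⟨le_rfl, by omega, fun x hx => le_one_of_mem_matrixCells hx, ?_, ?_, fun H hH => (hgr H hH).1, hq⟩
    · rw [length_ramItems]; exact Nat.mul_le_mul_left _ hKn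
    · intro it hit
      simp only [τ, ramItems, List.mem_flatMap, List.mem_map, List.mem_range] at hit
      obtain ⟨a, ha, i, -, rfl⟩ := hit
      exact ha
  have h4 := h.four_le
  set N := (I.ramInput F).length with hN
  -- Values are at most `N ^ 4` and expressions have degree at most 12; the exponent 49 leaves one
  -- factor for strictness.
  have hword : (N ^ 4) ^ 12 < 2 ^ w := by
    refine lt_of_lt_of_le ?_ hw
    rw [← pow_mul]
    exact Nat.pow_lt_pow_right (by omega) (by norm_num)
  have hsum := h.length_sum
  have hV : N ^ 4 < 2 ^ w := lt_of_le_of_lt (Nat.le_self_pow (by norm_num) _) hword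
  have hreg : ∀ r < 64, (N ^ 4) ^ 12 < 2 ^ (Layout.word w).reg r := fun _ _ => hword
  have hmem : ∀ a, (I.headCells F.length ++ matrixCells I.G ++ familyCells F).length ≤ a →
      a < (I.headCells F.length ++ matrixCells I.G ++ familyCells F).length + 3 * (I.K + (I.prob F τ).B) →
      I.n + (I.prob F τ).B < 2 ^ (Layout.word w).mem a := by
    intro a ha ha'
    have h1 := h.small (x := a) (by omega)
    have h2 : (Layout.word w).mem a = w := if_pos (by omega)
    rw [h2]
    refine lt_of_le_of_lt (h.small ?_) hV
    have := h.n_lt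
    omega
  have hl : (matrixCells I.G).length = I.n * I.n := length_matrixCells _
  have hS := h.setup (Layout.word w) [] 1 0 hreg hmem
  have hd := ram_drive hS (FinGraph.bit ⟨I.n, I.G⟩) (fun a b => FinGraph.bit_le _ _ _) (by
    intro a ha b hb
    change a < I.n at ha
    change b < I.n at hb
    have hlt : a * I.n + b < I.n * I.n :=
      calc _ < a * I.n + I.n := by omega
        _ = (a + 1) * I.n := by ring
        _ ≤ _ := Nat.mul_le_mul_right _ ha
    constructor
    · change 4 + I.K + a * I.n + b < N
      omega
    · change (I.headCells F.length ++ matrixCells I.G ++ familyCells F).getD (4 + I.K + a * I.n + b) 0 = _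
      rw [List.append_assoc, List.getD_append_right _ _ _ _ (by rw [length_headCells]; omega), length_headCells,
        List.getD_append _ _ _ _ (by omega)]
      rw [show 4 + I.K + a * I.n + b - (4 + I.K) = a * I.n + b by omega]
      exact getD_matrixCells ⟨I.n, I.G⟩ ha hb)
    (fun i hi => Inst.prob_X_lt hi) rfl
  obtain ⟨s, e, hyes, ht⟩ := h.run (Layout.word w) [] 1 0 hreg hmem hP hc hF (fun t => ramItems_scans hK1 rfl t)
    (fb := ramBase) rfl (fun u' h1 h2 => by simp only [ramBase, E.eval, Op.eval, h1, h2, hl]) hd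
  refine ⟨s, e, hyes, ?_⟩
  rw [one_mul, zero_mul, add_zero] at ht
  have hkK : I.K ≤ c * I.K := Nat.le_mul_of_pos_left _ hc1
  calc s.time ≤ _ := ht
    _ ≤ _ := ram_cost_le hq hn1 hK1 (by have := h.two_lt_B; omega) (E := 3 * (c * I.K)) (by omega) hB
    _ ≤ 300 * (100 * 1) * (F.length * I.n * (C * (c ^ I.K * I.K ^ I.K * I.K.factorial * (c * I.K).factorial))) := by
        exact Nat.mul_le_mul_left _ (Nat.mul_le_mul_left _ (hC c I.K hc1 hK1))
    _ = 30000 * C * (F.length * 1 * c ^ I.K * (I.K ^ I.K * 1) * I.K.factorial * (c * I.K).factorial * I.n) := by ring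
    -- The factors 2^K and K^3 of the claimed bound are pure slack here.
    _ ≤ 30000 * C * (F.length * 2 ^ I.K * c ^ I.K * (I.K ^ I.K * I.K ^ 3) * I.K.factorial *
        (c * I.K).factorial * I.n) := by
        gcongr
        · exact Nat.one_le_two_pow
        · exact Nat.one_le_pow _ _ hK1
    _ = _ := by rw [pow_add]

end PiDel

namespace PiDel

/-! ### The streaming machine -/

theorem size_add_le (x y : ℕ) : Nat.size (x + y) ≤ Nat.size x + Nat.size y := by
  rw [Nat.size_le, pow_add]
  have hx := Nat.lt_size_self x
  have hy := Nat.lt_size_self y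
  calc x + y < (x + 1) * (y + 1) := by nlinarith
    _ ≤ _ := Nat.mul_le_mul hx hy

theorem size_le_log (n : ℕ) : Nat.size n ≤ Nat.log 2 n + 1 :=
  Nat.size_le.2 (Nat.lt_pow_succ_log_self (by norm_num) n)

theorem size_le_self (n : ℕ) : Nat.size n ≤ n := Nat.size_le.2 Nat.lt_two_pow_self

theorem pow_lt_two_pow_size (s : ℕ) : (s ^ 4) ^ 12 < 2 ^ (48 * Nat.size s) := by
  rw [← pow_mul, mul_comm 48, pow_mul 2]
  exact Nat.pow_lt_pow_left (Nat.lt_size_self s) (by norm_num)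

/-- The number of bits of the cells of a list. -/
def cellBits (l : List ℕ) : ℕ := (l.map fun x => max 1 (Nat.size x)).sum

theorem cellBits_append (l l' : List ℕ) : cellBits (l ++ l') = cellBits l + cellBits l' := by
  simp [cellBits]

theorem cellBits_cons (x : ℕ) (l : List ℕ) : cellBits (x :: l) = max 1 (Nat.size x) + cellBits l := by
  simp [cellBits]

theorem cellBits_le {l : List ℕ} {b : ℕ} (h : ∀ x ∈ l, max 1 (Nat.size x) ≤ b) : cellBits l ≤ l.length * b := by
  have := List.sum_le_card_nsmul (l.map fun x => max 1 (Nat.size x)) b (by simpa using h)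
  simpa [cellBits] using this

theorem sum_range_getD (l : List ℕ) (f : ℕ → ℕ) :
    ∑ a ∈ Finset.range l.length, f (l.getD a 0) = (l.map f).sum := by
  induction l with
  | nil => simp
  | cons x l ih =>
    rw [List.length_cons, Finset.sum_range_succ', List.map_cons, List.sum_cons, ← ih, add_comm]
    rfl

theorem cellBits_familyCells_le (F : List FinGraph) {p : ℕ} (hp : 1 ≤ p) (hF : ∀ H ∈ F, H.m ≤ 2 * p) :
    cellBits (familyCells F) ≤ 10 * (F.length * p ^ 2) := by
  induction F with
  | nil => simp [familyCells, cellBits]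
  | cons H F ih =>
    have hm := hF H List.mem_cons_self
    have h1 := ih fun H' h => hF H' (List.mem_cons_of_mem _ h)
    have h2 : cellBits (matrixCells H.graph) ≤ H.m * H.m * 1 := by
      rw [← length_matrixCells H.graph]
      refine cellBits_le fun x hx => ?_
      have := le_one_of_mem_matrixCells hx
      have := size_le_self x
      omega
    have h3 : max 1 (Nat.size H.m) ≤ 2 * p := by
      have := size_le_self H.m
      omega
    rw [familyCells_cons, cellBits_append, cellBits_cons, List.length_cons]
    have h4 : H.m * H.m ≤ 2 * p * (2 * p) := Nat.mul_le_mul hm hm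
    nlinarith

theorem length_familyCells_le (F : List FinGraph) {p : ℕ} (hp : 1 ≤ p) (hF : ∀ H ∈ F, H.m ≤ 2 * p) :
    (familyCells F).length ≤ 10 * (F.length * p ^ 2) := by
  refine le_trans ?_ (cellBits_familyCells_le F hp hF)
  simpa [cellBits] using List.card_nsmul_le_sum ((familyCells F).map fun x => max 1 (Nat.size x)) 1 (by simp)

theorem cellBits_headCells_le (I : Inst) {q : ℕ} (hq : 1 ≤ q) (hK : I.K ≤ I.n) :
    cellBits (I.headCells q) ≤ q + (3 + I.K) * (Nat.log 2 I.n + 1) := by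
  have h : ∀ x ≤ I.n, max 1 (Nat.size x) ≤ Nat.log 2 I.n + 1 := by
    intro x hx
    have := (Nat.size_le_size hx).trans (size_le_log I.n)
    omega
  have h1 := h I.n le_rfl
  have h2 := h I.K hK
  have h3 := h I.ℓ I.budget_le
  have h4 : cellBits ((I.X.sort (· ≤ ·)).map Fin.val) ≤ I.K * (Nat.log 2 I.n + 1) := by
    rw [← Inst.length_sort]
    refine cellBits_le fun x hx => ?_
    obtain ⟨a, -, rfl⟩ := List.mem_map.1 hx
    exact h _ a.2.le
  have h5 := size_le_self q
  simp only [Inst.headCells, List.cons_append, List.nil_append, cellBits_cons]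
  have : (3 + I.K) * (Nat.log 2 I.n + 1) = 3 * (Nat.log 2 I.n + 1) + I.K * (Nat.log 2 I.n + 1) := by ring
  omega

/-- Storage for `input` and `ws` further cells of `wm` bits, with registers of `W` bits. -/
def Layout.cells (W : ℕ) (input : List ℕ) (ws wm : ℕ) : Layout where
  reg := fun r => if r < 64 then W else 0
  mem := fun a => if a < input.length then Nat.size (input.getD a 0) else if a < input.length + ws then wm else 0

theorem Layout.cells_bitsAtMost {W : ℕ} (input : List ℕ) (ws : ℕ) {wm : ℕ} (hW : 1 ≤ W) (hwm : 1 ≤ wm) :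
    (Layout.cells W input ws wm).BitsAtMost (64 * W + (cellBits input + ws * wm)) := by
  refine ⟨64, input.length + ws, fun r hr => if_neg (by omega), fun a ha => ?_, ?_⟩
  · simp only [Layout.cells]
    rw [if_neg (by omega), if_neg (by omega)]
  · refine Nat.add_le_add ?_ ?_
    · refine (Finset.sum_le_card_nsmul _ _ W fun r hr => ?_).trans (by simp)
      rw [Finset.mem_range] at hr
      simp only [Layout.cells, if_pos hr]
      omega
    · rw [Finset.sum_range_add]
      refine Nat.add_le_add ?_ ?_
      · rw [cellBits, ← sum_range_getD]
        refine Finset.sum_le_sum fun a ha => ?_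
        rw [Finset.mem_range] at ha
        simp only [Layout.cells, if_pos ha]
        exact le_rfl
      · refine (Finset.sum_le_card_nsmul _ _ wm fun a ha => ?_).trans (by simp)
        rw [Finset.mem_range] at ha
        simp only [Layout.cells]
        rw [if_neg (by omega), if_pos (by omega)]
        omega

theorem Layout.cells_mem {W : ℕ} {input : List ℕ} {ws wm a : ℕ} (h : input.length ≤ a) (h' : a < input.length + ws) :
    (Layout.cells W input ws wm).mem a = wm := by
  simp only [Layout.cells]
  rw [if_neg (by omega), if_pos h']

theorem Layout.cells_reg {W : ℕ} {input : List ℕ} {ws wm r : ℕ} (h : r < 64) :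
    (Layout.cells W input ws wm).reg r = W := if_pos h

theorem Layout.cells_holds (W : ℕ) (input : List ℕ) (ws wm : ℕ) : (Layout.cells W input ws wm).Holds input := by
  intro a
  by_cases h : a < input.length
  · simp only [Layout.cells, if_pos h]
    exact Nat.lt_size_self _
  · rw [List.getD_eq_default _ _ (by omega)]
    positivity

def streamBase : E := .op .add (.c 4) (.v 24)

/-- The layout depends on the instance and the family only, not on the stream. Space is made up of
64 registers, the input cells at their exact sizes, and 3(K+B) work cells that hold numbers up to
n+B. -/
theorem exists_stream_constant : ∃ C : ℕ, ∀ (P : GraphProperty) (c : ℕ),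
    (∀ (m : ℕ) (H : SimpleGraph (Fin m)), P.holds H → H.Connected ∧ ∃ x y, H.Adj x y) →
    P.CharacterizedBy c → ∀ (I : Inst) (F : List FinGraph), 1 ≤ F.length → P.ListsMinimal ((c + 1) * I.K) F →
    ∃ L : Layout, L.BitsAtMost (C * (F.length * (c * I.K) ^ 2) * (Nat.log 2 I.n + 1) ^ 1) ∧
      L.Holds (I.streamInput F) ∧ ∀ σ : List (ℕ × ℕ), IsALStream I.G σ →
      ∃ s : State, Exec L σ (mainP streamBase streamP) (State.start (I.streamInput F)) s ∧
        (s.reg 0 = 1 ↔ I.IsYes P) ∧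
        s.passes ≤ C * (F.length * 2 ^ I.K * c ^ I.K * I.K ^ (I.K + 2) * I.K.factorial * (c * I.K).factorial) := by
  obtain ⟨C, hC⟩ := exists_search_bound
  refine ⟨C + 100000, fun P c hP hc I F hq hF => ?_⟩
  have hinput : I.streamInput F = I.headCells F.length ++ [] ++ familyCells F := by simp [Inst.streamInput]
  rw [hinput]
  set input := I.headCells F.length ++ [] ++ familyCells F with hinp
  obtain ⟨hc1, hK1, hn1, hgr, hB⟩ := param_bounds (τ := []) hP hc hF hq
  have hKn : I.K ≤ I.n := Inst.K_le_n
  have hkK : I.K ≤ c * I.K := Nat.le_mul_of_pos_left _ hc1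
  set B := (I.prob F []).B with hBdef
  set s := input.length + I.n + 1 with hs
  set lg := Nat.log 2 I.n + 1 with hlg
  have hlg1 : 1 ≤ lg := Nat.le_add_left _ _
  refine ⟨Layout.cells (48 * Nat.size s) input (3 * (I.K + B)) (Nat.size (I.n + B)), ?_, Layout.cells_holds _ _ _ _, ?_⟩
  · have hpos : ∀ x, 1 ≤ x → 1 ≤ Nat.size x := fun x hx => Nat.size_pos.2 hx
    obtain ⟨R, B', h1, h2, h3⟩ := Layout.cells_bitsAtMost (W := 48 * Nat.size s) input (3 * (I.K + B))
      (wm := Nat.size (I.n + B)) (by have := hpos s (by omega); omega) (hpos _ (by omega))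
    refine ⟨R, B', h1, h2, h3.trans ?_⟩
    set k := c * I.K with hk
    have hk1 : 1 ≤ k := hK1.trans hkK
    set Q := F.length * k ^ 2 with hQ
    have hkk : k ≤ k ^ 2 := Nat.le_self_pow (by norm_num) k
    have hkQ : k ^ 2 ≤ Q := Nat.le_mul_of_pos_left _ hq
    have hqQ : F.length ≤ Q := Nat.le_mul_of_pos_right _ (by positivity)
    have hfam := length_familyCells_le F hk1 fun H hH => (hgr H hH).2
    have hfamb := cellBits_familyCells_le F hk1 fun H hH => (hgr H hH).2
    have hhead := cellBits_headCells_le I hq hKn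
    rw [← hlg] at hhead
    have hlen : input.length = 4 + I.K + (familyCells F).length := by
      simp [hinp, length_headCells]
    -- Only n must enter logarithmically; the input length may be bounded linearly, as a multiple of
    -- `Q` is available anyway.
    have hs1 : Nat.size s ≤ 16 * Q + lg := by
      have e : s = (input.length + 1) + I.n := by omega
      rw [e]
      refine (size_add_le _ _).trans (Nat.add_le_add ((size_le_self _).trans ?_) (size_le_log _))
      rw [hlen]
      omega
    have hwm : Nat.size (I.n + B) ≤ lg + 3 * k :=
      (size_add_le _ _).trans (Nat.add_le_add (size_le_log _) ((size_le_self _).trans hB))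
    have hws : 3 * (I.K + B) * Nat.size (I.n + B) ≤ 12 * k * (lg + 3 * k) :=
      Nat.mul_le_mul (by omega) hwm
    have hib : cellBits input ≤ F.length + (3 + I.K) * lg + 10 * Q := by
      rw [hinp, List.append_nil, cellBits_append]; omega
    have hQl : Q ≤ Q * lg := Nat.le_mul_of_pos_right _ hlg1
    have hlQ : lg ≤ Q * lg := Nat.le_mul_of_pos_left _ (by omega)
    have hkl : k * lg ≤ Q * lg := Nat.mul_le_mul_right _ (by omega)
    have hKl : I.K * lg ≤ Q * lg := Nat.mul_le_mul_right _ (by omega)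
    calc 64 * (48 * Nat.size s) + (cellBits input + 3 * (I.K + B) * Nat.size (I.n + B))
        ≤ 64 * (48 * (16 * Q + lg)) + ((F.length + (3 + I.K) * lg + 10 * Q) + 12 * k * (lg + 3 * k)) := by
          gcongr
      _ = 49162 * Q + 3072 * lg + F.length + 3 * lg + I.K * lg + 12 * (k * lg) + 36 * k ^ 2 := by ring
      _ ≤ 100000 * (Q * lg) := by omega
      _ ≤ (C + 100000) * (Q * lg) := Nat.mul_le_mul_right _ (Nat.le_add_left _ _)
      _ = (C + 100000) * Q * lg ^ 1 := by ring
  · intro σ hσ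
    have h : Scale I F [] σ s := by
      refine ⟨by rw [← hinp]; omega, by omega, by simp, hσ.length_le, fun it hit => (hσ.mem hit).1, fun H hH => (hgr H hH).1, hq⟩
    have hBσ : (I.prob F σ).B = B := rfl
    have hreg : ∀ r < 64, (s ^ 4) ^ 12 <
        2 ^ (Layout.cells (48 * Nat.size s) input (3 * (I.K + B)) (Nat.size (I.n + B))).reg r := by
      intro r hr
      rw [Layout.cells_reg hr]
      exact pow_lt_two_pow_size s
    have hmem : ∀ a, (I.headCells F.length ++ [] ++ familyCells F).length ≤ a →
        a < (I.headCells F.length ++ [] ++ familyCells F).length + 3 * (I.K + (I.prob F σ).B) →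
        I.n + (I.prob F σ).B <
          2 ^ (Layout.cells (48 * Nat.size s) input (3 * (I.K + B)) (Nat.size (I.n + B))).mem a := by
      intro a ha ha'
      rw [← hinp] at ha
      rw [← hinp, hBσ] at ha'
      rw [Layout.cells_mem ha ha', hBσ]
      exact Nat.lt_size_self _
    have hS := h.setup _ σ 0 1 hreg hmem
    have hd := stream_drive hS rfl rfl (fun it hit => h.small (by
      have := (hσ.mem hit).2
      omega))
    obtain ⟨s', e, hyes, ht⟩ := h.run _ σ 0 1 hreg hmem hP hc hF hσ.scans
      (fb := streamBase) rfl (fun u' h1 h2 => by simp [streamBase, E.eval, Op.eval, h1]) hd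
    refine ⟨s', e, hyes, ?_⟩
    have ht' : s'.passes ≤ B ^ min I.ℓ (I.K - 1) * (I.K * (F.length * (B ^ I.K * (B * 1)))) := by
      have hκ : (h.cfg _ σ 0 1 hreg hmem).κ = 0 := rfl
      simp only [Cfg.scost, Cfg.round, hκ] at ht
      simp only [zero_mul, one_mul, mul_zero, zero_add, add_zero] at ht
      exact ht
    calc s'.passes ≤ _ := ht'
      _ ≤ F.length * (3 * (c * I.K)) ^ (2 * I.K + 3) :=
        stream_cost_le hK1 (by have : 2 < B := h.two_lt_B; omega) (by omega) hB
      _ ≤ F.length * (C * (c ^ I.K * I.K ^ I.K * I.K.factorial * (c * I.K).factorial)) :=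
        Nat.mul_le_mul_left _ (hC c I.K hc1 hK1)
      _ = C * (F.length * 1 * c ^ I.K * (I.K ^ I.K * 1) * I.K.factorial * (c * I.K).factorial) := by ring
      _ ≤ (C + 100000) * (F.length * 2 ^ I.K * c ^ I.K * (I.K ^ I.K * I.K ^ 2) * I.K.factorial *
          (c * I.K).factorial) := by
        gcongr
        · omega
        · exact Nat.one_le_two_pow
        · exact Nat.one_le_pow _ _ hK1
      _ = _ := by rw [pow_add]

end PiDel

/-! ### Both algorithms together -/

theorem mainTheorem6 :
    -- random access algorithm
    (∃ (prog : PiDel.Prog) (C d : ℕ),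
      ∀ (P : PiDel.GraphProperty) (c : ℕ),
        (∀ (m : ℕ) (H : SimpleGraph (Fin m)), P.holds H → H.Connected ∧ ∃ x y, H.Adj x y) →
        P.CharacterizedBy c →
        ∀ (I : PiDel.Inst) (F : List PiDel.FinGraph) (K q : ℕ),
          K = I.K → q = F.length → 1 ≤ q →
          P.ListsMinimal ((c + 1) * K) F →
          ∀ w : ℕ, (I.ramInput F).length ^ d ≤ 2 ^ w →
            ∃ s : PiDel.State,
              PiDel.Exec (PiDel.Layout.word w) [] prog (PiDel.State.start (I.ramInput F)) s ∧
              (s.reg 0 = 1 ↔ I.IsYes P) ∧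
              s.time ≤ C * (q * 2 ^ K * ((c + 1) * K) ^ K * K.factorial * K *
                ((c + 1) * K).factorial * ((c + 1) * K) ^ 2 * I.n) ∧
              s.time ≤ C * (q * 2 ^ K * c ^ K * K ^ (K + 3) * K.factorial *
                (c * K).factorial * I.n)) ∧
    -- streaming algorithm in the adjacency list model
    (∃ (prog : PiDel.Prog) (C d : ℕ),
      ∀ (P : PiDel.GraphProperty) (c : ℕ),
        (∀ (m : ℕ) (H : SimpleGraph (Fin m)), P.holds H → H.Connected ∧ ∃ x y, H.Adj x y) →
        P.CharacterizedBy c →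
        ∀ (I : PiDel.Inst) (F : List PiDel.FinGraph) (K q : ℕ),
          K = I.K → q = F.length → 1 ≤ q →
          P.ListsMinimal ((c + 1) * K) F →
          ∃ L : PiDel.Layout,
            L.BitsAtMost (C * (q * (c * K) ^ 2) * (Nat.log 2 I.n + 1) ^ d) ∧
            L.Holds (I.streamInput F) ∧
            ∀ σ : List (ℕ × ℕ), PiDel.IsALStream I.G σ →
              ∃ s : PiDel.State,
                PiDel.Exec L σ prog (PiDel.State.start (I.streamInput F)) s ∧
                (s.reg 0 = 1 ↔ I.IsYes P) ∧
                s.passes ≤ C * (q * 2 ^ K * c ^ K * K ^ (K + 2) * K.factorial *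
                  (c * K).factorial)) := by
  obtain ⟨C, hC⟩ := PiDel.exists_ram_constant
  obtain ⟨C', hC'⟩ := PiDel.exists_stream_constant
  refine ⟨⟨PiDel.mainP PiDel.ramBase PiDel.ramP, C, 49, ?_⟩, ⟨PiDel.mainP PiDel.streamBase PiDel.streamP, C', 1, ?_⟩⟩
  · rintro P c hP hc I F K q rfl rfl hq hF w hw
    obtain ⟨s, e, hy, ht⟩ := hC P c hP hc I F hq hF w hw
    exact ⟨s, e, hy, ht.trans (Nat.mul_le_mul_left _ (PiDel.time_bound_mono _ _ _ _)), ht⟩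
  · rintro P c hP hc I F K q rfl rfl hq hF
    exact hC' P c hP hc I F hq hF
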